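/- **Setting.** Let $p\ge 1$. A *multipatch spline domain* consists of finitely many patches $\Omega_k=F_k((0,1)^2)\subset\mathbb R^2$, $k=1,\dots,K$, where each $F_k$ is a $C^1$ diffeomorphism of the closed square $[0,1]^2$ onto its image (injective, $C^1$ up to the boundary, with invertible derivative everywhere). The $\Omega_k$ are pairwise disjoint and geometrically conforming: for $k\ne l$ the set $\overline{\Omega_k}\cap\overline{\Omega_l}$ is empty, or a single common vertex, or a single common edge (the image of a side of the square under both maps) on which the parametrizations $F_k,F_l$ agree up to orientation. The domain $\Omega=\operatorname{int}\bigcup_k\overline{\Omega_k}$ has Lipschitz boundary. Each patch carries a knot vector $0=\xi^k_0=\dots=\xi^k_p<\xi^k_{p+1}<\dots<\xi^k_{n_k+1}=\dots=\xi^k_{n_k+1+p}=1$ with at least three cells ($n_k+1-p\ge 3$), the degree-$p$ B-splines $\lambda^k_0,\dots,\lambda^k_{n_k}$, their span $\mathbb V_k$, and the functions $\Lambda^k_{(i,j)}=(\lambda^k_i\otimes\lambda^k_j)\circ F_k^{-1}$ on $\Omega_k$, extended by $0$. The broken space $V^0_{pw}$ is the space of $v\in L^2(\Omega)$ with $v\circ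 F_k\in\mathbb V_k\otimes\mathbb V_k$ for all $k$; its basis is $(\Lambda^k_{\boldsymbol i})$. The conforming space is $V^0_h=V^0_{pw}\cap H^1(\Omega)$. An interior edge is an edge of two different patches. Resolutions are nested: every interior edge $e$ is shared by two patches $k^-=k^-(e)$, $k^+=k^+(e)$ such that, as spaces of functions of the common parameter along $e$, $\mathbb V_{k^-}\subset\mathbb V_{k^+}$; such a labelling is fixed. Let $0\le r\le p+1$. **Local numbering.** At a vertex or an edge, logical coordinates and basis functions of each adjacent patch are renumbered (and reflected where necessary) so that index $0$ belongs to that vertex or edge. In such a numbering, let $\gamma^{k}=(M^k)^{-1}b^k\in\mathbb R^r$, with $M^k$ the matrix with entries $\int_0^1\lambda^k_m q_j$ (row $j$, column $m$; $1\le j,m\le r$), $b^k_j=\int_0^1\lambda^k_0q_j$ and $q_j(x)=x^{j-1}$; so $\sum_{m=1}^r\gamma^k_m\lambda^k_m$ has the same moments as $\lambda^k_0$ against polynomials of degree $\le r-1$. **Vertex operators.** Let $\mathcal K(v)$ be the set of patches containing the vertex $v$. $P_v$ is the linear map on $V^0_{pw}$ given, for $k\in\mathcal K(v)$, by $$P_v\Lambda^k_{\boldsymbol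 0}=\frac1{\#\mathcal K(v)}\sum_{k'\in\mathcal K(v)}\Lambda^{k'}_{\boldsymbol 0}+\sum_{m_1,m_2=1}^r\gamma^k_{m_1}\gamma^k_{m_2}\Lambda^k_{\boldsymbol m}-\frac1{\#\mathcal K(v)}\sum_{k'\in\mathcal K(v)}\sum_{m_1,m_2=1}^r\gamma^{k'}_{m_1}\gamma^{k'}_{m_2}\Lambda^{k'}_{\boldsymbol m}$$ (each $\gamma^k_{m_t}$ computed in the direction $t$ from the end at $v$), and by the identity on all other basis functions. **Edge operators.** On a boundary edge $P_e=\mathrm{id}$. On an interior edge write $\pm$ for $k^\pm(e)$, let the first index be parallel and the second perpendicular to $e$, and let $\mathcal F^0$ be the push-forward to $\Omega_{k^-}\cup\Omega_{k^+}$, where $\lambda^{\pm}_{\perp,m}$ denotes the perpendicular basis function on the patch $k^\pm$, extended by $0$ to the other patch. Let $\bar\lambda_\perp=\frac12(\lambda^-_{\perp,0}+\lambda^+_{\perp,0})$ and $C=\frac12\sum_{m=1}^r(\gamma^-_m\lambda^-_{\perp,m}-\gamma^+_m\lambda^+_{\perp,m})$. For each end point of $e$, $\mu^+$ is the combination $\sum_{m=1}^r\gamma^+_m\lambda^+_m$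 in the numbering from that end point. Writing $\phi_i$ for B-spline coefficients, the restriction $\mathcal R:\mathbb V_{k^+}\to\mathbb V_{k^-}$ is $\mathcal R\phi=\phi_0\lambda^-_0+\phi_{n_+}\lambda^-_{n_-}+\tilde{\mathcal T}\tilde{\mathcal R}(\phi-\phi_0\lambda^-_0-\phi_{n_+}\lambda^-_{n_-})$, where $\tilde{\mathcal R}$ is the $L^2(0,1)$-projection onto $\mathbb V_{k^-}$ and $\tilde{\mathcal T}$ replaces $\lambda^-_0$ by $\sum_{m=1}^r\gamma^-_m\lambda^-_m$ and $\lambda^-_{n_-}$ by $\sum_{m=1}^r\gamma^-_m\lambda^-_{n_--m}$ (here $\gamma^-$ is computed from the respective end) and fixes the other $\lambda^-_i$. With $\mu^-=\lambda^-_i+\mathcal R(\mu^+-\lambda^+_{i'})$ at the end point of $e$ with index $i\in\{0,n_-\}$ on $k^-$ and $i'\in\{0,n_+\}$ on $k^+$, $$P_e\Lambda^-_{(i,0)}=\mathcal F^0\big(\lambda^-_i\otimes\bar\lambda_\perp+a_i\otimes C\big),\qquad P_e\Lambda^+_{(i,0)}=\mathcal F^0\big(\mathcal R\lambda^+_i\otimes\bar\lambda_\perp-\mathcal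 R b_i\otimes C\big),$$ where $a_i=\lambda^-_i$, $b_i=\lambda^+_i$ if $i$ is not an end index, and $a_i=\mu^-$, $b_i=\mu^+$ (at the corresponding end point) if it is; $P_e$ is the identity on all other basis functions. **Theorem.** Put $P_V=\prod_vP_v$ and $P_E=\prod_eP_e$ over all patch vertices and edges. Then $P^0=P_EP_V$ does not depend on the order of the factors in the two products, it is a projection of $V^0_{pw}$ onto $V^0_h$ (that is, $P^0\phi\in V^0_h$ for all $\phi\in V^0_{pw}$ and $P^0\phi=\phi$ for all $\phi\in V^0_h$), and it preserves logical polynomial moments of order $r$: for every $v\in V^0_{pw}$, every patch $k$ and every polynomial $q$ of degree at most $r-1$ in each variable (only $q=0$ if $r=0$), $$\int_{(0,1)^2}(P^0v)(F_k(\hat x))\,q(\hat x)\,d\hat x=\int_{(0,1)^2}v(F_k(\hat x))\,q(\hat x)\,d\hat x .$$ -/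

import Mathlib

open MeasureTheory Set
open scoped ContDiff Matrix

noncomputable section

namespace BrokenFEEC

/-- The physical plane. -/
abbrev Plane := EuclideanSpace ℝ (Fin 2)

/-! ### Univariate clamped splines -/

/-- The Cox–de Boor recursion: `bspline ξ q i` is the B-spline of degree `q` with knots
`ξ i, …, ξ (i + q + 1)`. Fractions `0 / 0` are `0`, as usual. The degree-zero functions are the
indicators of the half-open knot spans, the last nonempty one being closed at the end point `1`. -/
def bspline (ξ : ℕ → ℝ) : ℕ → ℕ → ℝ → ℝ
  | 0, i, x => if (ξ i ≤ x ∧ x < ξ (i + 1)) ∨ (x = 1 ∧ ξ i < 1 ∧ ξ (i + 1) = 1) then 1 else 0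
  | q + 1, i, x =>
      (x - ξ i) / (ξ (i + q + 1) - ξ i) * bspline ξ q i x +
      (ξ (i + q + 2) - x) / (ξ (i + q + 2) - ξ (i + 1)) * bspline ξ q (i + 1) x

/-- An open (clamped) knot vector of degree `p` on `[0, 1]` with simple interior knots,
`0 = ξ 0 = ⋯ = ξ p < ξ (p+1) < ⋯ < ξ (n+1) = ⋯ = ξ (n+1+p) = 1`
(the sequence is continued by `1`; the later entries are never used),
whose number `n + 1 - p` of cells is at least three. -/
structure Knots (p : ℕ) where
  n : ℕ
  ξ : ℕ → ℝ
  left : ∀ i, i ≤ p → ξ i = 0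
  strict : ∀ i, p ≤ i → i ≤ n → ξ i < ξ (i + 1)
  right : ∀ i, n + 1 ≤ i → ξ i = 1
  three_cells : 3 + p ≤ n + 1

/-- The coordinate on `[0, 1]` seen from the end point `0` (`true`) or from `1` (`false`). -/
def orient : Bool → ℝ → ℝ
  | true, t => t
  | false, t => 1 - t

/-- The numbering of `n + 1` basis functions from the first (`true`) or the last one (`false`). -/
def orientIdx {n : ℕ} : Bool → Fin (n + 1) → Fin (n + 1)
  | true, i => i
  | false, i => Fin.rev i

namespace Knots

variable {p : ℕ} (S : Knots p)

/-- The B-spline basis functions. For `o = true` these are `λ_0, …, λ_n`. For `o = false` the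
coordinate and the numbering are reversed, `t ↦ λ_{n-i}(1 - t)`, so that in both cases the basis
function with index `0` is the one attached to the local end point `t = 0`. -/
def lam (o : Bool) (i : Fin (S.n + 1)) : ℝ → ℝ :=
  fun t => bspline S.ξ p (orientIdx o i : Fin (S.n + 1)) (orient o t)

/-- The univariate spline space, in the coordinate oriented by `o`. -/
def V (o : Bool) : Submodule ℝ (ℝ → ℝ) := Submodule.span ℝ (range (S.lam o))

lemma mono : Monotone S.ξ := by
  refine monotone_nat_of_le_succ fun i => ?_
  rcases lt_or_ge i p with h | h
  · rw [S.left i h.le, S.left (i + 1) h]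
  · rcases lt_or_ge S.n i with h' | h'
    · rw [S.right i h', S.right (i + 1) (by omega)]
    · exact (S.strict i h h').le

lemma bspline_eq_zero (q : ℕ) : ∀ (i : ℕ) (x : ℝ), x ≠ 1 →
    (x < S.ξ i ∨ S.ξ (i + q + 1) ≤ x) → bspline S.ξ q i x = 0 := by
  induction q with
  | zero =>
    intro i x hx h
    simp only [bspline]
    rw [if_neg]
    rintro (⟨h1, h2⟩ | ⟨h1, -⟩)
    · rcases h with h | h
      · exact absurd h1 (not_le.2 h)
      · exact absurd h2 (not_lt.2 h)
    · exact hx h1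
  | succ q ih =>
    intro i x hx h
    simp only [bspline]
    rw [ih i x hx, ih (i + 1) x hx]
    · simp
    · rcases h with h | h
      · exact Or.inl (h.trans_le (S.mono (by omega)))
      · exact Or.inr (le_trans (S.mono (by omega)) h)
    · rcases h with h | h
      · exact Or.inl h
      · exact Or.inr (le_trans (S.mono (by omega)) h)

lemma bspline_pos (i : ℕ) (x : ℝ) (h1 : S.ξ i < x)
    (h2 : x < S.ξ (i + 1)) (hx : x ≠ 1) (q : ℕ) : 0 < bspline S.ξ q i x := by
  induction q with
  | zero => simp [bspline, h1.le, h2]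
  | succ q ih =>
    simp only [bspline]
    rw [S.bspline_eq_zero q (i + 1) x hx (Or.inl h2), mul_zero, add_zero]
    refine mul_pos (div_pos (by linarith) ?_) ih
    have := S.mono (show i + 1 ≤ i + q + 1 by omega)
    linarith

lemma bspline_near_zero (q : ℕ) : ∀ i, i ≤ p → p ≤ i + q →
    ∃ g : ℝ → ℝ, Continuous g ∧ 0 < g 0 ∧ ∀ x, 0 < x → x < S.ξ (p + 1) → x ≠ 1 →
      bspline S.ξ q i x = x ^ (i + q - p) * g x := by
  have hpos : 0 < S.ξ (p + 1) := by
    have := S.strict p le_rfl (by have := S.three_cells; omega)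
    rwa [S.left p le_rfl] at this
  induction q with
  | zero =>
    intro i hi hi'
    obtain rfl : i = p := by omega
    refine ⟨fun _ => 1, continuous_const, one_pos, fun x h0 h1 hx => ?_⟩
    simp [bspline, S.left i le_rfl, h0.le, h1]
  | succ q ih =>
    intro i hi hi'
    -- first summand
    have hA : ∃ g : ℝ → ℝ, Continuous g ∧ 0 ≤ g 0 ∧ (p ≤ i + q → 0 < g 0) ∧
        ∀ x, 0 < x → x < S.ξ (p + 1) → x ≠ 1 →
        (x - S.ξ i) / (S.ξ (i + q + 1) - S.ξ i) * bspline S.ξ q i x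
          = x ^ (i + (q + 1) - p) * g x := by
      by_cases h : p ≤ i + q
      · obtain ⟨g, hg, hg0, hgx⟩ := ih i hi h
        have hd : 0 < S.ξ (i + q + 1) := hpos.trans_le (S.mono (by omega))
        refine ⟨fun x => g x / S.ξ (i + q + 1), hg.div_const _, (div_pos hg0 hd).le,
          fun _ => div_pos hg0 hd, fun x h0 h1 hx => ?_⟩
        rw [hgx x h0 h1 hx, S.left i hi, show i + (q + 1) - p = (i + q - p) + 1 by omega, pow_succ]
        simp only [sub_zero]
        ring
      · refine ⟨fun _ => 0, continuous_const, le_rfl, fun h' => absurd h' h,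
          fun x h0 h1 hx => ?_⟩
        rw [S.bspline_eq_zero q i x hx (Or.inr ?_)]
        · simp
        · rw [S.left (i + q + 1) (by omega)]
          exact h0.le
    have hB : ∃ g : ℝ → ℝ, Continuous g ∧ 0 ≤ g 0 ∧ (i < p → 0 < g 0) ∧
        ∀ x, 0 < x → x < S.ξ (p + 1) → x ≠ 1 →
        (S.ξ (i + q + 2) - x) / (S.ξ (i + q + 2) - S.ξ (i + 1)) * bspline S.ξ q (i + 1) x
          = x ^ (i + (q + 1) - p) * g x := by
      by_cases h : i < p
      · obtain ⟨g, hg, hg0, hgx⟩ := ih (i + 1) h (by omega)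
        have hd : 0 < S.ξ (i + q + 2) := hpos.trans_le (S.mono (by omega))
        have h1' : 0 < (S.ξ (i + q + 2) - 0) / S.ξ (i + q + 2) * g 0 := by
          rw [sub_zero]
          exact mul_pos (div_pos hd hd) hg0
        refine ⟨fun x => (S.ξ (i + q + 2) - x) / S.ξ (i + q + 2) * g x, by fun_prop, h1'.le,
          fun _ => h1', fun x h0 h1 hx => ?_⟩
        rw [hgx x h0 h1 hx, S.left (i + 1) h, show i + (q + 1) - p = i + 1 + q - p by omega]
        simp only [sub_zero]
        ring
      · refine ⟨fun _ => 0, continuous_const, le_rfl, fun h' => absurd h' h,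
          fun x h0 h1 hx => ?_⟩
        obtain rfl : i = p := by omega
        rw [S.bspline_eq_zero q (i + 1) x hx (Or.inl h1)]
        simp
    obtain ⟨g, hg, hg0, hg1, hgx⟩ := hA
    obtain ⟨g', hg', hg0', hg1', hgx'⟩ := hB
    refine ⟨fun x => g x + g' x, hg.add hg', ?_, fun x h0 h1 hx => ?_⟩
    · rcases lt_or_ge i p with h | h
      · have := hg1' h
        simp only
        linarith
      · have := hg1 (by omega)
        simp only
        linarith
    · simp only [bspline]
      rw [hgx x h0 h1 hx, hgx' x h0 h1 hx, mul_add]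

/-- Linear independence of the B-splines on the open unit interval. -/
lemma bspline_indep (c : Fin (S.n + 1) → ℝ)
    (h : ∀ x ∈ Ioo (0 : ℝ) 1, ∑ i, c i * bspline S.ξ p i x = 0) : ∀ i, c i = 0 := by
  have hn := S.three_cells
  have hpos : 0 < S.ξ (p + 1) := by
    have := S.strict p le_rfl (by omega)
    rwa [S.left p le_rfl] at this
  have hle : ∀ i, S.ξ i ≤ 1 := fun i => by
    rw [← S.right (S.n + 1 + i) (by omega)]
    exact S.mono (by omega)
  have hge : ∀ i, 0 ≤ S.ξ i := fun i => by
    rw [← S.left 0 (by omega)]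
    exact S.mono (by omega)
  suffices H : ∀ m (hm : m < S.n + 1), c ⟨m, hm⟩ = 0 from fun i => H i i.2
  intro m
  induction m using Nat.strong_induction_on with
  | _ m ih =>
    intro hm
    rcases le_or_gt p m with hpm | hpm
    · obtain ⟨x, hx1, hx2⟩ := exists_between (S.strict m hpm (by omega))
      have hx : x ∈ Ioo (0 : ℝ) 1 := ⟨(hge _).trans_lt hx1, hx2.trans_le (hle _)⟩
      have h0 := h x hx
      rw [Finset.sum_eq_single (⟨m, hm⟩ : Fin (S.n + 1))] at h0
      · exact (mul_eq_zero.1 h0).resolve_right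
          (S.bspline_pos m x hx1 hx2 hx.2.ne p).ne'
      · intro j _ hj
        rcases lt_or_gt_of_ne (fun h' => hj (Fin.ext h') : (j : ℕ) ≠ m) with hjm | hjm
        · rw [show c j = 0 from ih j hjm j.2, zero_mul]
        · rw [S.bspline_eq_zero p j x hx.2.ne (Or.inl (hx2.trans_le (S.mono (by omega)))), mul_zero]
      · simp
    · have hex : ∀ j : Fin (S.n + 1), ∃ g : ℝ → ℝ, Continuous g ∧ ((j : ℕ) = m → 0 < g 0) ∧
          ∀ x, 0 < x → x < S.ξ (p + 1) → x ≠ 1 →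
            m ≤ (j : ℕ) → bspline S.ξ p j x = x ^ ((j : ℕ) - m) * x ^ m * g x := by
        intro j
        rcases le_or_gt (j : ℕ) p with hj | hj
        · obtain ⟨g, hg, hg0, hgx⟩ := S.bspline_near_zero p j hj (by omega)
          refine ⟨g, hg, fun _ => hg0, fun x h0 h1 hx hmj => ?_⟩
          rw [hgx x h0 h1 hx, ← pow_add]
          congr 2
          omega
        · refine ⟨fun _ => 0, continuous_const, fun h' => by omega, fun x h0 h1 hx hmj => ?_⟩
          rw [S.bspline_eq_zero p j x hx (Or.inl (h1.trans_le (S.mono (by omega)))), mul_zero]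
      choose g hg hg0 hgx using hex
      set G : ℝ → ℝ := fun x => ∑ j : Fin (S.n + 1), c j * (x ^ ((j : ℕ) - m) * g j x) with hG
      have hGc : Continuous G := by
        refine continuous_finsetSum _ fun j _ => ?_
        have := hg j
        fun_prop
      have hz : ∀ x, 0 < x → x < S.ξ (p + 1) → G x = 0 := by
        intro x h0 h1
        have hx1 : x < 1 := h1.trans_le (hle _)
        have hs := h x ⟨h0, hx1⟩
        have : x ^ m * G x = 0 := by
          rw [← hs, hG, Finset.mul_sum]
          refine Finset.sum_congr rfl fun j _ => ?_
          rcases lt_or_ge (j : ℕ) m with hj | hj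
          · rw [show c j = 0 from ih j hj j.2]
            ring
          · rw [hgx j x h0 h1 hx1.ne hj]
            ring
        exact (mul_eq_zero.1 this).resolve_left (pow_pos h0 m).ne'
      have hG0 : G 0 = 0 := by
        have h1 : Filter.Tendsto G (nhdsWithin 0 (Ioi 0)) (nhds (G 0)) :=
          hGc.continuousAt.tendsto.mono_left nhdsWithin_le_nhds
        have h2 : Filter.Tendsto G (nhdsWithin 0 (Ioi 0)) (nhds 0) := by
          refine tendsto_const_nhds.congr' ?_
          filter_upwards [Ioo_mem_nhdsGT hpos] with x hx
          exact (hz x hx.1 hx.2).symm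
        exact tendsto_nhds_unique h1 h2
      rw [hG] at hG0
      simp only at hG0
      rw [Finset.sum_eq_single (⟨m, hm⟩ : Fin (S.n + 1))] at hG0
      · simp only [Nat.sub_self, pow_zero, one_mul] at hG0
        exact (mul_eq_zero.1 hG0).resolve_right (hg0 _ rfl).ne'
      · intro j _ hj
        rcases lt_or_gt_of_ne (fun h' => hj (Fin.ext h') : (j : ℕ) ≠ m) with hjm | hjm
        · rw [show c j = 0 from ih j hjm j.2, zero_mul]
        · rw [zero_pow (by omega)]
          ring
      · simp

lemma lam_indep (o : Bool) (c : Fin (S.n + 1) → ℝ)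
    (h : ∀ t ∈ Ioo (0 : ℝ) 1, ∑ i, c i * S.lam o i t = 0) : ∀ i, c i = 0 := by
  cases o with
  | true => exact S.bspline_indep c h
  | false =>
    intro i
    have := S.bspline_indep (fun i => c (Fin.rev i)) (fun x hx => by
      rw [← h (1 - x) ⟨by linarith [hx.2], by linarith [hx.1]⟩]
      refine Fintype.sum_equiv Fin.revPerm _ _ fun j => ?_
      simp [lam, orient, orientIdx]) (Fin.rev i)
    simpa using this

lemma linearIndependent_lam (o : Bool) : LinearIndependent ℝ (S.lam o) := by
  rw [Fintype.linearIndependent_iff]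
  intro c hc
  refine S.lam_indep o c fun t _ => ?_
  have := congrFun hc t
  simpa [Finset.sum_apply] using this

/-- The B-spline basis of the univariate spline space. -/
def basis (o : Bool) : Module.Basis (Fin (S.n + 1)) ℝ (S.V o) :=
  Module.Basis.span (S.linearIndependent_lam o)

/-- The index `m`, counted from the local start; only used for `m ≤ n`. -/
def idx (m : ℕ) : Fin (S.n + 1) := Fin.ofNat (S.n + 1) m

/-- The duality matrix `∫ λ_m q_j` (row `j`, column `m`; the functions are `λ_1, …, λ_r` and the
polynomial basis is `1, x, …, x^{r-1}`). -/
def momentMatrix (o : Bool) (r : ℕ) : Matrix (Fin r) (Fin r) ℝ :=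
  Matrix.of fun j m => ∫ t in Ioo (0 : ℝ) 1, S.lam o (S.idx (m + 1)) t * t ^ (j : ℕ)

/-- The vector `∫ λ_0 q_j`. -/
def momentVector (o : Bool) (r : ℕ) : Fin r → ℝ :=
  fun j => ∫ t in Ioo (0 : ℝ) 1, S.lam o 0 t * t ^ (j : ℕ)

/-- The one-dimensional correction coefficients `γ = M⁻¹ b`; the entry `m : Fin r` is the
coefficient of `λ_{m+1}`. -/
def gamma (o : Bool) (r : ℕ) : Fin r → ℝ :=
  (S.momentMatrix o r)⁻¹ *ᵥ S.momentVector o r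

/-- The spline `∑_{m=1}^r γ_m λ_m` that has the moments of `λ_0`. -/
def muStart (o : Bool) (r : ℕ) : S.V o :=
  ∑ m : Fin r, S.gamma o r m • S.basis o (S.idx (m + 1))

/-- The same at the other end point: the spline `∑_{m=1}^r γ_m λ_{n-m}` that has the moments of
`λ_n`, with the coefficients `γ` computed from that end. -/
def muEnd (o : Bool) (r : ℕ) : S.V o :=
  ∑ m : Fin r, S.gamma (!o) r m • S.basis o (Fin.rev (S.idx (m + 1)))

end Knots

/-! ### Restriction from a fine to a coarse univariate spline space -/

section Restriction

variable {p : ℕ} (A : Knots p) (oA : Bool) (B : Knots p) (oB : Bool) (h : A.V oA ≤ B.V oB) (r : ℕ)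

/-- Gram matrix of the coarse basis. -/
def gram : Matrix (Fin (A.n + 1)) (Fin (A.n + 1)) ℝ :=
  Matrix.of fun i j => ∫ t in Ioo (0 : ℝ) 1, A.lam oA i t * A.lam oA j t

/-- The `L²` projection from the fine space `B` onto the coarse space `A`. -/
def l2Restrict : B.V oB →ₗ[ℝ] A.V oA :=
  (B.basis oB).constr ℝ fun i =>
    ∑ a, ((gram A oA)⁻¹ *ᵥ fun j => ∫ t in Ioo (0 : ℝ) 1, A.lam oA j t * B.lam oB i t) a •
      A.basis oA a

/-- The truncation `φ ↦ φ - φ_0 λ⁻_0 - φ_n λ⁻_n` on the fine space. -/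
def truncFine : B.V oB →ₗ[ℝ] B.V oB :=
  LinearMap.id
    - ((B.basis oB).coord 0).smulRight (Submodule.inclusion h (A.basis oA 0))
    - ((B.basis oB).coord (Fin.last _)).smulRight
        (Submodule.inclusion h (A.basis oA (Fin.last _)))

/-- The moment-preserving truncation on the coarse space. -/
def truncCoarse : A.V oA →ₗ[ℝ] A.V oA :=
  LinearMap.id
    - ((A.basis oA).coord 0).smulRight (A.basis oA 0)
    - ((A.basis oA).coord (Fin.last _)).smulRight (A.basis oA (Fin.last _))
    + ((A.basis oA).coord 0).smulRight (A.muStart oA r)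
    + ((A.basis oA).coord (Fin.last _)).smulRight (A.muEnd oA r)

/-- The restriction operator from the fine space `B` to the coarse space `A`. -/
def restrictOp : B.V oB →ₗ[ℝ] A.V oA :=
  ((B.basis oB).coord 0).smulRight (A.basis oA 0)
    + ((B.basis oB).coord (Fin.last _)).smulRight (A.basis oA (Fin.last _))
    + truncCoarse A oA r ∘ₗ l2Restrict A oA B oB ∘ₗ truncFine A oA B oB h

end Restriction

/-! ### The reference square -/

/-- The open reference square. -/
def openSquare : Set (ℝ × ℝ) := Ioo 0 1 ×ˢ Ioo 0 1

/-- The closed reference square. -/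
def closedSquare : Set (ℝ × ℝ) := Icc 0 1 ×ˢ Icc 0 1

/-- A corner of the square: in each direction the end `0` (`true`) or `1` (`false`). -/
abbrev Corner := Bool × Bool

/-- The point of the reference square. -/
def Corner.pt (c : Corner) : ℝ × ℝ := (orient c.1 0, orient c.2 0)

/-- The pair of indices counted from the corner `c`. -/
def Corner.index {n : ℕ} (c : Corner) (m : Fin (n + 1) × Fin (n + 1)) :
    Fin (n + 1) × Fin (n + 1) := (orientIdx c.1 m.1, orientIdx c.2 m.2)

/-- An oriented side of the reference square, through coordinates `(t, d)`: `t` runs along the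
side and `d` is the distance to it. If `swap` is false, `t` is the first logical coordinate,
otherwise the second; `par` and `perp` are the orientations of `t` and `d`. -/
structure Frame where
  swap : Bool
  par : Bool
  perp : Bool

instance : Fintype Frame :=
  Fintype.ofEquiv (Bool × Bool × Bool)
    { toFun := fun a => ⟨a.1, a.2.1, a.2.2⟩
      invFun := fun s => (s.swap, s.par, s.perp)
      left_inv := fun _ => rfl
      right_inv := fun _ => rfl }

/-- From side coordinates `(t, d)` to logical coordinates. -/
def Frame.pt (s : Frame) (x : ℝ × ℝ) : ℝ × ℝ :=
  if s.swap then (orient s.perp x.2, orient s.par x.1) else (orient s.par x.1, orient s.perp x.2)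

/-- From (parallel, perpendicular) indices to the logical indices. -/
def Frame.index {n : ℕ} (s : Frame) (m : Fin (n + 1) × Fin (n + 1)) : Fin (n + 1) × Fin (n + 1) :=
  if s.swap then (orientIdx s.perp m.2, orientIdx s.par m.1)
  else (orientIdx s.par m.1, orientIdx s.perp m.2)

/-- From logical indices to (parallel, perpendicular) indices. -/
def Frame.localIndex {n : ℕ} (s : Frame) (j : Fin (n + 1) × Fin (n + 1)) :
    Fin (n + 1) × Fin (n + 1) :=
  if s.swap then (orientIdx s.par j.2, orientIdx s.perp j.1)
  else (orientIdx s.par j.1, orientIdx s.perp j.2)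

/-! ### Lipschitz boundary and `H¹` -/

/-- Near every boundary point the set is, in suitable orthonormal coordinates, the set above the
graph of a Lipschitz function. -/
def HasLipschitzBoundary (Ω : Set Plane) : Prop :=
  ∀ x ∈ frontier Ω, ∃ (T : Plane ≃ₗᵢ[ℝ] Plane) (L : NNReal) (f : ℝ → ℝ) (δ : ℝ),
    0 < δ ∧ LipschitzWith L f ∧ ∀ y ∈ Metric.ball x δ, (y ∈ Ω ↔ f (T y 0) < T y 1)

/-- `g` is the weak partial derivative of `v` in the direction `i` on `Ω`. -/
def HasWeakPartial (Ω : Set Plane) (i : Fin 2) (v g : Plane → ℝ) : Prop :=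
  ∀ ψ : Plane → ℝ, ContDiff ℝ ∞ ψ → HasCompactSupport ψ → tsupport ψ ⊆ Ω →
    ∫ x in Ω, v x * fderiv ℝ ψ x (EuclideanSpace.single i 1) = - ∫ x in Ω, g x * ψ x

lemma integrable_mul_test {Ω : Set Plane} {v ψ : Plane → ℝ}
    (hv : MemLp v 2 (volume.restrict Ω)) (hψ : Continuous ψ) (hc : HasCompactSupport ψ) :
    Integrable (fun x => v x * ψ x) (volume.restrict Ω) :=
  MemLp.integrable_mul (p := 2) (q := 2) hv (hψ.memLp_of_hasCompactSupport hc)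

lemma integrable_mul_fderiv {Ω : Set Plane} {v ψ : Plane → ℝ} (i : Fin 2)
    (hv : MemLp v 2 (volume.restrict Ω)) (hψ : ContDiff ℝ ∞ ψ) (hc : HasCompactSupport ψ) :
    Integrable (fun x => v x * fderiv ℝ ψ x (EuclideanSpace.single i 1)) (volume.restrict Ω) := by
  refine integrable_mul_test hv ?_ ?_
  · exact (hψ.continuous_fderiv (by simp)).clm_apply continuous_const
  · exact hc.fderiv_apply (𝕜 := ℝ) _

/-- The Sobolev space `H¹(Ω)`, as a space of functions (not identified almost everywhere). -/
def H1 (Ω : Set Plane) : Submodule ℝ (Plane → ℝ) where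
  carrier := {v | MemLp v 2 (volume.restrict Ω) ∧
    ∀ i, ∃ g, MemLp g 2 (volume.restrict Ω) ∧ HasWeakPartial Ω i v g}
  zero_mem' := ⟨MemLp.zero', fun i => ⟨0, MemLp.zero', fun ψ _ _ _ => by simp⟩⟩
  add_mem' := by
    rintro v w ⟨hv, hv'⟩ ⟨hw, hw'⟩
    refine ⟨hv.add hw, fun i => ?_⟩
    obtain ⟨g, hg, hg'⟩ := hv' i
    obtain ⟨k, hk, hk'⟩ := hw' i
    refine ⟨g + k, hg.add hk, fun ψ h1 h2 h3 => ?_⟩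
    simp only [Pi.add_apply, add_mul]
    rw [integral_add (integrable_mul_fderiv i hv h1 h2) (integrable_mul_fderiv i hw h1 h2),
      integral_add (integrable_mul_test hg h1.continuous h2)
        (integrable_mul_test hk h1.continuous h2), hg' ψ h1 h2 h3, hk' ψ h1 h2 h3]
    ring
  smul_mem' := by
    rintro c v ⟨hv, hv'⟩
    refine ⟨hv.const_smul c, fun i => ?_⟩
    obtain ⟨g, hg, hg'⟩ := hv' i
    refine ⟨c • g, hg.const_smul c, fun ψ h1 h2 h3 => ?_⟩
    simp only [Pi.smul_apply, smul_eq_mul, mul_assoc]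
    rw [integral_const_mul, integral_const_mul, hg' ψ h1 h2 h3]
    ring

/-! ### Multipatch domains -/

/-- The side with frame `s` of the patch parametrized by `F`. -/
def sideImage (F : ℝ × ℝ → Plane) (s : Frame) : Set Plane :=
  (fun t : ℝ => F (s.pt (t, 0))) '' Icc 0 1

/-- A multipatch domain with `K` patches `F k (openSquare)`, each with a clamped knot vector of the
common degree `p`. -/
structure Multipatch (p K : ℕ) where
  knots : Fin K → Knots p
  F : Fin K → ℝ × ℝ → Plane
  /-- each `F k` is a `C¹` diffeomorphism from the closed square onto its image -/
  smooth : ∀ k, ∀ x ∈ closedSquare, ContDiffAt ℝ 1 (F k) x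
  immersive : ∀ k, ∀ x ∈ closedSquare, Function.Bijective (fderiv ℝ (F k) x)
  injOn : ∀ k, InjOn (F k) closedSquare
  disjoint : ∀ k l, k ≠ l → Disjoint (F k '' openSquare) (F l '' openSquare)
  /-- geometric conformity: two closed patches are disjoint, or meet in exactly one common vertex,
  or meet in exactly one common side, on which the parametrizations agree up to orientation -/
  conforming : ∀ k l, k ≠ l →
    closure (F k '' openSquare) ∩ closure (F l '' openSquare) = ∅ ∨
    (∃ c d : Corner, F k c.pt = F l d.pt ∧
      closure (F k '' openSquare) ∩ closure (F l '' openSquare) = {F k c.pt}) ∨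
    (∃ s s' : Frame, (∀ t ∈ Icc (0 : ℝ) 1, F k (s.pt (t, 0)) = F l (s'.pt (t, 0))) ∧
      closure (F k '' openSquare) ∩ closure (F l '' openSquare) = sideImage (F k) s)
  /-- the domain has a Lipschitz boundary -/
  lipschitz : HasLipschitzBoundary (interior (⋃ k, closure (F k '' openSquare)))

namespace Multipatch

variable {p K : ℕ} (D : Multipatch p K)

/-- The open patch `Ω_k`. -/
def patch (k : Fin K) : Set Plane := D.F k '' openSquare

/-- The domain `Ω`. -/
def Ω : Set Plane := interior (⋃ k, closure (D.patch k))

/-- The number `n_k`; the univariate spline space of the patch has dimension `n_k + 1`. -/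
abbrev n (k : Fin K) : ℕ := (D.knots k).n

/-- Indices `(k, i)` of the basis functions of the broken space. -/
abbrev Idx : Type := (k : Fin K) × (Fin (D.n k + 1) × Fin (D.n k + 1))

/-- The tensor-product B-spline on the logical domain. -/
def logicalFun (k : Fin K) (i : Fin (D.n k + 1) × Fin (D.n k + 1)) : ℝ × ℝ → ℝ :=
  fun x => (D.knots k).lam true i.1 x.1 * (D.knots k).lam true i.2 x.2

/-- The tensor-product spline space on the logical domain of patch `k`. -/
def logicalSpace (k : Fin K) : Submodule ℝ (ℝ × ℝ → ℝ) :=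
  Submodule.span ℝ (range (D.logicalFun k))

/-- The broken space: on every patch the pullback is a tensor-product spline. An element of
`L²(Ω)` with this property is represented by its continuous representative on each open patch,
extended by `0` to the complement of the open patches (in `Ω` a null set). -/
def Vpw : Submodule ℝ (Plane → ℝ) where
  carrier := {v | (∀ x, x ∉ ⋃ k, D.patch k → v x = 0) ∧
    ∀ k, ∃ φ ∈ D.logicalSpace k, ∀ x ∈ openSquare, v (D.F k x) = φ x}
  zero_mem' := ⟨fun _ _ => rfl, fun k => ⟨0, Submodule.zero_mem _, fun _ _ => rfl⟩⟩
  add_mem' := by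
    rintro v w ⟨hv, hv'⟩ ⟨hw, hw'⟩
    refine ⟨fun x hx => by simp [hv x hx, hw x hx], fun k => ?_⟩
    obtain ⟨φ, hφ, h1⟩ := hv' k
    obtain ⟨χ, hχ, h2⟩ := hw' k
    exact ⟨φ + χ, Submodule.add_mem _ hφ hχ, fun x hx => by simp [h1 x hx, h2 x hx]⟩
  smul_mem' := by
    rintro c v ⟨hv, hv'⟩
    refine ⟨fun x hx => by simp [hv x hx], fun k => ?_⟩
    obtain ⟨φ, hφ, h1⟩ := hv' k
    exact ⟨c • φ, Submodule.smul_mem _ c hφ, fun x hx => by simp [h1 x hx]⟩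

/-- The `H¹`-conforming subspace of the broken space. -/
def Vh : Submodule ℝ D.Vpw := (H1 D.Ω).comap D.Vpw.subtype

open Classical in
/-- The broken basis functions: the pushforward of the logical ones on the patch, `0` elsewhere. -/
def LamFun (a : D.Idx) : Plane → ℝ := fun x =>
  if x ∈ D.patch a.1 then
    D.logicalFun a.1 a.2 (Function.invFunOn (D.F a.1) openSquare x) else 0

lemma openSquare_subset : openSquare ⊆ closedSquare :=
  prod_mono Ioo_subset_Icc_self Ioo_subset_Icc_self

lemma LamFun_same (k : Fin K) (i) (x : ℝ × ℝ) (hx : x ∈ openSquare) :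
    D.LamFun ⟨k, i⟩ (D.F k x) = D.logicalFun k i x := by
  have h1 : D.F k x ∈ D.patch k := mem_image_of_mem _ hx
  rw [LamFun, if_pos h1]
  congr 1
  have h2 : ∃ a ∈ openSquare, D.F k a = D.F k x := ⟨x, hx, rfl⟩
  exact D.injOn k (openSquare_subset (Function.invFunOn_mem h2)) (openSquare_subset hx)
    (Function.invFunOn_eq h2)

lemma LamFun_other (k l : Fin K) (hkl : l ≠ k) (i) (x : ℝ × ℝ) (hx : x ∈ openSquare) :
    D.LamFun ⟨l, i⟩ (D.F k x) = 0 := by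
  rw [LamFun, if_neg]
  intro h
  exact (D.disjoint l k hkl).le_bot ⟨h, mem_image_of_mem _ hx⟩

lemma sum_LamFun (c : D.Idx → ℝ) (k : Fin K) (x : ℝ × ℝ) (hx : x ∈ openSquare) :
    ∑ a, c a * D.LamFun a (D.F k x) = ∑ i, c ⟨k, i⟩ * D.logicalFun k i x := by
  rw [Fintype.sum_sigma, Finset.sum_eq_single k]
  · exact Finset.sum_congr rfl fun i _ => by rw [D.LamFun_same k i x hx]
  · intro l _ hl
    exact Finset.sum_eq_zero fun i _ => by rw [D.LamFun_other k l hl i x hx, mul_zero]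
  · simp

lemma LamFun_mem (a : D.Idx) : D.LamFun a ∈ D.Vpw := by
  obtain ⟨k, i⟩ := a
  refine ⟨fun x hx => ?_, fun l => ?_⟩
  · rw [LamFun, if_neg]
    exact fun h => hx (mem_iUnion.2 ⟨k, h⟩)
  · by_cases h : k = l
    · subst h
      exact ⟨_, Submodule.subset_span (mem_range_self i), fun x hx => D.LamFun_same k i x hx⟩
    · exact ⟨0, Submodule.zero_mem _, fun x hx => D.LamFun_other l k h i x hx⟩

/-- The broken basis functions as elements of the broken space. -/
def Lam (a : D.Idx) : D.Vpw := ⟨D.LamFun a, D.LamFun_mem a⟩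

lemma linearIndependent_Lam : LinearIndependent ℝ D.Lam := by
  rw [Fintype.linearIndependent_iff]
  rintro c hc ⟨k, i, j⟩
  have h0 : ∀ x ∈ Ioo (0 : ℝ) 1, ∀ y ∈ Ioo (0 : ℝ) 1,
      ∑ i, (∑ j, c ⟨k, i, j⟩ * (D.knots k).lam true j y) * (D.knots k).lam true i x = 0 := by
    intro x hx y hy
    have h1 := congrFun (congrArg Subtype.val hc) (D.F k (x, y))
    have h2 := D.sum_LamFun c k (x, y) ⟨hx, hy⟩
    have h3 : ∑ a, c a * D.LamFun a (D.F k (x, y)) = 0 := by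
      rw [← show ((0 : D.Vpw) : Plane → ℝ) (D.F k (x, y)) = 0 from rfl, ← h1]
      simp [Lam, Finset.sum_apply]
    rw [h3, Fintype.sum_prod_type] at h2
    rw [h2]
    refine Finset.sum_congr rfl fun i _ => ?_
    rw [Finset.sum_mul]
    refine Finset.sum_congr rfl fun j _ => ?_
    simp only [logicalFun]
    ring
  refine (D.knots k).lam_indep true (fun j => c ⟨k, i, j⟩) (fun y hy => ?_) j
  exact (D.knots k).lam_indep true (fun i => ∑ j, c ⟨k, i, j⟩ * (D.knots k).lam true j y)
    (fun x hx => h0 x hx y hy) i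

lemma span_Lam : ⊤ ≤ Submodule.span ℝ (range D.Lam) := by
  rintro ⟨v, hv, hv'⟩ -
  have hc : ∀ k, ∃ c : Fin (D.n k + 1) × Fin (D.n k + 1) → ℝ, ∀ x ∈ openSquare,
      v (D.F k x) = ∑ i, c i * D.logicalFun k i x := by
    intro k
    obtain ⟨φ, hφ, h⟩ := hv' k
    obtain ⟨c, rfl⟩ := (Submodule.mem_span_range_iff_exists_fun ℝ).1 hφ
    exact ⟨c, fun x hx => by simp [h x hx, Finset.sum_apply]⟩
  choose c hc using hc
  refine (Submodule.mem_span_range_iff_exists_fun ℝ).2 ⟨fun a => c a.1 a.2, Subtype.ext ?_⟩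
  funext y
  have h1 : ((∑ a, c a.1 a.2 • D.Lam a : D.Vpw) : Plane → ℝ) y
      = ∑ a : D.Idx, c a.1 a.2 * D.LamFun a y := by
    simp [Lam, Finset.sum_apply]
  rw [h1]
  by_cases hy : y ∈ ⋃ k, D.patch k
  · obtain ⟨k, x, hx, rfl⟩ := mem_iUnion.1 hy
    rw [D.sum_LamFun (fun a => c a.1 a.2) k x hx]
    exact (hc k x hx).symm
  · have h2 : v y = 0 := hv y hy
    change _ = v y
    rw [h2]
    refine Finset.sum_eq_zero fun a _ => ?_
    rw [LamFun, if_neg (fun h => hy (mem_iUnion.2 ⟨a.1, h⟩)), mul_zero]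

/-- The basis `Λ^k_i` of the broken space. -/
def basis : Module.Basis D.Idx ℝ D.Vpw :=
  Module.Basis.mk D.linearIndependent_Lam D.span_Lam

/-! ### Vertex operators -/

open Classical in
/-- The set of patch vertices. -/
def vertices : Finset Plane :=
  Finset.univ.image fun a : Fin K × Corner => D.F a.1 a.2.pt

open Classical in
/-- The patches that contain the vertex `v`, each together with its (unique) corner at `v`. -/
def cornersAt (v : Plane) : Finset (Fin K × Corner) :=
  {a | D.F a.1 a.2.pt = v}

/-- The vertex-conforming function: the average of the basis functions at the vertex. -/
def vertexAverage (v : Plane) : D.Vpw :=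
  ((D.cornersAt v).card : ℝ)⁻¹ • ∑ a ∈ D.cornersAt v, D.basis ⟨a.1, a.2.index (0, 0)⟩

/-- The correction `∑_{m₁,m₂=1}^r γ_{m₁} γ_{m₂} Λ^k_m` on the patch `k`, indices being counted from
the corner `c`; it has the moments of the basis function at the corner. -/
def vertexCorrection (r : ℕ) (k : Fin K) (c : Corner) : D.Vpw :=
  ∑ m₁ : Fin r, ∑ m₂ : Fin r,
    ((D.knots k).gamma c.1 r m₁ * (D.knots k).gamma c.2 r m₂) •
      D.basis ⟨k, c.index ((D.knots k).idx (m₁ + 1), (D.knots k).idx (m₂ + 1))⟩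

open Classical in
/-- The local vertex operator `P_v`, by its values on the basis. -/
def vertexOp (r : ℕ) (v : Plane) : Module.End ℝ D.Vpw :=
  D.basis.constr ℝ fun a =>
    if h : ∃ c : Corner, D.F a.1 c.pt = v ∧ a.2 = c.index (0, 0) then
      D.vertexAverage v + (D.vertexCorrection r a.1 h.choose
        - ((D.cornersAt v).card : ℝ)⁻¹ • ∑ b ∈ D.cornersAt v, D.vertexCorrection r b.1 b.2)
    else D.basis a

/-! ### Edge operators -/

open Classical in
/-- The set of patch edges. -/
def edges : Finset (Set Plane) :=
  Finset.univ.image fun a : Fin K × Frame => sideImage (D.F a.1) a.2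

/-- Interior edges are the edges shared by two patches. -/
def IsInterior (e : Set Plane) : Prop :=
  ∃ k l, k ≠ l ∧ ∃ s s', sideImage (D.F k) s = e ∧ sideImage (D.F l) s' = e

/-- An interior edge with its coarse patch `km` and its fine patch `kp`: the common
parametrization of the edge from both patches, and the nestedness of the univariate spline spaces
in the common parameter along the edge. -/
structure Interface (e : Set Plane) where
  km : Fin K
  kp : Fin K
  sm : Frame
  sp : Frame
  ne : km ≠ kp
  image_eq : sideImage (D.F km) sm = e
  matching : ∀ t ∈ Icc (0 : ℝ) 1, D.F km (sm.pt (t, 0)) = D.F kp (sp.pt (t, 0))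
  nested : (D.knots km).V sm.par ≤ (D.knots kp).V sp.par

/-- The pushforward of `f ⊗ λ_m` on the patch `k`, where `f` is a function of the coordinate along
the side `s` and `λ_m` is the `m`-th basis function counted from that side. -/
def sideFun (k : Fin K) (s : Frame) (m : Fin (D.n k + 1)) : (D.knots k).V s.par →ₗ[ℝ] D.Vpw :=
  ((D.knots k).basis s.par).constr ℝ fun i => D.basis ⟨k, s.index (i, m)⟩

namespace Interface

variable {D} {e : Set Plane} (I : D.Interface e) (r : ℕ)

/-- The coarse univariate space along the edge. -/
abbrev Vm : Submodule ℝ (ℝ → ℝ) := (D.knots I.km).V I.sm.par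

/-- The fine univariate space along the edge. -/
abbrev Vp : Submodule ℝ (ℝ → ℝ) := (D.knots I.kp).V I.sp.par

/-- The coarse basis along the edge. -/
abbrev lamM (i : Fin (D.n I.km + 1)) : I.Vm := (D.knots I.km).basis I.sm.par i

/-- The fine basis along the edge. -/
abbrev lamP (i : Fin (D.n I.kp + 1)) : I.Vp := (D.knots I.kp).basis I.sp.par i

/-- The extension operator. -/
def ext : I.Vm →ₗ[ℝ] I.Vp := Submodule.inclusion I.nested

/-- The restriction operator. -/
def res : I.Vp →ₗ[ℝ] I.Vm :=
  restrictOp (D.knots I.km) I.sm.par (D.knots I.kp) I.sp.par I.nested r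

/-- The pushforward of `f ⊗ (λ⁻_{⊥,0} + λ⁺_{⊥,0}) / 2`. -/
def average : I.Vm →ₗ[ℝ] D.Vpw :=
  (2⁻¹ : ℝ) • (D.sideFun I.km I.sm 0 + D.sideFun I.kp I.sp 0 ∘ₗ I.ext)

/-- The pushforward of `f ⊗ C` with `C = ½ ∑_{m=1}^r (γ⁻_m λ⁻_{⊥,m} - γ⁺_m λ⁺_{⊥,m})`. -/
def correction : I.Vm →ₗ[ℝ] D.Vpw :=
  (2⁻¹ : ℝ) • (∑ m : Fin r, (D.knots I.km).gamma I.sm.perp r m •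
      D.sideFun I.km I.sm ((D.knots I.km).idx (m + 1))
    - ∑ m : Fin r, (D.knots I.kp).gamma I.sp.perp r m •
      (D.sideFun I.kp I.sp ((D.knots I.kp).idx (m + 1)) ∘ₗ I.ext))

/-- The factor of the correction term for the fine basis function `i` on the edge:
`λ⁺_i` in the interior of the edge, `μ⁺` at the end points. -/
def corrP (i : Fin (D.n I.kp + 1)) : I.Vp :=
  if i = 0 then (D.knots I.kp).muStart I.sp.par r
  else if i = Fin.last _ then (D.knots I.kp).muEnd I.sp.par r
  else I.lamP i

/-- The factor of the correction term for the coarse basis function `i` on the edge: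
`λ⁻_i` in the interior of the edge, `μ⁻ = λ⁻ + R (μ⁺ - λ⁺)` at the end points. -/
def corrM (i : Fin (D.n I.km + 1)) : I.Vm :=
  if i = 0 then I.lamM 0 + I.res r ((D.knots I.kp).muStart I.sp.par r - I.lamP 0)
  else if i = Fin.last _ then I.lamM (Fin.last _) +
    I.res r ((D.knots I.kp).muEnd I.sp.par r - I.lamP (Fin.last _))
  else I.lamM i

/-- The local edge operator `P_e` of an interior edge, by its values on the basis. -/
def edgeOp : Module.End ℝ D.Vpw :=
  D.basis.constr ℝ fun a =>
    if h : a.1 = I.km then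
      let j := I.sm.localIndex (h ▸ a.2 : Fin (D.n I.km + 1) × Fin (D.n I.km + 1))
      if j.2 = 0 then I.average (I.lamM j.1) + I.correction r (I.corrM r j.1) else D.basis a
    else if h : a.1 = I.kp then
      let j := I.sp.localIndex (h ▸ a.2 : Fin (D.n I.kp + 1) × Fin (D.n I.kp + 1))
      if j.2 = 0 then
        I.average (I.res r (I.lamP j.1)) - I.correction r (I.res r (I.corrP r j.1))
      else D.basis a
    else D.basis a

end Interface

open Classical in
/-- The local edge operator `P_e` of an arbitrary edge, for a choice of the coarse and the fine
patch at every interior edge; on boundary edges there is no constraint and `P_e` is the identity. -/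
def edgeOp (I : ∀ e, D.IsInterior e → D.Interface e) (r : ℕ) (e : Set Plane) :
    Module.End ℝ D.Vpw :=
  if h : D.IsInterior e then (I e h).edgeOp r else 1

/-- `P_V`, the product of the vertex operators (in some order). -/
def vertexProd (r : ℕ) : Module.End ℝ D.Vpw :=
  (D.vertices.toList.map (D.vertexOp r)).prod

/-- `P_E`, the product of the edge operators (in some order). -/
def edgeProd (I : ∀ e, D.IsInterior e → D.Interface e) (r : ℕ) : Module.End ℝ D.Vpw :=
  (D.edges.toList.map (D.edgeOp I r)).prod

/-- `P⁰ = P_E P_V`. -/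
def P0 (I : ∀ e, D.IsInterior e → D.Interface e) (r : ℕ) : Module.End ℝ D.Vpw :=
  D.edgeProd I r * D.vertexProd r

/-- The polynomials of degree at most `r - 1` in each of the two variables (`0` for `r = 0`). -/
def polyQ (r : ℕ) : Submodule ℝ (ℝ × ℝ → ℝ) :=
  Submodule.span ℝ {q | ∃ a b : ℕ, a < r ∧ b < r ∧ q = fun x => x.1 ^ a * x.2 ^ b}

/-- Preservation of the logical polynomial moments of order `r` on every patch. -/
def MomentPreserving (r : ℕ) (P : Module.End ℝ D.Vpw) : Prop :=
  ∀ (v : D.Vpw) (k : Fin K), ∀ q ∈ polyQ r,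
    ∫ x in openSquare, (P v : Plane → ℝ) (D.F k x) * q x
      = ∫ x in openSquare, (v : Plane → ℝ) (D.F k x) * q x

end Multipatch

end BrokenFEEC

end

/-!
The proof has an algebraic part, about B-spline coefficients, and an analytic part, which identifies
the conforming space; between them stands the space of splines whose coefficients satisfy

* corner condition (`vertexConforming`): the corner coefficients of all patches at a vertex agree;
* trace condition (`TracesMatch`): on every interior edge the trace from the fine patch is the image
  of the trace from the coarse patch under the inclusion of the spline spaces.

**Algebra.** Every vertex operator is the identity plus an increment. The increment at `v` has
corner coefficients only at `v`, where it replaces each of them by their mean, and it depends only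
on the corner coefficients at `v`; it vanishes if these agree. The three cells of a knot vector give
`r < n`, so that the correction functions, with indices `1, …, r`, involve no other corner. Hence
the increments of a product of vertex operators just add up, in any order
(`list_prod_apply_eq_add_sum`), and the product is a projection onto the corner condition.

On a spline with the corner condition, the two traces on an edge have the same end coefficients, and
the restriction operator keeps end coefficients. The factors `a_i` and `b_i` at the end indices
therefore contribute nothing (`Interface.corr_diff`), and the increment of the edge operator is
supported on rows parallel to the edge whose end coefficients vanish. Such rows have no corner
coefficients and no trace on any other side (`Interface.map_increment_eq_zero`), so that the
increments of different edges do not see each other and again add up in any order. On its own edge,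
the increment replaces both traces by one coarse spline (`Interface.trP_increment`), and it vanishes
if the traces agree already, because restriction after inclusion is the identity
(`restrictOp_inclusion`). Thus `P0` is a projection onto the corner and trace conditions.

**Moments.** All corrections replace a B-spline by a combination of its neighbours with the same
moments. Such a combination exists because the moments of order `r` of `r` consecutive B-splines of
degree `p` are linearly independent (`isUnit_momentMatrix`): by repeated integration and Rolle's
argument, a nonzero function orthogonal to the polynomials of degree below `r` has at least `r` sign
changes (`exists_altFrom_of_orthogonal`), but a combination of `r` consecutive B-splines has at most
`r - 1` of them (`altFrom_combo`). The restriction operator keeps moments because polynomials of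
degree at most `p` are splines (`marsden`), so that the `L²` projection keeps their moments.

**The conforming space is given by the two conditions.** A spline with both conditions takes
the same value at a point from all closed patches that contain it (`value_eq_of_tracesMatch`); here
one uses that no third patch contains an interior edge, since it would have to lie on one of the two
sides of the edge. It therefore has a continuous extension that is Lipschitz on each closed
patch, hence locally Lipschitz in `Ω`, and by Rademacher's theorem its directional derivatives are
weak derivatives (`mem_H1_of_locally_lipschitz`).

Conversely, let a spline lie in `H¹(Ω)`. The relative interior of an interior edge lies in `Ω`,
as the boundary of `Ω` is Lipschitz (`IsPatchMap.side_mem`). At one of its points, the blow-ups of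
the spline converge to a function that is constant on each side of the tangent. By the scaling of
the Dirichlet energy in the plane, their energy is that of the spline in a shrinking disc and tends
to zero; so the two constants agree (`tendsto_blowup`, `eq_of_blowup`).
This is the trace condition. At a vertex, the patches with a given corner value and those with
other values meet only in the vertex; but as `Ω` has Lipschitz boundary, its points near the vertex,
other than the vertex, lie in a connected subset of `Ω` that does not contain the vertex
(`exists_isPreconnected`), and two closed sets with nothing in common cannot divide it. This is the
corner condition.
-/

noncomputable section

namespace BrokenFEEC

/-! ### Calculus of univariate B-splines -/

namespace Knots

variable {p : ℕ} (S : Knots p)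

lemma knot_le_one (i : ℕ) : S.ξ i ≤ 1 := by
  rw [← S.right (S.n + 1 + i) (by omega)]
  exact S.mono (by omega)

lemma knot_lt_one {i : ℕ} (hi : i ≤ S.n) : S.ξ i < 1 := by
  rcases le_or_gt p i with h | h
  · exact (S.strict i h hi).trans_le (S.knot_le_one _)
  · rw [S.left i h.le]
    exact one_pos

lemma knot_pos {i : ℕ} (hi : p < i) : 0 < S.ξ i := by
  have h1 := S.strict p le_rfl (by have := S.three_cells; omega)
  rw [S.left p le_rfl] at h1
  exact h1.trans_le (S.mono hi)

/-- A B-spline whose support has collapsed to a point vanishes, thanks to the convention for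
division by zero in the recursion. -/
lemma bspline_degenerate (q : ℕ) : ∀ (i : ℕ) (x : ℝ), S.ξ i = S.ξ (i + q + 1) →
    bspline S.ξ q i x = 0 := by
  induction q with
  | zero =>
    intro i x h
    simp only [bspline]
    rw [if_neg]
    rintro (⟨h1, h2⟩ | ⟨-, h1, h2⟩)
    · rw [add_zero] at h; linarith
    · rw [add_zero] at h; linarith
  | succ q ih =>
    intro i x h
    have h1 := S.mono (show i ≤ i + 1 by omega)
    have h2 := S.mono (show i + 1 ≤ i + q + 1 by omega)
    have h3 := S.mono (show i + q + 1 ≤ i + (q + 1) + 1 by omega)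
    simp only [bspline]
    rw [ih i x (by linarith), ih (i + 1) x (by
      rw [show i + 1 + q + 1 = i + (q + 1) + 1 by omega]; linarith)]
    simp

/-- The B-spline divided by the length of its support, `0` for a degenerate support. In these
functions the Cox–de Boor recursion and the derivative formula need no case distinction. -/
def nspline (q i : ℕ) (x : ℝ) : ℝ := bspline S.ξ q i x / (S.ξ (i + q + 1) - S.ξ i)

lemma bspline_eq_mul_nspline (q i : ℕ) (x : ℝ) :
    bspline S.ξ q i x = (S.ξ (i + q + 1) - S.ξ i) * S.nspline q i x := by
  by_cases h : S.ξ i = S.ξ (i + q + 1)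
  · rw [S.bspline_degenerate q i x h, h]; simp
  · rw [nspline, mul_div_cancel₀]
    exact sub_ne_zero.2 (Ne.symm h)

lemma nspline_degenerate {q i : ℕ} (h : S.ξ i = S.ξ (i + q + 1)) (x : ℝ) :
    S.nspline q i x = 0 := by
  rw [nspline, S.bspline_degenerate q i x h, zero_div]

lemma bspline_succ (q i : ℕ) (x : ℝ) :
    bspline S.ξ (q + 1) i x =
      (x - S.ξ i) * S.nspline q i x + (S.ξ (i + q + 2) - x) * S.nspline q (i + 1) x := by
  simp only [bspline, nspline]
  rw [show i + 1 + q + 1 = i + q + 2 by omega]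
  ring

lemma hasDerivAt_bspline_zero (i : ℕ) {x : ℝ} (hx1 : x ≠ 1) (hx : ∀ j, S.ξ j ≠ x) :
    HasDerivAt (bspline S.ξ 0 i) 0 x := by
  have hev : bspline S.ξ 0 i =ᶠ[nhds x] fun _ => bspline S.ξ 0 i x := by
    have h1 : ∀ᶠ y in nhds x, y ≠ 1 := isOpen_ne.mem_nhds hx1
    have hlt : ∀ j, ∀ᶠ y in nhds x, (S.ξ j < y ↔ S.ξ j < x) ∧ S.ξ j ≠ y := by
      intro j
      rcases lt_or_gt_of_ne (hx j) with h | h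
      · filter_upwards [lt_mem_nhds h] with y hy
        exact ⟨by simp [h, hy], hy.ne⟩
      · filter_upwards [gt_mem_nhds h] with y hy
        exact ⟨by simp [not_lt.2 h.le, not_lt.2 hy.le], hy.ne'⟩
    filter_upwards [h1, hlt i, hlt (i + 1)] with y hy h2 h3
    have e1 : S.ξ i ≤ y ↔ S.ξ i ≤ x := by
      rw [le_iff_lt_or_eq, le_iff_lt_or_eq, h2.1]
      simp [h2.2, hx i]
    have e2 : y < S.ξ (i + 1) ↔ x < S.ξ (i + 1) := by
      rw [← not_le, ← not_le, le_iff_lt_or_eq, le_iff_lt_or_eq, h3.1]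
      simp [h3.2, hx (i + 1)]
    simp only [bspline, e1, e2, hy, hx1]
  exact (hasDerivAt_const x _).congr_of_eventuallyEq hev

/-- The derivative of a B-spline away from the knots. -/
lemma hasDerivAt_bspline (q : ℕ) : ∀ (i : ℕ) {x : ℝ}, x ≠ 1 → (∀ j, S.ξ j ≠ x) →
    HasDerivAt (bspline S.ξ (q + 1) i)
      ((q + 1 : ℝ) * (S.nspline q i x - S.nspline q (i + 1) x)) x := by
  have key : ∀ (q i : ℕ) (x d e : ℝ), HasDerivAt (S.nspline q i) d x →
      HasDerivAt (S.nspline q (i + 1)) e x →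
      HasDerivAt (bspline S.ξ (q + 1) i) (S.nspline q i x - S.nspline q (i + 1) x
        + ((x - S.ξ i) * d + (S.ξ (i + q + 2) - x) * e)) x := by
    intro q i x d e h1 h2
    have h := (((hasDerivAt_id x).sub_const (S.ξ i)).mul h1).add
      (((hasDerivAt_id x).const_sub (S.ξ (i + q + 2))).mul h2)
    have heq : bspline S.ξ (q + 1) i = ((fun x => id x - S.ξ i) * S.nspline q i
        + (fun x => S.ξ (i + q + 2) - id x) * S.nspline q (i + 1)) := by
      funext y
      simp [S.bspline_succ]
    rw [heq]
    refine h.congr_deriv ?_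
    simp only [id]
    ring
  induction q with
  | zero =>
    intro i x hx1 hx
    have h0 : ∀ i, HasDerivAt (S.nspline 0 i) 0 x := fun i => by
      have h := (S.hasDerivAt_bspline_zero i hx1 hx).div_const (S.ξ (i + 0 + 1) - S.ξ i)
      rw [zero_div] at h
      exact h
    have h := key 0 i x 0 0 (h0 i) (h0 (i + 1))
    refine h.congr_deriv ?_
    simp
  | succ q ih =>
    intro i x hx1 hx
    have hN : ∀ i, HasDerivAt (S.nspline (q + 1) i) ((q + 1 : ℝ) *
        (S.nspline q i x - S.nspline q (i + 1) x) / (S.ξ (i + (q + 1) + 1) - S.ξ i)) x :=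
      fun i => (ih i hx1 hx).div_const _
    refine (key (q + 1) i x _ _ (hN i) (hN (i + 1))).congr_deriv ?_
    have hB : ∀ i, S.nspline (q + 1) i x = ((x - S.ξ i) * S.nspline q i x
        + (S.ξ (i + q + 2) - x) * S.nspline q (i + 1) x) / (S.ξ (i + (q + 1) + 1) - S.ξ i) :=
      fun i => by rw [nspline, S.bspline_succ]
    -- both sides telescope to the same multiple of the middle function of degree `q`
    have h1 : (x - S.ξ i) * ((q + 1 : ℝ) * (S.nspline q i x - S.nspline q (i + 1) x)
        / (S.ξ (i + (q + 1) + 1) - S.ξ i)) - (q + 1) * S.nspline (q + 1) i x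
        = - (q + 1) * S.nspline q (i + 1) x := by
      by_cases hd : S.ξ i = S.ξ (i + (q + 1) + 1)
      · rw [S.nspline_degenerate hd, S.nspline_degenerate (q := q) (i := i + 1), hd]
        · simp
        · have h1 := S.mono (show i ≤ i + 1 by omega)
          have h2 := S.mono (show i + 1 ≤ i + 1 + q + 1 by omega)
          rw [show i + (q + 1) + 1 = i + 1 + q + 1 by omega] at hd
          linarith
      · rw [hB, show i + (q + 1) + 1 = i + q + 2 by omega] at *
        have : S.ξ (i + q + 2) - S.ξ i ≠ 0 := sub_ne_zero.2 (Ne.symm hd)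
        field_simp
        ring
    have h2 : (S.ξ (i + (q + 1) + 2) - x) * ((q + 1 : ℝ) *
        (S.nspline q (i + 1) x - S.nspline q (i + 1 + 1) x)
        / (S.ξ (i + 1 + (q + 1) + 1) - S.ξ (i + 1))) + (q + 1) * S.nspline (q + 1) (i + 1) x
        = (q + 1) * S.nspline q (i + 1) x := by
      by_cases hd : S.ξ (i + 1) = S.ξ (i + 1 + (q + 1) + 1)
      · rw [S.nspline_degenerate hd, S.nspline_degenerate (q := q) (i := i + 1), hd]
        · simp
        · have h1 := S.mono (show i + 1 ≤ i + 1 + q + 1 by omega)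
          have h2 := S.mono (show i + 1 + q + 1 ≤ i + 1 + (q + 1) + 1 by omega)
          linarith
      · rw [hB, show i + (q + 1) + 2 = i + q + 3 by omega,
          show i + 1 + (q + 1) + 1 = i + q + 3 by omega, show i + 1 + q + 2 = i + q + 3 by omega]
        rw [show i + 1 + (q + 1) + 1 = i + q + 3 by omega] at hd
        have : S.ξ (i + q + 3) - S.ξ (i + 1) ≠ 0 := sub_ne_zero.2 (Ne.symm hd)
        field_simp
        ring
    push_cast
    linarith

/-- B-splines of positive degree are continuous: those of degree one are hat functions or, where a
knot is repeated at an end of the interval, half of one. -/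
lemma continuousOn_bspline (q i : ℕ) : ContinuousOn (bspline S.ξ (q + 1) i) (Icc 0 1) := by
  induction q generalizing i with
  | zero =>
    have hval : ∀ x ∈ Icc (0 : ℝ) 1, bspline S.ξ (0 + 1) i x =
        (x - S.ξ i) * S.nspline 0 i x + (S.ξ (i + 2) - x) * S.nspline 0 (i + 1) x :=
      fun x _ => S.bspline_succ 0 i x
    have h1 := S.mono (show i ≤ i + 1 by omega)
    have h2 := S.mono (show i + 1 ≤ i + 2 by omega)
    rcases h1.eq_or_lt with e1 | e1
    · rcases h2.eq_or_lt with e2 | e2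
      · refine (continuousOn_const (c := (0 : ℝ))).congr fun x hx => ?_
        rw [hval x hx, S.nspline_degenerate (by simpa using e1),
          S.nspline_degenerate (by simpa using e2)]
        simp
      · -- a double knot: it is the end point `0`
        have hi : i + 1 ≤ p := by
          by_contra! h
          have := S.strict i (by omega) (by
            by_contra! h'
            rw [S.right (i + 1) (by omega), S.right (i + 2) (by omega)] at e2
            exact lt_irrefl _ e2)
          linarith
        have hz := S.left (i + 1) hi
        refine (Continuous.continuousOn (f := fun x : ℝ => max 0 ((S.ξ (i + 2) - x)
          / (S.ξ (i + 2) - S.ξ (i + 1)))) (by fun_prop)).congr fun x hx => ?_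
        rw [hval x hx, S.nspline_degenerate (i := i) (by simpa using e1), mul_zero, zero_add]
        have hd : 0 < S.ξ (i + 2) - S.ξ (i + 1) := sub_pos.2 e2
        simp only [nspline, bspline]
        rw [show i + 1 + 0 + 1 = i + 2 by omega, show i + 1 + 1 = i + 2 by omega]
        rcases lt_or_ge x (S.ξ (i + 2)) with hx2 | hx2
        · rw [if_pos (Or.inl ⟨by rw [hz]; exact hx.1, hx2⟩), max_eq_right]
          · ring
          · exact div_nonneg (by linarith) hd.le
        · rw [max_eq_left (div_nonpos_of_nonpos_of_nonneg (by linarith) hd.le)]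
          rcases hx2.eq_or_lt with h | h
          · rw [h]; simp
          · rw [if_neg]
            · simp
            · rintro (⟨-, h'⟩ | ⟨h', -, h''⟩)
              · linarith
              · linarith
    · rcases h2.eq_or_lt with e2 | e2
      · have hi : S.n + 1 ≤ i + 1 := by
          by_contra! h
          have := S.strict (i + 1) (by
            by_contra! h'
            rw [S.left i (by omega), S.left (i + 1) (by omega)] at e1
            exact lt_irrefl _ e1) (by omega)
          rw [show i + 1 + 1 = i + 2 by omega] at this
          linarith
        have ho := S.right (i + 1) hi
        refine (Continuous.continuousOn (f := fun x : ℝ => max 0 ((x - S.ξ i)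
          / (S.ξ (i + 1) - S.ξ i))) (by fun_prop)).congr fun x hx => ?_
        rw [hval x hx, S.nspline_degenerate (i := i + 1) (by simpa using e2), mul_zero, add_zero]
        have hd : 0 < S.ξ (i + 1) - S.ξ i := sub_pos.2 e1
        simp only [nspline, bspline, add_zero]
        rcases le_or_gt (S.ξ i) x with hx2 | hx2
        · rw [if_pos, max_eq_right]
          · ring
          · exact div_nonneg (by linarith) hd.le
          · rcases hx.2.eq_or_lt with h | h
            · exact Or.inr ⟨h, by linarith, ho⟩
            · exact Or.inl ⟨hx2, by linarith⟩
        · rw [max_eq_left (div_nonpos_of_nonpos_of_nonneg (by linarith) hd.le), if_neg]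
          · simp
          · rintro (⟨h', -⟩ | ⟨h', h'', -⟩)
            · linarith
            · linarith
      · refine (Continuous.continuousOn (f := fun x : ℝ => max 0 (min ((x - S.ξ i)
          / (S.ξ (i + 1) - S.ξ i)) ((S.ξ (i + 2) - x) / (S.ξ (i + 2) - S.ξ (i + 1)))))
          (by fun_prop)).congr fun x hx => ?_
        rw [hval x hx]
        have hd : 0 < S.ξ (i + 1) - S.ξ i := sub_pos.2 e1
        have hd' : 0 < S.ξ (i + 2) - S.ξ (i + 1) := sub_pos.2 e2
        have hlt1 : S.ξ (i + 1) < 1 := e2.trans_le (S.knot_le_one _)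
        simp only [nspline, bspline, add_zero]
        rw [show i + 1 + 1 = i + 2 by omega]
        rcases lt_or_ge x (S.ξ i) with a1 | a1
        · rw [if_neg, if_neg, max_eq_left]
          · simp
          · exact min_le_iff.2 (Or.inl (div_nonpos_of_nonpos_of_nonneg (by linarith) hd.le))
          · rintro (⟨h', -⟩ | ⟨h', h'', h3⟩) <;> linarith
          · rintro (⟨h', -⟩ | ⟨h', h'', -⟩) <;> linarith
        rcases lt_or_ge x (S.ξ (i + 1)) with a2 | a2
        · rw [if_pos (Or.inl ⟨a1, a2⟩), if_neg, min_eq_left, max_eq_right]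
          · ring
          · exact div_nonneg (by linarith) hd.le
          · exact ((div_le_one hd).2 (by linarith)).trans ((one_le_div hd').2 (by linarith))
          · rintro (⟨h', -⟩ | ⟨h', h'', -⟩) <;> linarith
        rw [if_neg (show ¬ _ by rintro (⟨-, h'⟩ | ⟨h', -, h3⟩) <;> linarith)]
        rw [min_eq_right (((div_le_one hd').2 (by linarith)).trans
          ((one_le_div hd).2 (by linarith)))]
        rcases lt_or_ge x (S.ξ (i + 2)) with a3 | a3
        · rw [if_pos (Or.inl ⟨a2, a3⟩), max_eq_right]
          · ring
          · exact div_nonneg (by linarith) hd'.le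
        · rw [max_eq_left (div_nonpos_of_nonpos_of_nonneg (by linarith) hd'.le)]
          rcases a3.eq_or_lt with h | h
          · rw [h]; simp
          · rw [if_neg]
            · simp
            · rintro (⟨-, h'⟩ | ⟨h', -, h3⟩) <;> linarith
  | succ q ih =>
    have : bspline S.ξ (q + 1 + 1) i = fun x => (x - S.ξ i) * S.nspline (q + 1) i x
        + (S.ξ (i + (q + 1) + 2) - x) * S.nspline (q + 1) (i + 1) x :=
      funext fun x => S.bspline_succ (q + 1) i x
    rw [this]
    have hN : ∀ i, ContinuousOn (S.nspline (q + 1) i) (Icc 0 1) := fun i => (ih i).div_const _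
    have h1 := hN i
    have h2 := hN (i + 1)
    fun_prop

lemma bspline_at_zero (q : ℕ) : ∀ i, p - q ≤ i → i ≤ S.n → q ≤ p →
    bspline S.ξ q i 0 = if i = p - q then 1 else 0 := by
  induction q with
  | zero =>
    intro i h1 h2 _
    simp only [bspline, Nat.sub_zero, zero_ne_one, false_and, or_false]
    rcases h1.eq_or_lt with h | h
    · have h3 : S.ξ i = 0 := S.left i (by omega)
      rw [if_pos ⟨h3.le, S.knot_pos (by omega)⟩, if_pos (by omega)]
    · rw [if_neg (fun h' => absurd h'.1 (not_le.2 (S.knot_pos (by omega)))), if_neg (by omega)]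
  | succ q ih =>
    intro i h1 h2 hq
    have htop : bspline S.ξ q (i + 1) 0 = if i + 1 = p - q then 1 else 0 := by
      rcases h2.eq_or_lt with h | h
      · rw [S.bspline_eq_zero q _ _ zero_ne_one (Or.inl (S.knot_pos ?_)), if_neg] <;>
        · have := S.three_cells; omega
      · exact ih (i + 1) (by omega) (by omega) (by omega)
    rcases h1.eq_or_lt with h | h
    · have h3 : S.ξ i = 0 := S.left i (by omega)
      have h4 : S.ξ (i + 1) = 0 := S.left (i + 1) (by omega)
      have h5 : 0 < S.ξ (i + q + 2) := S.knot_pos (by omega)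
      simp only [bspline]
      rw [htop, h3, h4, if_pos (by omega), if_pos (by omega)]
      simp [h5.ne']
    · simp only [bspline]
      rw [htop, if_neg (show i + 1 ≠ p - q by omega), if_neg (show i ≠ p - (q + 1) by omega),
        ih i (by omega) h2 (by omega)]
      split_ifs with h6
      · rw [S.left i (by omega)]; simp
      · simp

lemma bspline_at_one (q : ℕ) : ∀ i, i ≤ S.n → bspline S.ξ q i 1 = if i = S.n then 1 else 0 := by
  induction q with
  | zero =>
    intro i hi
    simp only [bspline]
    have h1 : ¬ (1 : ℝ) < S.ξ (i + 1) := not_lt.2 (S.knot_le_one _)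
    simp only [h1, and_false, false_or, true_and]
    rcases hi.eq_or_lt with h | h
    · rw [if_pos ⟨S.knot_lt_one hi, S.right _ (by omega)⟩, if_pos h]
    · rw [if_neg (fun h' => (S.knot_lt_one (i := i + 1) (by omega)).ne h'.2), if_neg h.ne]
  | succ q ih =>
    intro i hi
    have htop : ∀ q, bspline S.ξ q (S.n + 1) 1 = 0 := fun q =>
      S.bspline_degenerate q _ _ (by rw [S.right _ (by omega), S.right _ (by omega)])
    simp only [bspline]
    rcases hi.eq_or_lt with h | h
    · subst h
      rw [ih _ le_rfl, htop, if_pos rfl, S.right (S.n + q + 1) (by omega)]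
      have := S.knot_lt_one (le_refl S.n)
      rw [div_self (by linarith)]
      simp
    · rw [ih i h.le, ih (i + 1) (by omega), if_neg h.ne, mul_zero, zero_add]
      split_ifs with h6
      · rw [S.right (i + q + 2) (by omega)]; simp
      · simp

lemma lam_at_zero (o : Bool) (i : Fin (S.n + 1)) : S.lam o i 0 = if i = 0 then 1 else 0 := by
  cases o with
  | true =>
    simp only [lam, orient, orientIdx]
    rw [S.bspline_at_zero p i (by omega) (by omega) le_rfl]
    simp only [Nat.sub_self, Fin.ext_iff, Fin.val_zero]
  | false =>
    simp only [lam, orient, orientIdx, sub_zero]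
    rw [S.bspline_at_one p _ (by omega)]
    simp only [Fin.val_rev, Fin.ext_iff, Fin.val_zero]
    congr 1
    simp only [eq_iff_iff]; omega

lemma lam_at_one (o : Bool) (i : Fin (S.n + 1)) :
    S.lam o i 1 = if i = Fin.last _ then 1 else 0 := by
  cases o with
  | true =>
    simp only [lam, orient, orientIdx]
    rw [S.bspline_at_one p i (by omega)]
    simp [Fin.ext_iff]
  | false =>
    simp only [lam, orient, orientIdx, sub_self]
    rw [S.bspline_at_zero p _ (by omega) (by omega) le_rfl]
    simp only [Fin.val_rev, Fin.ext_iff, Fin.val_last]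
    congr 1
    simp only [eq_iff_iff]; omega

lemma finite_range_knots : (range S.ξ).Finite := by
  refine ((Finset.range (S.n + 2)).image S.ξ).finite_toSet.subset ?_
  rintro _ ⟨i, rfl⟩
  simp only [Finset.coe_image, mem_image, Finset.coe_range, mem_Iio]
  rcases lt_or_ge i (S.n + 2) with h | h
  · exact ⟨i, h, rfl⟩
  · exact ⟨S.n + 1, by omega, by rw [S.right _ le_rfl, S.right _ (by omega)]⟩

lemma bspline_bounded (q i : ℕ) : ∃ M, ∀ x ∈ Icc (0 : ℝ) 1, |bspline S.ξ q i x| ≤ M := by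
  cases q with
  | zero =>
    refine ⟨1, fun x _ => ?_⟩
    simp only [bspline]
    split_ifs <;> simp
  | succ q =>
    obtain ⟨M, hM⟩ := (isCompact_Icc.image_of_continuousOn
      (S.continuousOn_bspline q i)).isBounded.exists_norm_le
    exact ⟨M, fun x hx => hM _ (mem_image_of_mem _ hx)⟩

lemma continuousOn_lam (hp : 1 ≤ p) (o : Bool) (i : Fin (S.n + 1)) :
    ContinuousOn (S.lam o i) (Icc 0 1) := by
  obtain ⟨q, rfl⟩ : ∃ q, p = q + 1 := ⟨p - 1, by omega⟩
  refine (S.continuousOn_bspline q _).comp (f := orient o) ?_ ?_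
  · cases o
    · exact (continuous_const.sub continuous_id).continuousOn
    · exact continuous_id.continuousOn
  · intro t ht
    cases o
    · exact ⟨by simp only [orient]; linarith [ht.2], by simp only [orient]; linarith [ht.1]⟩
    · exact ht

end Knots

/-- A continuous function on `[0, 1]` is the primitive of its derivative, if the latter exists off
a finite set and is interval integrable. -/
lemma sub_eq_integral_of_hasDerivAt {f f' : ℝ → ℝ} {s : Set ℝ} (hs : s.Finite)
    (hf : ContinuousOn f (Icc 0 1)) (hd : ∀ x ∈ Ioo (0 : ℝ) 1, x ∉ s → HasDerivAt f (f' x) x)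
    (hi : IntervalIntegrable f' volume 0 1) {x y : ℝ} (hx : 0 ≤ x) (hxy : x ≤ y) (hy : y ≤ 1) :
    f y - f x = ∫ t in x..y, f' t := by
  refine (MeasureTheory.integral_eq_of_hasDerivAt_off_countable_of_le f f' hxy hs.countable
    (hf.mono (Icc_subset_Icc hx hy)) (fun t ht => hd t ⟨by linarith [ht.1.1], by linarith [ht.1.2]⟩ ht.2)
    (hi.mono_set ?_)).symm
  rw [uIcc_of_le hxy, uIcc_of_le zero_le_one]
  exact Icc_subset_Icc hx hy

namespace Knots
variable {p : ℕ} (S : Knots p)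

lemma measurable_bspline (q i : ℕ) : Measurable (bspline S.ξ q i) := by
  induction q generalizing i with
  | zero =>
    simp only [bspline]
    refine Measurable.ite ?_ measurable_const measurable_const
    have : {a : ℝ | S.ξ i ≤ a ∧ a < S.ξ (i + 1) ∨ a = 1 ∧ S.ξ i < 1 ∧ S.ξ (i + 1) = 1}
      = Ico (S.ξ i) (S.ξ (i + 1)) ∪ ({1} ∩ {_a | S.ξ i < 1 ∧ S.ξ (i + 1) = 1}) := rfl
    rw [this]
    exact measurableSet_Ico.union ((measurableSet_singleton _).inter (MeasurableSet.const _))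
  | succ q ih =>
    have : bspline S.ξ (q + 1) i = fun x => (x - S.ξ i) * S.nspline q i x
        + (S.ξ (i + q + 2) - x) * S.nspline q (i + 1) x :=
      funext fun x => S.bspline_succ q i x
    rw [this]
    have hN : ∀ i, Measurable (S.nspline q i) := fun i => (ih i).div_const _
    have h1 := hN i
    have h2 := hN (i + 1)
    fun_prop

lemma nspline_bounded (q i : ℕ) : ∃ M, ∀ x ∈ Icc (0 : ℝ) 1, |S.nspline q i x| ≤ M := by
  obtain ⟨M, hM⟩ := S.bspline_bounded q i
  refine ⟨M / |S.ξ (i + q + 1) - S.ξ i|, fun x hx => ?_⟩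
  rw [nspline, abs_div]
  exact div_le_div_of_nonneg_right (hM x hx) (abs_nonneg _)

lemma intervalIntegrable_nspline (q i : ℕ) : IntervalIntegrable (S.nspline q i) volume 0 1 := by
  obtain ⟨M, hM⟩ := S.nspline_bounded q i
  rw [intervalIntegrable_iff_integrableOn_Icc_of_le zero_le_one]
  refine Measure.integrableOn_of_bounded (M := M) (by simp)
    ((S.measurable_bspline q i).div_const _).aestronglyMeasurable ?_
  filter_upwards [ae_restrict_mem measurableSet_Icc] with x hx using hM x hx

/-- B-splines of positive degree are Lipschitz: they are continuous, and their derivative off the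
knots is bounded. -/
lemma lipschitz_bspline (q i : ℕ) :
    ∃ C, ∀ x ∈ Icc (0 : ℝ) 1, ∀ y ∈ Icc (0 : ℝ) 1,
      |bspline S.ξ (q + 1) i x - bspline S.ξ (q + 1) i y| ≤ C * |x - y| := by
  obtain ⟨M, hM⟩ := S.nspline_bounded q i
  obtain ⟨M', hM'⟩ := S.nspline_bounded q (i + 1)
  refine ⟨(q + 1) * (M + M'), fun x hx y hy => ?_⟩
  wlog hxy : y ≤ x generalizing x y
  · rw [abs_sub_comm, abs_sub_comm x]
    exact this y hy x hx (by linarith)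
  rw [sub_eq_integral_of_hasDerivAt S.finite_range_knots (S.continuousOn_bspline q i)
    (fun t ht hts => S.hasDerivAt_bspline q i ht.2.ne (fun j hj => hts ⟨j, hj⟩))
    (((S.intervalIntegrable_nspline q i).sub (S.intervalIntegrable_nspline q (i + 1))).const_mul _)
    hy.1 hxy hx.2]
  rw [abs_of_nonneg (sub_nonneg.2 hxy), ← Real.norm_eq_abs,
    ← abs_of_nonneg (sub_nonneg.2 hxy)]
  refine intervalIntegral.norm_integral_le_of_norm_le_const fun t ht => ?_
  rw [uIoc_of_le hxy] at ht
  have ht' : t ∈ Icc (0 : ℝ) 1 := ⟨by linarith [ht.1, hy.1], by linarith [ht.2, hx.2]⟩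
  rw [norm_mul, Real.norm_eq_abs, Real.norm_eq_abs, abs_of_nonneg (by positivity)]
  refine mul_le_mul_of_nonneg_left ?_ (by positivity)
  exact (abs_sub _ _).trans (add_le_add (hM t ht') (hM' t ht'))

lemma lipschitz_lam (hp : 1 ≤ p) (o : Bool) (i : Fin (S.n + 1)) :
    ∃ C, ∀ x ∈ Icc (0 : ℝ) 1, ∀ y ∈ Icc (0 : ℝ) 1,
      |S.lam o i x - S.lam o i y| ≤ C * |x - y| := by
  obtain ⟨q, rfl⟩ : ∃ q, p = q + 1 := ⟨p - 1, by omega⟩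
  obtain ⟨C, hC⟩ := S.lipschitz_bspline q (orientIdx o i : Fin (S.n + 1))
  refine ⟨C, fun x hx y hy => ?_⟩
  have ho : ∀ t ∈ Icc (0 : ℝ) 1, orient o t ∈ Icc (0 : ℝ) 1 := fun t ht => by
    cases o
    · exact ⟨by simp only [orient]; linarith [ht.2], by simp only [orient]; linarith [ht.1]⟩
    · exact ht
  refine (hC _ (ho x hx) _ (ho y hy)).trans_eq ?_
  cases o <;> simp only [orient]
  rw [show 1 - x - (1 - y) = -(x - y) by ring, abs_neg]

open Polynomial in
/-- Marsden's identity, with the free parameter as a polynomial variable. -/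
lemma marsden (q : ℕ) (hq : q ≤ p) {x : ℝ} (hx0 : 0 ≤ x) (hx1 : x < 1) :
    ∑ i ∈ Finset.range (S.n + 1), C (bspline S.ξ q i x) *
      ∏ j ∈ Finset.range q, (X + C (S.ξ (i + j + 1))) = (X + C x) ^ q := by
  induction q with
  | zero =>
    obtain ⟨i, hi, h1, h2⟩ : ∃ i, i ≤ S.n ∧ S.ξ i ≤ x ∧ x < S.ξ (i + 1) := by
      by_contra! h
      have : ∀ i ≤ S.n + 1, S.ξ i ≤ x := by
        intro i
        induction i with
        | zero => intro _; rw [S.left 0 (by omega)]; exact hx0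
        | succ i ih => intro hi; exact h i (by omega) (ih (by omega))
      have := this _ le_rfl
      rw [S.right _ le_rfl] at this
      linarith
    simp only [Finset.range_zero, Finset.prod_empty, mul_one, pow_zero]
    rw [Finset.sum_eq_single i]
    · simp [bspline, h1, h2]
    · intro j _ hj
      rw [S.bspline_eq_zero 0 j x hx1.ne, C_0]
      rcases lt_or_gt_of_ne hj with h | h
      · exact Or.inr ((S.mono (by omega)).trans h1)
      · exact Or.inl (h2.trans_le (S.mono (by omega)))
    · intro h; simp at h; omega
  | succ q ih =>
    set ψ : ℕ → ℕ → ℝ[X] := fun q i => ∏ j ∈ Finset.range q, (X + C (S.ξ (i + j + 1))) with hψ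
    have e1 : ∀ i, ψ (q + 1) i = ψ q i * (X + C (S.ξ (i + q + 1))) := fun i => by
      simp only [hψ, Finset.prod_range_succ]
    have e2 : ∀ i, ψ (q + 1) i = ψ q (i + 1) * (X + C (S.ξ (i + 1))) := fun i => by
      simp only [hψ]
      rw [Finset.prod_range_succ']
      simp only [add_zero]
      congr 1
      refine Finset.prod_congr rfl fun j _ => ?_
      rw [show i + (j + 1) + 1 = i + 1 + j + 1 by omega]
    have hN0 : S.nspline q 0 x = 0 := S.nspline_degenerate (by
      rw [S.left _ (by omega), S.left _ (by omega)]) x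
    have hNn : S.nspline q (S.n + 1) x = 0 := S.nspline_degenerate (by
      rw [S.right _ (by omega), S.right _ (by omega)]) x
    calc ∑ i ∈ Finset.range (S.n + 1), C (bspline S.ξ (q + 1) i x) * ψ (q + 1) i
        = ∑ i ∈ Finset.range (S.n + 1), (C ((x - S.ξ i) * S.nspline q i x) *
            (ψ q i * (X + C (S.ξ (i + q + 1))))) + ∑ i ∈ Finset.range (S.n + 1),
            C ((S.ξ (i + q + 2) - x) * S.nspline q (i + 1) x) *
              (ψ q (i + 1) * (X + C (S.ξ (i + 1)))) := by
          rw [← Finset.sum_add_distrib]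
          refine Finset.sum_congr rfl fun i _ => ?_
          rw [S.bspline_succ, C_add, add_mul]
          nth_rewrite 1 [e1]
          rw [e2]
      _ = ∑ i ∈ Finset.range (S.n + 1), (C ((x - S.ξ i) * S.nspline q i x) *
            (ψ q i * (X + C (S.ξ (i + q + 1))))) + ∑ i ∈ Finset.range (S.n + 1),
            C ((S.ξ (i + q + 1) - x) * S.nspline q i x) * (ψ q i * (X + C (S.ξ i))) := by
          -- the second sum is shifted by one index; its boundary terms are degenerate
          congr 1
          have h := Finset.sum_range_succ' (fun i => C ((S.ξ (i + q + 1) - x) * S.nspline q i x) *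
            (ψ q i * (X + C (S.ξ i)))) (S.n + 1)
          rw [Finset.sum_range_succ, hNn, hN0] at h
          simp only [mul_zero, C_0, zero_mul, add_zero] at h
          rw [h]
          refine Finset.sum_congr rfl fun i _ => ?_
          rw [show i + 1 + q + 1 = i + q + 2 by omega]
      _ = (∑ i ∈ Finset.range (S.n + 1), C (bspline S.ξ q i x) * ψ q i) * (X + C x) := by
          rw [← Finset.sum_add_distrib, Finset.sum_mul]
          refine Finset.sum_congr rfl fun i _ => ?_
          rw [S.bspline_eq_mul_nspline q i x]
          simp only [C_mul, C_sub]
          ring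
      _ = (X + C x) ^ (q + 1) := by
          rw [ih (by omega), pow_succ]

/-- Monomials of degree at most `p` are splines. -/
lemma exists_monomial_eq (j : ℕ) (hj : j ≤ p) :
    ∃ c : Fin (S.n + 1) → ℝ, ∀ x ∈ Ico (0 : ℝ) 1, ∑ i, c i * bspline S.ξ p i x = x ^ j := by
  refine ⟨fun i => ((p.choose (p - j) : ℝ))⁻¹ * (∏ k ∈ Finset.range p,
    (Polynomial.X + Polynomial.C (S.ξ ((i : ℕ) + k + 1)))).coeff (p - j), fun x hx => ?_⟩
  have h := congrArg (fun P => Polynomial.coeff P (p - j)) (S.marsden p le_rfl hx.1 hx.2)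
  simp only [Polynomial.finsetSum_coeff, Polynomial.coeff_C_mul,
    Polynomial.coeff_X_add_C_pow, Nat.sub_sub_self hj] at h
  rw [Finset.sum_range] at h
  have hc : (p.choose (p - j) : ℝ) ≠ 0 := by
    exact_mod_cast (Nat.choose_pos (Nat.sub_le _ _)).ne'
  rw [eq_comm, ← mul_left_inj' hc, ← h, Finset.sum_mul]
  refine Finset.sum_congr rfl fun i _ => ?_
  field_simp

end Knots

/-! ### Sign alternations and the duality of B-splines with polynomials -/

/-- There are `m` points `x < y₁ < ⋯ < y_m < 1` at which `f` takes nonzero values of alternating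
sign, the sign of `f y₁` being that of `σ`. -/
def AltFrom (f : ℝ → ℝ) : ℕ → ℝ → ℝ → Prop
  | 0, _, _ => True
  | m + 1, σ, x => ∃ y, x < y ∧ y < 1 ∧ 0 < σ * f y ∧ AltFrom f m (-σ) y

namespace AltFrom

lemma weaken {f : ℝ → ℝ} {m : ℕ} {σ x x' : ℝ} (h : AltFrom f m σ x) (hx : x' ≤ x) :
    AltFrom f m σ x' := by
  cases m with
  | zero => trivial
  | succ m =>
    obtain ⟨y, h1, h2⟩ := h
    exact ⟨y, hx.trans_lt h1, h2⟩

lemma congr {f g : ℝ → ℝ} (hfg : ∀ x ∈ Ioo (0 : ℝ) 1, f x = g x) {m : ℕ} :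
    ∀ {σ x : ℝ}, 0 ≤ x → AltFrom f m σ x → AltFrom g m σ x := by
  induction m with
  | zero => intros; trivial
  | succ m ih =>
    rintro σ x hx ⟨y, h1, h2, h3, h4⟩
    exact ⟨y, h1, h2, by rwa [← hfg y ⟨hx.trans_lt h1, h2⟩], ih (hx.trans h1.le) h4⟩

section Rolle

variable {f f' : ℝ → ℝ} (H : ∀ σ x y : ℝ, 0 ≤ x → x < y → y ≤ 1 → 0 < σ * (f y - f x) →
  ∃ z, x < z ∧ z < y ∧ 0 < σ * f' z)
include H

/-- Rolle's argument: between two alternations of `f` there is a sign of the derivative. -/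
lemma deriv {m : ℕ} : ∀ {σ x : ℝ}, 0 ≤ x → σ * f x ≤ 0 → AltFrom f m σ x →
    AltFrom f' m σ x := by
  induction m with
  | zero => intros; trivial
  | succ m ih =>
    rintro σ x hx h0 ⟨y, h1, h2, h3, h4⟩
    obtain ⟨z, hz1, hz2, hz3⟩ := H σ x y hx h1 h2.le (by linarith)
    exact ⟨z, hz1, hz2.trans h2, hz3, (ih (hx.trans h1.le) (by linarith) h4).weaken hz2.le⟩

/-- If `f` vanishes at the right end point, then its derivative has one alternation more. -/
lemma deriv_right (hf1 : f 1 = 0) {m : ℕ} : ∀ {σ x : ℝ}, 0 ≤ x → x < 1 → σ * f x < 0 →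
    AltFrom f m σ x → AltFrom f' (m + 1) σ x := by
  induction m with
  | zero =>
    intro σ x hx hx1 h0 _
    obtain ⟨z, hz1, hz2, hz3⟩ := H σ x 1 hx hx1 le_rfl (by rw [hf1]; linarith)
    exact ⟨z, hz1, hz2, hz3, trivial⟩
  | succ m ih =>
    rintro σ x hx hx1 h0 ⟨y, h1, h2, h3, h4⟩
    obtain ⟨z, hz1, hz2, hz3⟩ := H σ x y hx h1 h2.le (by linarith)
    exact ⟨z, hz1, hz2.trans h2, hz3, (ih (hx.trans h1.le) h2 (by linarith) h4).weaken hz2.le⟩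

/-- If `f` vanishes at both end points, then its derivative has one alternation more. -/
lemma deriv_both (hf0 : f 0 = 0) (hf1 : f 1 = 0) {m : ℕ} {σ : ℝ} (h : AltFrom f (m + 1) σ 0) :
    AltFrom f' (m + 2) σ 0 := by
  obtain ⟨y, h1, h2, h3, h4⟩ := h
  obtain ⟨z, hz1, hz2, hz3⟩ := H σ 0 y le_rfl h1 h2.le (by rw [hf0]; linarith)
  exact ⟨z, hz1, hz2.trans h2, hz3, (deriv_right H hf1 h1.le h2 (by linarith) h4).weaken hz2.le⟩

end Rolle

end AltFrom

/-- The sign version of the mean value theorem, for a primitive. -/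
lemma exists_deriv_sign {f f' : ℝ → ℝ} {σ x y : ℝ} (hxy : x < y)
    (hI : f y - f x = ∫ t in x..y, f' t) (h : 0 < σ * (f y - f x)) :
    ∃ z, x < z ∧ z < y ∧ 0 < σ * f' z := by
  by_contra! hc
  rw [hI, ← intervalIntegral.integral_const_mul, intervalIntegral.integral_of_le hxy.le,
    integral_Ioc_eq_integral_Ioo] at h
  exact absurd h (not_lt.2 (setIntegral_nonpos measurableSet_Ioo fun z hz => hc z hz.1 hz.2))

/-- A nonzero continuous function that is orthogonal to the polynomials of degree below `r` has `r`
sign changes: its primitive vanishes at both end points and is orthogonal to the polynomials of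
degree below `r - 1`, so that Rolle's argument gives one more sign change at each step. -/
lemma exists_altFrom_of_orthogonal (r : ℕ) : ∀ f : ℝ → ℝ, Continuous f →
    (∀ j < r, ∫ t in (0 : ℝ)..1, f t * t ^ j = 0) → (∃ x ∈ Ioo (0 : ℝ) 1, f x ≠ 0) →
    ∃ σ, AltFrom f (r + 1) σ 0 := by
  induction r with
  | zero =>
    rintro f - - ⟨x, hx, h⟩
    exact ⟨f x, x, hx.1, hx.2, mul_self_pos.2 h, trivial⟩
  | succ r ih =>
    rintro f hf hj ⟨x, hx, h⟩
    set F : ℝ → ℝ := fun x => ∫ t in (0 : ℝ)..x, f t with hF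
    have hd : ∀ x, HasDerivAt F (f x) x := fun x =>
      intervalIntegral.integral_hasDerivAt_right (hf.intervalIntegrable _ _)
        hf.aestronglyMeasurable.stronglyMeasurableAtFilter hf.continuousAt
    have hFc : Continuous F := continuous_iff_continuousAt.2 fun x => (hd x).continuousAt
    have hF0 : F 0 = 0 := by simp [hF]
    have hF1 : F 1 = 0 := by simpa [hF] using hj 0 (by omega)
    have hFj : ∀ j < r, ∫ t in (0 : ℝ)..1, F t * t ^ j = 0 := by
      intro j hjr
      have hp : ∀ t, HasDerivAt (fun t : ℝ => t ^ (j + 1) / (j + 1 : ℝ)) (t ^ j) t := fun t => by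
        refine ((hasDerivAt_pow (j + 1) t).div_const (j + 1 : ℝ)).congr_deriv ?_
        push_cast
        have : (j + 1 : ℝ) ≠ 0 := by positivity
        rw [mul_div_assoc, mul_comm, div_mul_cancel₀ _ this]
      rw [intervalIntegral.integral_mul_deriv_eq_deriv_mul (fun t _ => hd t) (fun t _ => hp t)
        (hf.intervalIntegrable _ _) ((continuous_pow j).intervalIntegrable _ _), hF1, hF0]
      have h3 : ∫ t in (0 : ℝ)..1, f t * (t ^ (j + 1) / (j + 1 : ℝ))
          = (∫ t in (0 : ℝ)..1, f t * t ^ (j + 1)) / (j + 1 : ℝ) := by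
        rw [← intervalIntegral.integral_div]
        simp only [mul_div_assoc]
      rw [h3, hj (j + 1) (by omega)]
      simp
    have hFne : ∃ x ∈ Ioo (0 : ℝ) 1, F x ≠ 0 := by
      by_contra! hc
      refine h ((hd x).unique ?_)
      refine (hasDerivAt_const x (0 : ℝ)).congr_of_eventuallyEq ?_
      filter_upwards [isOpen_Ioo.mem_nhds hx] with y hy using hc y hy
    obtain ⟨σ, hσ⟩ := ih F hFc hFj hFne
    refine ⟨σ, AltFrom.deriv_both (f := F) ?_ hF0 hF1 hσ⟩
    intro σ x y hx hxy hy h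
    exact exists_deriv_sign hxy (by
      rw [intervalIntegral.integral_eq_sub_of_hasDerivAt (fun t _ => hd t)
        (hf.intervalIntegrable _ _)]) h

namespace Knots

variable {p : ℕ} (S : Knots p)

/-- A linear combination of B-splines of degree `q`. -/
def combo (q : ℕ) (c : ℕ → ℝ) (x : ℝ) : ℝ :=
  ∑ i ∈ Finset.range (S.n + 1), c i * bspline S.ξ q i x

/-- The coefficients of the derivative of a combination of B-splines of degree `q + 1`. They vanish
at the indices of degenerate B-splines, where the denominator is `0`. -/
def diffCoeff (q : ℕ) (c : ℕ → ℝ) (i : ℕ) : ℝ :=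
  (q + 1 : ℝ) * (c i - if i = 0 then 0 else c (i - 1)) / (S.ξ (i + q + 1) - S.ξ i)

lemma continuousOn_combo (q : ℕ) (c : ℕ → ℝ) : ContinuousOn (S.combo (q + 1) c) (Icc 0 1) := by
  refine continuousOn_finsetSum _ fun i _ => ?_
  exact continuousOn_const.mul (S.continuousOn_bspline q i)

lemma combo_diffCoeff (q : ℕ) (hq : q + 1 ≤ p) (c : ℕ → ℝ) (x : ℝ) :
    S.combo q (S.diffCoeff q c) x = ∑ i ∈ Finset.range (S.n + 1),
      c i * ((q + 1 : ℝ) * (S.nspline q i x - S.nspline q (i + 1) x)) := by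
  have hN0 : S.nspline q 0 x = 0 := S.nspline_degenerate (by
    rw [S.left _ (by omega), S.left _ (by omega)]) x
  have hNn : S.nspline q (S.n + 1) x = 0 := S.nspline_degenerate (by
    rw [S.right _ (by omega), S.right _ (by omega)]) x
  have h := Finset.sum_range_succ' (fun i => (if i = 0 then 0 else c (i - 1)) *
    ((q + 1 : ℝ) * S.nspline q i x)) (S.n + 1)
  rw [Finset.sum_range_succ, hNn, hN0] at h
  simp only [mul_zero, add_zero, Nat.add_eq_zero_iff, one_ne_zero, and_false, if_false,
    Nat.add_sub_cancel] at h
  calc S.combo q (S.diffCoeff q c) x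
      = ∑ i ∈ Finset.range (S.n + 1), (c i * ((q + 1 : ℝ) * S.nspline q i x) -
          (if i = 0 then 0 else c (i - 1)) * ((q + 1 : ℝ) * S.nspline q i x)) := by
        refine Finset.sum_congr rfl fun i _ => ?_
        simp only [diffCoeff, nspline]
        ring
    _ = _ := by
        rw [Finset.sum_sub_distrib, h, ← Finset.sum_sub_distrib]
        refine Finset.sum_congr rfl fun i _ => ?_
        ring

lemma combo_sub_eq_integral (q : ℕ) (hq : q + 1 ≤ p) (c : ℕ → ℝ) {x y : ℝ} (hx : 0 ≤ x)
    (hxy : x ≤ y) (hy : y ≤ 1) : S.combo (q + 1) c y - S.combo (q + 1) c x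
      = ∫ t in x..y, S.combo q (S.diffCoeff q c) t := by
  refine sub_eq_integral_of_hasDerivAt S.finite_range_knots (S.continuousOn_combo q c)
    (fun t ht hts => ?_) ?_ hx hxy hy
  · rw [S.combo_diffCoeff q hq]
    exact HasDerivAt.fun_sum fun i _ =>
      (S.hasDerivAt_bspline q i ht.2.ne (fun j hj => hts ⟨j, hj⟩)).const_mul (c i)
  · rw [show S.combo q (S.diffCoeff q c) = fun t => ∑ i ∈ Finset.range (S.n + 1),
      c i * ((q + 1 : ℝ) * (S.nspline q i t - S.nspline q (i + 1) t)) from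
      funext fun t => S.combo_diffCoeff q hq c t]
    rw [intervalIntegrable_iff]
    refine integrable_finsetSum _ fun i _ => intervalIntegrable_iff.1 ?_
    exact (((S.intervalIntegrable_nspline q i).sub
      (S.intervalIntegrable_nspline q (i + 1))).const_mul _).const_mul _

/-- In degree zero, a combination of B-splines is constant on each cell. -/
lemma combo_zero_cell (c : ℕ → ℝ) {i : ℕ} (hi : i ≤ S.n) {x : ℝ} (h1 : S.ξ i ≤ x)
    (h2 : x < S.ξ (i + 1)) : S.combo 0 c x = c i := by
  have hx1 : x ≠ 1 := (h2.trans_le (S.knot_le_one _)).ne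
  rw [combo, Finset.sum_eq_single i]
  · simp [bspline, h1, h2]
  · intro j _ hj
    rw [S.bspline_eq_zero 0 j x hx1, mul_zero]
    rcases lt_or_gt_of_ne hj with h | h
    · exact Or.inr ((S.mono (by omega)).trans h1)
    · exact Or.inl (h2.trans_le (S.mono (by omega)))
  · intro h; simp at h; omega

lemma exists_cell {x : ℝ} {j : ℕ} (hx : S.ξ j ≤ x) (hx1 : x < 1) :
    ∃ i, j ≤ i ∧ i ≤ S.n ∧ S.ξ i ≤ x ∧ x < S.ξ (i + 1) := by
  by_contra! h
  have hall : ∀ i, j ≤ i → S.ξ i ≤ x := by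
    intro i hi
    induction i, hi using Nat.le_induction with
    | base => exact hx
    | succ i hi ih =>
      rcases le_or_gt i S.n with h' | h'
      · exact h i hi h' ih
      · rw [S.right (i + 1) (by omega), ← S.right i (by omega)]
        exact ih
  have := hall (j + S.n + 1) (by omega)
  rw [S.right _ (by omega)] at this
  linarith

/-- In degree zero, each alternation needs a cell of its own, so that at most `b - j` of them take
place from the cell `j` on, and one fewer if the value on the cell `j` has the wrong sign. -/
lemma altFrom_combo_zero (c : ℕ → ℝ) {b : ℕ} (hc : ∀ i, c i ≠ 0 → i < b) (m : ℕ) :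
    ∀ (σ x : ℝ) (j : ℕ), S.ξ j ≤ x → AltFrom (S.combo 0 c) m σ x →
      m ≤ b - j ∧ (x < S.ξ (j + 1) → σ * c j < 0 → m ≤ b - (j + 1)) := by
  induction m with
  | zero => intros; exact ⟨Nat.zero_le _, fun _ _ => Nat.zero_le _⟩
  | succ m ih =>
    rintro σ x j hj ⟨y, h1, h2, h3, h4⟩
    obtain ⟨i, hi1, hi2, hi3, hi4⟩ := S.exists_cell (hj.trans h1.le) h2
    rw [S.combo_zero_cell c hi2 hi3 hi4] at h3
    have hib := hc i (by rintro h; rw [h] at h3; simp at h3)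
    have := (ih (-σ) y i hi3 h4).2 hi4 (by linarith)
    refine ⟨by omega, fun _ hs => ?_⟩
    have : i ≠ j := by rintro rfl; linarith
    omega

/-- Variation diminution: a combination of `b - a` consecutive nondegenerate B-splines has at most
`b - a` alternating values. The derivative is a combination of B-splines of lower degree with at
most one index more; for each end point at which the combination vanishes, it has one alternation
more, and at the other end points an index is saved. -/
lemma altFrom_combo (q : ℕ) : ∀ (c : ℕ → ℝ) (a b m : ℕ) (σ : ℝ), q ≤ p → p - q ≤ a →
    b ≤ S.n + 1 → (∀ i, c i ≠ 0 → a ≤ i ∧ i < b) → AltFrom (S.combo q c) m σ 0 → m ≤ b - a := by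
  induction q with
  | zero =>
    intro c a b m σ _ ha hb hc h
    rcases m with - | m
    · omega
    -- the first of the points lies in a cell with index at least `a`
    obtain ⟨y, h1, h2, h3, h4⟩ := h
    obtain ⟨i, -, hi2, hi3, hi4⟩ := S.exists_cell (j := 0) (x := y)
      (by rw [S.left 0 (by omega)]; exact h1.le) h2
    rw [S.combo_zero_cell c hi2 hi3 hi4] at h3
    have hib := hc i (by rintro h; rw [h] at h3; simp at h3)
    have := (S.altFrom_combo_zero c (fun i hi => (hc i hi).2) m (-σ) y i hi3 h4).2 hi4 (by linarith)
    omega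
  | succ q ih =>
    intro c a b m σ hq ha hb hc h
    rcases m with - | m
    · omega
    have hab : a < b := by
      by_contra! hab
      obtain ⟨y, -, -, h3, -⟩ := h
      have : S.combo (q + 1) c y = 0 := by
        refine Finset.sum_eq_zero fun i _ => ?_
        have : c i = 0 := by
          by_contra hci
          have := hc i hci
          omega
        rw [this, zero_mul]
      rw [this] at h3
      simp at h3
    have H : ∀ σ x y : ℝ, 0 ≤ x → x < y → y ≤ 1 →
        0 < σ * (S.combo (q + 1) c y - S.combo (q + 1) c x) →
        ∃ z, x < z ∧ z < y ∧ 0 < σ * S.combo q (S.diffCoeff q c) z := fun σ x y hx hxy hy h =>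
      exists_deriv_sign hxy (S.combo_sub_eq_integral q hq c hx hxy.le hy) h
    have hc' : ∀ i, S.diffCoeff q c i ≠ 0 → (a ≤ i ∧ p - q ≤ i) ∧ i < b + 1 ∧ i < S.n + 1 := by
      intro i hi
      have hnum : c i ≠ 0 ∨ (i ≠ 0 ∧ c (i - 1) ≠ 0) := by
        by_contra! hcon
        apply hi
        have : (if i = 0 then 0 else c (i - 1)) = 0 := by
          split_ifs with h0
          · rfl
          · exact hcon.2 h0
        simp [diffCoeff, this, hcon.1]
      have hden : S.ξ (i + q + 1) ≠ S.ξ i := by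
        intro h0
        apply hi
        simp [diffCoeff, h0]
      have h1 : p - q ≤ i := by
        by_contra! h0
        exact hden (by rw [S.left _ (by omega), S.left _ (by omega)])
      have h2 : i < S.n + 1 := by
        by_contra! h0
        exact hden (by rw [S.right _ (by omega), S.right _ (by omega)])
      rcases hnum with h0 | ⟨h0, h0'⟩
      · have := hc i h0
        omega
      · have := hc (i - 1) h0'
        omega
    have hleft : p - q ≤ a → S.combo (q + 1) c 0 = 0 := by
      intro h0
      refine Finset.sum_eq_zero fun i hi => ?_
      by_cases hci : c i = 0
      · rw [hci, zero_mul]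
      · have := hc i hci
        rw [S.bspline_at_zero (q + 1) i (by omega) (by simp at hi; omega) hq, if_neg (by omega),
          mul_zero]
    have hright : b ≤ S.n → S.combo (q + 1) c 1 = 0 := by
      intro h0
      refine Finset.sum_eq_zero fun i hi => ?_
      by_cases hci : c i = 0
      · rw [hci, zero_mul]
      · have := hc i hci
        rw [S.bspline_at_one (q + 1) i (by simp at hi; omega), if_neg (by omega), mul_zero]
    rcases le_or_gt (p - q) a with hl | hl
    · rcases le_or_gt b S.n with hr | hr
      · have := ih (S.diffCoeff q c) a (b + 1) (m + 2) σ (by omega) hl (by omega)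
          (fun i hi => by have := hc' i hi; omega)
          (AltFrom.deriv_both H (hleft hl) (hright hr) h)
        omega
      · have := ih (S.diffCoeff q c) a b (m + 1) σ (by omega) hl (by omega)
          (fun i hi => by have := hc' i hi; omega)
          (AltFrom.deriv H le_rfl (by rw [hleft hl, mul_zero]) h)
        omega
    · obtain ⟨y, h1, h2, h3, h4⟩ := h
      rcases le_or_gt b S.n with hr | hr
      · have := ih (S.diffCoeff q c) (a + 1) (b + 1) (m + 1) (-σ) (by omega) (by omega) (by omega)
          (fun i hi => by have := hc' i hi; omega)
          ((AltFrom.deriv_right H (hright hr) h1.le h2 (by linarith) h4).weaken h1.le)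
        omega
      · have := ih (S.diffCoeff q c) (a + 1) b m (-σ) (by omega) (by omega) (by omega)
          (fun i hi => by have := hc' i hi; omega)
          ((AltFrom.deriv H h1.le (by linarith) h4).weaken h1.le)
        omega

/-- A combination of `r` consecutive B-splines of full degree that is orthogonal to the polynomials
of degree below `r` vanishes: it would have too many sign changes. -/
lemma combo_eq_zero_of_orthogonal (hp : 1 ≤ p) (c : ℕ → ℝ) (a r : ℕ) (har : a + r ≤ S.n + 1)
    (hc : ∀ i, c i ≠ 0 → a ≤ i ∧ i < a + r)
    (h : ∀ j < r, ∫ t in Ioo (0 : ℝ) 1, S.combo p c t * t ^ j = 0) : ∀ i, c i = 0 := by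
  obtain ⟨q, rfl⟩ : ∃ q, p = q + 1 := ⟨p - 1, by omega⟩
  have hcont := S.continuousOn_combo q c
  set f : ℝ → ℝ := IccExtend zero_le_one ((Icc (0 : ℝ) 1).domRestrict (S.combo (q + 1) c)) with hf
  have hfc : Continuous f := (continuousOn_iff_continuous_domRestrict.1 hcont).Icc_extend'
  have hfe : ∀ x ∈ Icc (0 : ℝ) 1, f x = S.combo (q + 1) c x := fun x hx => by
    rw [hf, IccExtend_of_mem _ _ hx]; rfl
  by_cases hz : ∃ x ∈ Ioo (0 : ℝ) 1, f x ≠ 0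
  · obtain ⟨σ, hσ⟩ := exists_altFrom_of_orthogonal r f hfc (fun j hj => by
      rw [intervalIntegral.integral_of_le zero_le_one, integral_Ioc_eq_integral_Ioo]
      refine Eq.trans ?_ (h j hj)
      refine setIntegral_congr_fun measurableSet_Ioo fun t ht => ?_
      simp only [hfe t (Ioo_subset_Icc_self ht)]) hz
    have := S.altFrom_combo (q + 1) c a (a + r) (r + 1) σ le_rfl (by omega) har hc
      (hσ.congr (fun x hx => hfe x (Ioo_subset_Icc_self hx)) le_rfl)
    omega
  · push Not at hz
    have := S.bspline_indep (fun i => c i) fun x hx => by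
      rw [← hz x hx, hfe x (Ioo_subset_Icc_self hx), combo, Finset.sum_range]
    intro i
    by_contra hci
    exact hci (this ⟨i, by have := hc i hci; omega⟩)

end Knots

/-! ### Univariate moments -/

/-- The moment of `f` on the unit interval against the polynomial `Q`. -/
def mom (f : ℝ → ℝ) (Q : Polynomial ℝ) : ℝ := ∫ t in Ioo (0 : ℝ) 1, f t * Q.eval t

lemma integrableOn_of_continuousOn {f : ℝ → ℝ} (hf : ContinuousOn f (Icc 0 1)) :
    IntegrableOn f (Ioo 0 1) :=
  (hf.integrableOn_compact isCompact_Icc).mono_set Ioo_subset_Icc_self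

lemma integral_comp_orient (o : Bool) (f : ℝ → ℝ) :
    ∫ t in Ioo (0 : ℝ) 1, f (orient o t) = ∫ t in Ioo (0 : ℝ) 1, f t := by
  cases o with
  | true => rfl
  | false =>
    simp only [orient]
    rw [← integral_Ioc_eq_integral_Ioo, ← integral_Ioc_eq_integral_Ioo,
      ← intervalIntegral.integral_of_le zero_le_one, ← intervalIntegral.integral_of_le zero_le_one,
      intervalIntegral.integral_comp_sub_left]
    simp

/-- The polynomial in the reoriented coordinate. -/
def orientPoly (o : Bool) (Q : Polynomial ℝ) : Polynomial ℝ :=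
  if o then Q else Q.comp (1 - Polynomial.X)

lemma orientPoly_eval (o : Bool) (Q : Polynomial ℝ) (t : ℝ) :
    (orientPoly o Q).eval t = Q.eval (orient o t) := by
  cases o <;> simp [orientPoly, orient]

lemma natDegree_orientPoly {o : Bool} {Q : Polynomial ℝ} {r : ℕ} (h : Q.natDegree < r) :
    (orientPoly o Q).natDegree < r := by
  cases o with
  | true => exact h
  | false =>
    refine lt_of_le_of_lt ?_ h
    refine Polynomial.natDegree_comp_le.trans ?_
    have : (1 - Polynomial.X : Polynomial ℝ).natDegree ≤ 1 := by compute_degree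
    nlinarith

lemma orient_orient (o : Bool) (t : ℝ) : orient o (orient o t) = t := by
  cases o <;> simp [orient]

lemma orientIdx_not (o : Bool) {n : ℕ} (i : Fin (n + 1)) :
    orientIdx (!o) i = orientIdx o (Fin.rev i) := by
  cases o <;> simp [orientIdx]

lemma mom_eq_sum_of_natDegree_lt {f : ℝ → ℝ} (hf : ContinuousOn f (Icc 0 1)) {Q : Polynomial ℝ}
    {r : ℕ} (h : Q.natDegree < r) :
    mom f Q = ∑ j ∈ Finset.range r, Q.coeff j * ∫ t in Ioo (0 : ℝ) 1, f t * t ^ j := by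
  rw [mom]
  simp_rw [Polynomial.eval_eq_sum_range' h, ← integral_const_mul]
  rw [← integral_finsetSum]
  · refine integral_congr_ae (Filter.Eventually.of_forall fun t => ?_)
    simp only [Finset.mul_sum]
    exact Finset.sum_congr rfl fun j _ => by ring
  · intro j _
    exact (integrableOn_of_continuousOn (hf.mul (continuous_pow j).continuousOn)).const_mul _

namespace Knots

variable {p : ℕ} (S : Knots p)

lemma continuousOn_of_mem_V (hp : 1 ≤ p) {o : Bool} {f : ℝ → ℝ} (hf : f ∈ S.V o) :
    ContinuousOn f (Icc 0 1) := by
  induction hf using Submodule.span_induction with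
  | mem x h => obtain ⟨i, rfl⟩ := h; exact S.continuousOn_lam hp o i
  | zero => exact continuousOn_const
  | add x y _ _ hx hy => exact hx.add hy
  | smul a x _ hx => exact hx.const_smul a

/-- The moment against `Q`, as a linear functional on the spline space. -/
def momV (hp : 1 ≤ p) (o : Bool) (Q : Polynomial ℝ) : S.V o →ₗ[ℝ] ℝ where
  toFun f := mom f Q
  map_add' f g := by
    have h : ∀ f : S.V o, IntegrableOn (fun t => (f : ℝ → ℝ) t * Q.eval t) (Ioo 0 1) := fun f =>
      integrableOn_of_continuousOn
        ((S.continuousOn_of_mem_V hp f.2).mul Q.continuous.continuousOn)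
    simp only [mom, Submodule.coe_add, Pi.add_apply, add_mul]
    exact integral_add (h f) (h g)
  map_smul' a f := by
    simp only [mom, Submodule.coe_smul, Pi.smul_apply, smul_eq_mul, mul_assoc, RingHom.id_apply]
    exact integral_const_mul _ _

lemma basis_apply (o : Bool) (i : Fin (S.n + 1)) : (S.basis o i : ℝ → ℝ) = S.lam o i :=
  congrArg Subtype.val (Module.Basis.span_apply (S.linearIndependent_lam o) i)

lemma coe_eq_sum (o : Bool) (f : S.V o) (t : ℝ) :
    (f : ℝ → ℝ) t = ∑ i, (S.basis o).repr f i * S.lam o i t := by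
  conv_lhs => rw [← (S.basis o).sum_repr f]
  simp only [Submodule.coe_sum, Finset.sum_apply, Submodule.coe_smul, Pi.smul_apply, smul_eq_mul,
    basis_apply]

lemma repr_zero_eq (o : Bool) (f : S.V o) : (S.basis o).repr f 0 = (f : ℝ → ℝ) 0 := by
  rw [S.coe_eq_sum]
  simp [S.lam_at_zero]

lemma repr_last_eq (o : Bool) (f : S.V o) :
    (S.basis o).repr f (Fin.last _) = (f : ℝ → ℝ) 1 := by
  rw [S.coe_eq_sum]
  simp [S.lam_at_one]

lemma eq_of_eqOn_Ioo (o : Bool) (f g : S.V o)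
    (h : ∀ t ∈ Ioo (0 : ℝ) 1, (f : ℝ → ℝ) t = (g : ℝ → ℝ) t) : f = g := by
  have h1 := S.lam_indep o (fun i => (S.basis o).repr (f - g) i) fun t ht => by
    rw [← S.coe_eq_sum]
    simp [h t ht]
  exact sub_eq_zero.1 ((S.basis o).ext_elem fun i => by rw [h1 i]; simp)

lemma idx_val {m : ℕ} (hm : m ≤ S.n) : (S.idx m : ℕ) = m := by
  simp [idx, Fin.ofNat, Nat.mod_eq_of_lt (Nat.lt_succ_of_le hm)]

lemma mom_lam (o : Bool) (i : Fin (S.n + 1)) (Q : Polynomial ℝ) :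
    mom (S.lam o i) Q = mom (S.lam true (orientIdx o i)) (orientPoly o Q) := by
  rw [mom, mom, ← integral_comp_orient o]
  refine setIntegral_congr_fun measurableSet_Ioo fun t _ => ?_
  simp only [orientPoly_eval]
  congr 1
  simp only [lam, orient_orient]
  rfl

lemma orientIdx_orientIdx (o : Bool) {n : ℕ} (i : Fin (n + 1)) :
    orientIdx o (orientIdx o i) = i := by
  cases o <;> simp [orientIdx]

/-- Polynomials of degree at most `p` are splines on the unit interval. -/
lemma exists_spline_eq_polynomial (o : Bool) {Q : Polynomial ℝ} (hQ : Q.natDegree < p + 1) :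
    ∃ g : S.V o, ∀ t ∈ Ioo (0 : ℝ) 1, (g : ℝ → ℝ) t = Q.eval t := by
  have hmono : ∀ j : ℕ, ∃ c : Fin (S.n + 1) → ℝ, j ≤ p → ∀ x ∈ Ico (0 : ℝ) 1,
      ∑ i, c i * bspline S.ξ p i x = x ^ j := fun j => by
    by_cases hj : j ≤ p
    · obtain ⟨c, hc⟩ := S.exists_monomial_eq j hj
      exact ⟨c, fun _ => hc⟩
    · exact ⟨0, fun h => absurd h hj⟩
  choose c hc using hmono
  refine ⟨∑ i, (∑ j ∈ Finset.range (p + 1), (orientPoly o Q).coeff j * c j i) •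
    S.basis o (orientIdx o i), fun t ht => ?_⟩
  have ho : orient o t ∈ Ico (0 : ℝ) 1 := by
    cases o
    · exact ⟨by simp only [orient]; linarith [ht.2], by simp only [orient]; linarith [ht.1]⟩
    · exact ⟨ht.1.le, ht.2⟩
  rw [← orient_orient o t, ← orientPoly_eval,
    Polynomial.eval_eq_sum_range' (natDegree_orientPoly hQ), orient_orient]
  simp only [Submodule.coe_sum, Finset.sum_apply, Submodule.coe_smul, Pi.smul_apply, smul_eq_mul,
    basis_apply, lam, orientIdx_orientIdx, Finset.sum_mul]
  rw [Finset.sum_comm]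
  refine Finset.sum_congr rfl fun j hj => ?_
  rw [← hc j (by simpa [Nat.lt_succ_iff] using hj) _ ho, Finset.mul_sum]
  refine Finset.sum_congr rfl fun i _ => ?_
  ring

/-- The duality matrix is invertible: a vector in its kernel gives a combination of `r` consecutive
B-splines that is orthogonal to the polynomials of degree below `r`, hence zero. -/
lemma isUnit_momentMatrix (hp : 1 ≤ p) (o : Bool) {r : ℕ} (hr : r ≤ p + 1) :
    IsUnit (S.momentMatrix o r).det := by
  have hn := S.three_cells
  rw [isUnit_iff_ne_zero]
  intro hdet
  obtain ⟨c, hc0, hc⟩ := Matrix.exists_mulVec_eq_zero_iff.2 hdet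
  apply hc0
  -- the moments of the spline with the coefficient vector `c`
  set f : ℝ → ℝ := fun t => ∑ m : Fin r, c m * S.lam o (S.idx (m + 1)) t with hf
  have hfc : ContinuousOn f (Icc 0 1) := continuousOn_finsetSum _ fun m _ =>
    continuousOn_const.mul (S.continuousOn_lam hp o _)
  have hmom : ∀ j < r, ∫ t in Ioo (0 : ℝ) 1, f t * t ^ j = 0 := by
    intro j hj
    have h := congrFun hc ⟨j, hj⟩
    simp only [Matrix.mulVec, dotProduct, momentMatrix, Matrix.of_apply, Pi.zero_apply] at h
    refine Eq.trans ?_ h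
    simp_rw [← integral_mul_const]
    rw [← integral_finsetSum]
    · refine integral_congr_ae (Filter.Eventually.of_forall fun t => ?_)
      simp only [hf, Finset.sum_mul]
      exact Finset.sum_congr rfl fun m _ => by ring
    · intro m _
      exact (integrableOn_of_continuousOn ((S.continuousOn_lam hp o _).mul
        (continuous_pow j).continuousOn)).mul_const _
  have hmomQ : ∀ Q : Polynomial ℝ, Q.natDegree < r → mom f Q = 0 := by
    intro Q hQ
    rw [mom_eq_sum_of_natDegree_lt hfc hQ]
    refine Finset.sum_eq_zero fun j hj => ?_
    rw [hmom j (Finset.mem_range.1 hj), mul_zero]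
  -- the same spline in the original orientation
  set d : ℕ → ℝ := fun i => ∑ m : Fin r, if (orientIdx o (S.idx (m + 1)) : ℕ) = i then c m else 0
    with hd
  have hcombo : ∀ t, S.combo p d (orient o t) = f t := by
    intro t
    simp only [combo, hd, hf, Finset.sum_mul]
    rw [Finset.sum_comm]
    refine Finset.sum_congr rfl fun m _ => ?_
    rw [Finset.sum_eq_single (orientIdx o (S.idx (m + 1)) : ℕ)]
    · simp [lam]
    · intro i _ hi
      rw [if_neg (Ne.symm hi), zero_mul]
    · intro h
      simp only [Finset.mem_range] at h
      omega
  have hval : ∀ m : Fin r, (orientIdx o (S.idx (m + 1)) : ℕ)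
      = if o then (m : ℕ) + 1 else S.n - (m + 1) := by
    intro m
    have := S.idx_val (m := m + 1) (by omega)
    cases o
    · simp [orientIdx, Fin.val_rev, this]
    · simpa [orientIdx] using this
  have hd0 : ∀ i, d i = 0 := by
    refine S.combo_eq_zero_of_orthogonal hp d (if o then 1 else S.n - r) r
      (by split_ifs <;> omega) ?_ ?_
    · intro i hi
      obtain ⟨m, -, hm⟩ := Finset.exists_ne_zero_of_sum_ne_zero hi
      have hm' : (orientIdx o (S.idx (m + 1)) : ℕ) = i := by
        by_contra h0
        exact hm (if_neg h0)
      rw [hval m] at hm'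
      split_ifs at hm' ⊢ <;> omega
    · intro j hj
      rw [← integral_comp_orient o]
      have h := hmomQ (orientPoly o (Polynomial.X ^ j))
        (natDegree_orientPoly (by simpa using hj))
      refine Eq.trans ?_ h
      rw [mom]
      refine integral_congr_ae (Filter.Eventually.of_forall fun t => ?_)
      simp only [hcombo, orientPoly_eval]
      simp
  funext m
  have h := hd0 (orientIdx o (S.idx (m + 1)) : ℕ)
  simp only [hd] at h
  rw [Finset.sum_eq_single m] at h
  · simpa using h
  · intro m' _ hm'
    rw [if_neg]
    rw [hval, hval]
    have : (m' : ℕ) ≠ m := fun h => hm' (Fin.ext h)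
    split_ifs <;> omega
  · simp

/-- The correction coefficients reproduce the moments of the first basis function. -/
lemma sum_gamma_mom (hp : 1 ≤ p) (o : Bool) {r : ℕ} (hr : r ≤ p + 1) {Q : Polynomial ℝ}
    (hQ : Q.natDegree < r) :
    ∑ m : Fin r, S.gamma o r m * mom (S.lam o (S.idx (m + 1))) Q = mom (S.lam o 0) Q := by
  have hM : S.momentMatrix o r *ᵥ S.gamma o r = S.momentVector o r := by
    rw [gamma, Matrix.mulVec_mulVec, Matrix.mul_nonsing_inv _ (S.isUnit_momentMatrix hp o hr),
      Matrix.one_mulVec]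
  rw [mom_eq_sum_of_natDegree_lt (S.continuousOn_lam hp o 0) hQ]
  simp_rw [mom_eq_sum_of_natDegree_lt (S.continuousOn_lam hp o _) hQ, Finset.mul_sum]
  rw [Finset.sum_comm]
  refine Finset.sum_congr rfl fun j hj => ?_
  have h := congrFun hM ⟨j, Finset.mem_range.1 hj⟩
  simp only [Matrix.mulVec, dotProduct, momentMatrix, Matrix.of_apply, momentVector] at h
  rw [← h, Finset.mul_sum]
  refine Finset.sum_congr rfl fun m _ => ?_
  ring

lemma mom_muStart (hp : 1 ≤ p) (o : Bool) {r : ℕ} (hr : r ≤ p + 1) {Q : Polynomial ℝ}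
    (hQ : Q.natDegree < r) : mom (S.muStart o r) Q = mom (S.basis o 0) Q := by
  change S.momV hp o Q (S.muStart o r) = _
  rw [S.basis_apply, ← S.sum_gamma_mom hp o hr hQ, muStart, map_sum]
  refine Finset.sum_congr rfl fun m _ => ?_
  rw [map_smul, smul_eq_mul, ← S.basis_apply]
  rfl

lemma mom_lam_rev (o : Bool) (i : Fin (S.n + 1)) (Q : Polynomial ℝ) :
    mom (S.lam o (Fin.rev i)) Q = mom (S.lam (!o) i) (orientPoly false Q) := by
  rw [mom_lam, S.mom_lam (!o), orientIdx_not]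
  simp only [mom]
  refine integral_congr_ae (Filter.Eventually.of_forall fun t => ?_)
  simp only [orientPoly_eval]
  cases o <;> simp [orient]

lemma mom_muEnd (hp : 1 ≤ p) (o : Bool) {r : ℕ} (hr : r ≤ p + 1) {Q : Polynomial ℝ}
    (hQ : Q.natDegree < r) : mom (S.muEnd o r) Q = mom (S.basis o (Fin.last _)) Q := by
  change S.momV hp o Q (S.muEnd o r) = _
  rw [S.basis_apply, ← Fin.rev_zero, mom_lam_rev,
    ← S.sum_gamma_mom hp (!o) hr (natDegree_orientPoly hQ), muEnd, map_sum]
  refine Finset.sum_congr rfl fun m _ => ?_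
  rw [map_smul, smul_eq_mul, ← mom_lam_rev, ← S.basis_apply]
  rfl

lemma integrableOn_mul (hp : 1 ≤ p) (o : Bool) (i j : Fin (S.n + 1)) :
    IntegrableOn (fun t => S.lam o i t * S.lam o j t) (Ioo 0 1) :=
  integrableOn_of_continuousOn ((S.continuousOn_lam hp o i).mul (S.continuousOn_lam hp o j))

lemma eq_zero_of_integral_mul_self (hp : 1 ≤ p) (o : Bool) (f : S.V o)
    (h : ∫ t in Ioo (0 : ℝ) 1, (f : ℝ → ℝ) t * (f : ℝ → ℝ) t = 0) : f = 0 := by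
  have hfc := S.continuousOn_of_mem_V hp f.2
  rw [setIntegral_eq_zero_iff_of_nonneg_ae
    (Filter.Eventually.of_forall fun t => mul_self_nonneg _)
    (integrableOn_of_continuousOn (hfc.mul hfc))] at h
  have h0 : EqOn (fun t => (f : ℝ → ℝ) t * (f : ℝ → ℝ) t) 0 (Ioo 0 1) :=
    Measure.eqOn_open_of_ae_eq h isOpen_Ioo
      ((hfc.mul hfc).mono Ioo_subset_Icc_self) continuousOn_const
  exact S.eq_of_eqOn_Ioo o f 0 fun t ht => mul_self_eq_zero.1 (h0 ht)

lemma isUnit_gram (hp : 1 ≤ p) (o : Bool) : IsUnit (gram S o).det := by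
  rw [isUnit_iff_ne_zero]
  intro hdet
  obtain ⟨c, hc0, hc⟩ := Matrix.exists_mulVec_eq_zero_iff.2 hdet
  apply hc0
  set f : S.V o := ∑ i, c i • S.basis o i with hf
  have hft : ∀ t, (f : ℝ → ℝ) t = ∑ i, c i * S.lam o i t := fun t => by
    simp [hf, Finset.sum_apply, basis_apply]
  have h0 : f = 0 := by
    apply S.eq_zero_of_integral_mul_self hp
    have h : ∑ i, c i * (gram S o *ᵥ c) i = 0 := by simp [hc]
    refine Eq.trans ?_ h
    simp only [Matrix.mulVec, dotProduct, gram, Matrix.of_apply, Finset.mul_sum]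
    simp_rw [← integral_mul_const, ← integral_const_mul]
    have e : (fun t => (f : ℝ → ℝ) t * (f : ℝ → ℝ) t)
        = fun t => ∑ i, ∑ j, c i * (S.lam o i t * S.lam o j t * c j) := by
      funext t
      rw [hft, Finset.sum_mul_sum]
      exact Finset.sum_congr rfl fun i _ => Finset.sum_congr rfl fun j _ => by ring
    have hij : ∀ i j, IntegrableOn (fun t => c i * (S.lam o i t * S.lam o j t * c j)) (Ioo 0 1) :=
      fun i j => ((S.integrableOn_mul hp o i j).mul_const _).const_mul _
    rw [e, integral_finsetSum _ fun i _ => integrable_finsetSum _ fun j _ => hij i j]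
    exact Finset.sum_congr rfl fun i _ => integral_finsetSum _ fun j _ => hij i j
  have := (S.basis o).linearIndependent
  rw [Fintype.linearIndependent_iff] at this
  exact funext fun i => this c h0 i

end Knots

/-! ### The restriction operator -/

section Restriction

variable {p : ℕ} (A : Knots p) (oA : Bool) (B : Knots p) (oB : Bool) (h : A.V oA ≤ B.V oB) (r : ℕ)

/-- The `L²` projection is orthogonal. -/
lemma integral_l2Restrict (hp : 1 ≤ p) (φ : B.V oB) (g : A.V oA) :
    ∫ t in Ioo (0 : ℝ) 1, (l2Restrict A oA B oB φ : ℝ → ℝ) t * (g : ℝ → ℝ) t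
      = ∫ t in Ioo (0 : ℝ) 1, (φ : ℝ → ℝ) t * (g : ℝ → ℝ) t := by
  -- both sides are bilinear, so basis functions suffice
  have hI : ∀ {o o' : Bool} (S S' : Knots p) (f : S.V o) (g : S'.V o'),
      IntegrableOn (fun t => (f : ℝ → ℝ) t * (g : ℝ → ℝ) t) (Ioo 0 1) := fun S S' f g =>
    integrableOn_of_continuousOn ((S.continuousOn_of_mem_V hp f.2).mul
      (S'.continuousOn_of_mem_V hp g.2))
  let pair : ∀ (S : Knots p) (o : Bool), S.V o →ₗ[ℝ] A.V oA →ₗ[ℝ] ℝ := fun S o =>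
    LinearMap.mk₂ ℝ (fun f g => ∫ t in Ioo (0 : ℝ) 1, (f : ℝ → ℝ) t * (g : ℝ → ℝ) t)
      (fun f f' g => by
        simp only [Submodule.coe_add, Pi.add_apply, add_mul]
        exact integral_add (hI S A f g) (hI S A f' g))
      (fun c f g => by
        simp only [Submodule.coe_smul, Pi.smul_apply, smul_eq_mul, mul_assoc]
        exact integral_const_mul _ _)
      (fun f g g' => by
        simp only [Submodule.coe_add, Pi.add_apply, mul_add]
        exact integral_add (hI S A f g) (hI S A f g'))
      (fun c f g => by
        simp only [Submodule.coe_smul, Pi.smul_apply, smul_eq_mul]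
        rw [← integral_const_mul]
        exact integral_congr_ae (Filter.Eventually.of_forall fun t => by simp only; ring))
  suffices H : pair A oA ∘ₗ l2Restrict A oA B oB = pair B oB from
    congrArg (fun L => L g) (congrArg (fun L => L φ) H)
  refine (B.basis oB).ext fun i => (A.basis oA).ext fun j => ?_
  simp only [LinearMap.comp_apply, l2Restrict, Module.Basis.constr_basis]
  set w : Fin (A.n + 1) → ℝ := fun j => ∫ t in Ioo (0 : ℝ) 1, A.lam oA j t * B.lam oB i t with hw
  have hG : gram A oA *ᵥ ((gram A oA)⁻¹ *ᵥ w) = w := by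
    rw [Matrix.mulVec_mulVec, Matrix.mul_nonsing_inv _ (A.isUnit_gram hp oA), Matrix.one_mulVec]
  have h1 : pair B oB (B.basis oB i) (A.basis oA j) = w j := by
    simp only [pair, LinearMap.mk₂_apply, Knots.basis_apply, hw]
    exact integral_congr_ae (Filter.Eventually.of_forall fun t => mul_comm _ _)
  rw [h1, ← congrFun hG j, map_sum, LinearMap.sum_apply]
  simp only [Matrix.mulVec, dotProduct, map_smul, LinearMap.smul_apply, smul_eq_mul]
  refine Finset.sum_congr rfl fun a _ => ?_
  rw [mul_comm]
  congr 1
  simp only [pair, LinearMap.mk₂_apply, Knots.basis_apply, gram, Matrix.of_apply]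
  exact integral_congr_ae (Filter.Eventually.of_forall fun t => mul_comm _ _)

lemma l2Restrict_inclusion (hp : 1 ≤ p) (f : A.V oA) :
    l2Restrict A oA B oB (Submodule.inclusion h f) = f := by
  have hI : ∀ g g' : A.V oA, IntegrableOn (fun t => (g : ℝ → ℝ) t * (g' : ℝ → ℝ) t) (Ioo 0 1) :=
    fun g g' => integrableOn_of_continuousOn ((A.continuousOn_of_mem_V hp g.2).mul
      (A.continuousOn_of_mem_V hp g'.2))
  set g := l2Restrict A oA B oB (Submodule.inclusion h f) with hg
  refine sub_eq_zero.1 (A.eq_zero_of_integral_mul_self hp oA (g - f) ?_)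
  have h1 := integral_l2Restrict A oA B oB hp (Submodule.inclusion h f) (g - f)
  have h2 : ∀ t, ((g - f : A.V oA) : ℝ → ℝ) t * ((g - f : A.V oA) : ℝ → ℝ) t
      = (g : ℝ → ℝ) t * ((g - f : A.V oA) : ℝ → ℝ) t
        - (f : ℝ → ℝ) t * ((g - f : A.V oA) : ℝ → ℝ) t := fun t => by
    simp only [Submodule.coe_sub, Pi.sub_apply]; ring
  simp_rw [h2]
  rw [integral_sub (hI _ _) (hI _ _), h1]
  simp

lemma mom_l2Restrict (hp : 1 ≤ p) (φ : B.V oB) {Q : Polynomial ℝ} (hQ : Q.natDegree < p + 1) :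
    mom (l2Restrict A oA B oB φ) Q = mom φ Q := by
  obtain ⟨g, hg⟩ := A.exists_spline_eq_polynomial oA hQ
  have h1 := integral_l2Restrict A oA B oB hp φ g
  have h2 : ∀ f : ℝ → ℝ, mom f Q = ∫ t in Ioo (0 : ℝ) 1, f t * (g : ℝ → ℝ) t := fun f =>
    setIntegral_congr_fun measurableSet_Ioo fun t ht => by simp only [hg t ht]
  rw [h2, h2, h1]

lemma repr_muStart_zero (o : Bool) (hr : r ≤ p + 1) : (A.basis o).repr (A.muStart o r) 0 = 0 := by
  have hn := A.three_cells
  simp only [Knots.muStart, map_sum, map_smul, Module.Basis.repr_self, Finsupp.coe_finsetSum,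
    Finset.sum_apply, Finsupp.coe_smul, Pi.smul_apply, smul_eq_mul]
  refine Finset.sum_eq_zero fun m _ => ?_
  rw [Finsupp.single_eq_of_ne, mul_zero]
  rw [Ne, Fin.ext_iff, A.idx_val (by omega)]
  simp

lemma repr_muStart_last (o : Bool) (hr : r ≤ p + 1) :
    (A.basis o).repr (A.muStart o r) (Fin.last _) = 0 := by
  have hn := A.three_cells
  simp only [Knots.muStart, map_sum, map_smul, Module.Basis.repr_self, Finsupp.coe_finsetSum,
    Finset.sum_apply, Finsupp.coe_smul, Pi.smul_apply, smul_eq_mul]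
  refine Finset.sum_eq_zero fun m _ => ?_
  rw [Finsupp.single_eq_of_ne, mul_zero]
  rw [Ne, Fin.ext_iff, A.idx_val (by omega), Fin.val_last]
  omega

lemma repr_muEnd_zero (o : Bool) (hr : r ≤ p + 1) : (A.basis o).repr (A.muEnd o r) 0 = 0 := by
  have hn := A.three_cells
  simp only [Knots.muEnd, map_sum, map_smul, Module.Basis.repr_self, Finsupp.coe_finsetSum,
    Finset.sum_apply, Finsupp.coe_smul, Pi.smul_apply, smul_eq_mul]
  refine Finset.sum_eq_zero fun m _ => ?_
  rw [Finsupp.single_eq_of_ne, mul_zero]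
  rw [Ne, Fin.ext_iff, Fin.val_rev, A.idx_val (by omega), Fin.val_zero]
  omega

lemma repr_muEnd_last (o : Bool) (hr : r ≤ p + 1) :
    (A.basis o).repr (A.muEnd o r) (Fin.last _) = 0 := by
  have hn := A.three_cells
  simp only [Knots.muEnd, map_sum, map_smul, Module.Basis.repr_self, Finsupp.coe_finsetSum,
    Finset.sum_apply, Finsupp.coe_smul, Pi.smul_apply, smul_eq_mul]
  refine Finset.sum_eq_zero fun m _ => ?_
  rw [Finsupp.single_eq_of_ne, mul_zero]
  rw [Ne, Fin.ext_iff, Fin.val_rev, A.idx_val (by omega), Fin.val_last]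
  omega

lemma last_ne_zero' : (Fin.last A.n) ≠ 0 := by
  have hn := A.three_cells
  rw [Ne, Fin.ext_iff]
  simp
  omega

lemma repr_truncCoarse_zero (hr : r ≤ p + 1) (f : A.V oA) :
    (A.basis oA).repr (truncCoarse A oA r f) 0 = 0 := by
  have h1 : (0 : Fin (A.n + 1)) ≠ Fin.last A.n := (last_ne_zero' A).symm
  simp [truncCoarse, repr_muStart_zero A r oA hr, repr_muEnd_zero A r oA hr, h1,
    Finsupp.single_eq_of_ne]

lemma repr_truncCoarse_last (hr : r ≤ p + 1) (f : A.V oA) :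
    (A.basis oA).repr (truncCoarse A oA r f) (Fin.last _) = 0 := by
  have h1 : Fin.last A.n ≠ (0 : Fin (A.n + 1)) := last_ne_zero' A
  simp [truncCoarse, repr_muStart_last A r oA hr, repr_muEnd_last A r oA hr, h1,
    Finsupp.single_eq_of_ne]

lemma mom_truncCoarse (hp : 1 ≤ p) (hr : r ≤ p + 1) (f : A.V oA) {Q : Polynomial ℝ}
    (hQ : Q.natDegree < r) : mom (truncCoarse A oA r f) Q = mom f Q := by
  have h0 : A.momV hp oA Q (A.muStart oA r) = A.momV hp oA Q (A.basis oA 0) :=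
    A.mom_muStart hp oA hr hQ
  have h1 : A.momV hp oA Q (A.muEnd oA r) = A.momV hp oA Q (A.basis oA (Fin.last _)) :=
    A.mom_muEnd hp oA hr hQ
  change A.momV hp oA Q (truncCoarse A oA r f) = A.momV hp oA Q f
  simp only [truncCoarse, LinearMap.add_apply, LinearMap.sub_apply, LinearMap.id_apply,
    LinearMap.smulRight_apply, map_add, map_sub, map_smul, h0, h1]
  ring

/-- The restriction operator keeps the values at the end points. -/
lemma repr_restrictOp_zero (hr : r ≤ p + 1) (φ : B.V oB) :
    (A.basis oA).repr (restrictOp A oA B oB h r φ) 0 = (B.basis oB).repr φ 0 := by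
  have h1 : (0 : Fin (A.n + 1)) ≠ Fin.last A.n := (last_ne_zero' A).symm
  simp [restrictOp, repr_truncCoarse_zero A oA r hr, h1, Finsupp.single_eq_of_ne]

lemma repr_restrictOp_last (hr : r ≤ p + 1) (φ : B.V oB) :
    (A.basis oA).repr (restrictOp A oA B oB h r φ) (Fin.last _)
      = (B.basis oB).repr φ (Fin.last _) := by
  have h1 : Fin.last A.n ≠ (0 : Fin (A.n + 1)) := last_ne_zero' A
  simp [restrictOp, repr_truncCoarse_last A oA r hr, h1, Finsupp.single_eq_of_ne]

/-- The restriction operator preserves moments of order `r`. -/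
lemma mom_restrictOp (hp : 1 ≤ p) (hr : r ≤ p + 1) (φ : B.V oB) {Q : Polynomial ℝ}
    (hQ : Q.natDegree < r) : mom (restrictOp A oA B oB h r φ) Q = mom φ Q := by
  have h1 : ∀ f, A.momV hp oA Q (truncCoarse A oA r f) = A.momV hp oA Q f :=
    fun f => mom_truncCoarse A oA r hp hr f hQ
  have h2 : ∀ f, A.momV hp oA Q (l2Restrict A oA B oB f) = B.momV hp oB Q f :=
    fun f => mom_l2Restrict A oA B oB hp f (by omega)
  have h3 : ∀ f, B.momV hp oB Q (Submodule.inclusion h f) = A.momV hp oA Q f := fun f => rfl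
  change A.momV hp oA Q (restrictOp A oA B oB h r φ) = B.momV hp oB Q φ
  simp only [restrictOp, truncFine, LinearMap.add_apply, LinearMap.sub_apply, LinearMap.id_apply,
    LinearMap.comp_apply, LinearMap.smulRight_apply, map_add, map_sub, map_smul, h1, h2, h3]
  ring

/-- The restriction operator is a left inverse of the inclusion. -/
lemma restrictOp_inclusion (hp : 1 ≤ p) (f : A.V oA) :
    restrictOp A oA B oB h r (Submodule.inclusion h f) = f := by
  have h0 : (B.basis oB).repr (Submodule.inclusion h f) 0 = (A.basis oA).repr f 0 := by
    rw [Knots.repr_zero_eq, Knots.repr_zero_eq]; rfl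
  have h1 : (B.basis oB).repr (Submodule.inclusion h f) (Fin.last _)
      = (A.basis oA).repr f (Fin.last _) := by
    rw [Knots.repr_last_eq, Knots.repr_last_eq]; rfl
  have h2 : (0 : Fin (A.n + 1)) ≠ Fin.last A.n := (last_ne_zero' A).symm
  simp only [restrictOp, truncFine, LinearMap.add_apply, LinearMap.sub_apply, LinearMap.id_apply,
    LinearMap.comp_apply, LinearMap.smulRight_apply, Module.Basis.coord_apply, h0, h1, map_sub,
    map_smul, l2Restrict_inclusion A oA B oB h hp]
  simp only [truncCoarse, LinearMap.add_apply, LinearMap.sub_apply, LinearMap.id_apply,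
    LinearMap.smulRight_apply, Module.Basis.coord_apply, Module.Basis.repr_self,
    Finsupp.single_eq_same, Finsupp.single_eq_of_ne h2, Finsupp.single_eq_of_ne h2.symm,
    zero_smul, one_smul]
  module

end Restriction

/-! ### Commuting unipotent operators -/

/-- If the operators `P e` differ from the identity on `W` by increments that the other operators
leave fixed, then their product in any order adds all the increments. -/
lemma list_prod_apply_eq_add_sum {M ι : Type*} [AddCommGroup M] [Module ℝ M]
    (P : ι → Module.End ℝ M) (W : Submodule ℝ M) (l : List ι) (hl : l.Nodup)
    (hfix : ∀ e e', e ≠ e' → ∀ φ ∈ W, P e (P e' φ - φ) = P e' φ - φ) {φ : M} (hφ : φ ∈ W) :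
    (l.map P).prod φ = φ + (l.map fun e => P e φ - φ).sum := by
  induction l with
  | nil => simp
  | cons e l ih =>
    rw [List.nodup_cons] at hl
    rw [List.map_cons, List.prod_cons, Module.End.mul_apply, ih hl.2, map_add, List.map_cons,
      List.sum_cons]
    have : P e (l.map fun e => P e φ - φ).sum = (l.map fun e => P e φ - φ).sum := by
      rw [map_list_sum, List.map_map]
      congr 1
      refine List.map_congr_left fun e' he' => ?_
      exact hfix e e' (fun h => hl.1 (h ▸ he')) φ hφ
    rw [this]
    abel

/-! ### Corners and moments -/

lemma orientIdx_zero_inj {n : ℕ} (hn : 0 < n) {o o' : Bool}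
    (h : orientIdx o (0 : Fin (n + 1)) = orientIdx o' 0) : o = o' := by
  cases o <;> cases o' <;> simp [orientIdx, Fin.ext_iff] at h ⊢ <;> omega

lemma Corner.index_zero_inj {n : ℕ} (hn : 0 < n) {c d : Corner}
    (h : c.index ((0 : Fin (n + 1)), (0 : Fin (n + 1))) = d.index (0, 0)) : c = d := by
  simp only [Corner.index, Prod.mk.injEq] at h
  exact Prod.ext (orientIdx_zero_inj hn h.1) (orientIdx_zero_inj hn h.2)

namespace Multipatch

variable {p K : ℕ} (D : Multipatch p K)

lemma n_pos (k : Fin K) : 0 < D.n k := by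
  have := (D.knots k).three_cells
  simp only [n]
  omega

lemma coe_basis (a : D.Idx) : (D.basis a : Plane → ℝ) = D.LamFun a := by
  rw [basis, Module.Basis.mk_apply]
  rfl

/-- The index of the basis function at a corner of a patch. -/
abbrev cornerIdx (b : Fin K × Corner) : D.Idx := ⟨b.1, b.2.index (0, 0)⟩

lemma cornerIdx_injective : Function.Injective D.cornerIdx := by
  rintro ⟨k, c⟩ ⟨l, d⟩ h
  simp only [cornerIdx, Sigma.mk.injEq] at h
  obtain ⟨rfl, h⟩ := h
  rw [Corner.index_zero_inj (D.n_pos k) (eq_of_heq h)]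

lemma mem_cornersAt {v : Plane} {b : Fin K × Corner} :
    b ∈ D.cornersAt v ↔ D.F b.1 b.2.pt = v := by
  simp [cornersAt]

/-- The splines whose corner coefficients at a common vertex agree. -/
def vertexConforming : Submodule ℝ D.Vpw where
  carrier := {φ | ∀ b b' : Fin K × Corner, D.F b.1 b.2.pt = D.F b'.1 b'.2.pt →
    D.basis.repr φ (D.cornerIdx b) = D.basis.repr φ (D.cornerIdx b')}
  zero_mem' := by simp
  add_mem' := by
    intro φ χ h1 h2 b b' hb
    simp only [map_add, Finsupp.add_apply, h1 b b' hb, h2 b b' hb]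
  smul_mem' := by
    intro c φ h1 b b' hb
    simp only [map_smul, Finsupp.smul_apply, h1 b b' hb]

/-- The moment on the patch `k` against `P ⊗ Q`, in terms of the coefficients. -/
def moment (k : Fin K) (P Q : Polynomial ℝ) : D.Vpw →ₗ[ℝ] ℝ :=
  D.basis.constr ℝ fun a =>
    if a.1 = k then mom ((D.knots a.1).lam true a.2.1) P * mom ((D.knots a.1).lam true a.2.2) Q
    else 0

lemma moment_basis (k : Fin K) (P Q : Polynomial ℝ) (a : D.Idx) :
    D.moment k P Q (D.basis a) = if a.1 = k then
      mom ((D.knots a.1).lam true a.2.1) P * mom ((D.knots a.1).lam true a.2.2) Q else 0 := by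
  rw [moment, Module.Basis.constr_basis]

lemma apply_F_eq_sum (v : D.Vpw) (k : Fin K) {x : ℝ × ℝ} (hx : x ∈ openSquare) :
    (v : Plane → ℝ) (D.F k x) = ∑ i, D.basis.repr v ⟨k, i⟩ * D.logicalFun k i x := by
  rw [← D.sum_LamFun (fun a => D.basis.repr v a) k x hx]
  conv_lhs => rw [← D.basis.sum_repr v]
  simp only [Submodule.coe_sum, Finset.sum_apply, Submodule.coe_smul, Pi.smul_apply, smul_eq_mul,
    coe_basis]

lemma measurableSet_openSquare : MeasurableSet openSquare :=
  measurableSet_Ioo.prod measurableSet_Ioo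

lemma continuousOn_logicalFun (hp : 1 ≤ p) (k : Fin K) (i) :
    ContinuousOn (D.logicalFun k i) closedSquare := by
  refine ContinuousOn.mul ?_ ?_
  · exact ((D.knots k).continuousOn_lam hp true i.1).comp continuousOn_fst fun x hx => hx.1
  · exact ((D.knots k).continuousOn_lam hp true i.2).comp continuousOn_snd fun x hx => hx.2

lemma isCompact_closedSquare : IsCompact closedSquare := isCompact_Icc.prod isCompact_Icc

lemma integral_eq_moment (hp : 1 ≤ p) (v : D.Vpw) (k : Fin K) (P Q : Polynomial ℝ) :
    ∫ x in openSquare, (v : Plane → ℝ) (D.F k x) * (P.eval x.1 * Q.eval x.2)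
      = D.moment k P Q v := by
  have h1 : ∫ x in openSquare, (v : Plane → ℝ) (D.F k x) * (P.eval x.1 * Q.eval x.2)
      = ∫ x in openSquare, ∑ i, D.basis.repr v ⟨k, i⟩ * (((D.knots k).lam true i.1 x.1 * P.eval x.1)
        * ((D.knots k).lam true i.2 x.2 * Q.eval x.2)) := by
    refine setIntegral_congr_fun measurableSet_openSquare fun x hx => ?_
    rw [D.apply_F_eq_sum v k hx, Finset.sum_mul]
    refine Finset.sum_congr rfl fun i _ => ?_
    simp only [logicalFun]
    ring
  rw [h1, integral_finsetSum]
  · have h2 : D.moment k P Q v = ∑ a, D.basis.repr v a * D.moment k P Q (D.basis a) := by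
      conv_lhs => rw [← D.basis.sum_repr v]
      simp only [map_sum, map_smul, smul_eq_mul]
    rw [h2, Fintype.sum_sigma, Finset.sum_eq_single k]
    · refine Finset.sum_congr rfl fun i _ => ?_
      rw [integral_const_mul, moment_basis, if_pos rfl]
      congr 1
      exact setIntegral_prod_mul (fun t => (D.knots k).lam true i.1 t * P.eval t)
        (fun t => (D.knots k).lam true i.2 t * Q.eval t) (Ioo 0 1) (Ioo 0 1)
    · intro l _ hl
      exact Finset.sum_eq_zero fun i _ => by rw [moment_basis, if_neg hl, mul_zero]
    · simp
  · intro i _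
    have : ContinuousOn (fun x : ℝ × ℝ => D.basis.repr v ⟨k, i⟩ *
        (((D.knots k).lam true i.1 x.1 * P.eval x.1)
        * ((D.knots k).lam true i.2 x.2 * Q.eval x.2))) closedSquare := by
      refine continuousOn_const.mul (ContinuousOn.mul (ContinuousOn.mul ?_ ?_)
        (ContinuousOn.mul ?_ ?_))
      · exact ((D.knots k).continuousOn_lam hp true i.1).comp continuousOn_fst fun x hx => hx.1
      · exact (P.continuous.comp continuous_fst).continuousOn
      · exact ((D.knots k).continuousOn_lam hp true i.2).comp continuousOn_snd fun x hx => hx.2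
      · exact (Q.continuous.comp continuous_snd).continuousOn
    exact (this.integrableOn_compact isCompact_closedSquare).mono_set openSquare_subset

/-- It suffices to test with tensor-product polynomials, through the coefficient functionals. -/
lemma momentPreserving_of_moment (hp : 1 ≤ p) (r : ℕ) (T : Module.End ℝ D.Vpw)
    (h : ∀ v k, ∀ P Q : Polynomial ℝ, P.natDegree < r → Q.natDegree < r →
      D.moment k P Q (T v) = D.moment k P Q v) : D.MomentPreserving r T := by
  intro v k q hq
  have hint : ∀ w : D.Vpw, ∀ q : ℝ × ℝ → ℝ, ContinuousOn q closedSquare →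
      IntegrableOn (fun x => (w : Plane → ℝ) (D.F k x) * q x) openSquare := by
    intro w q hqc
    have h1 : ContinuousOn (fun x => (∑ i, D.basis.repr w ⟨k, i⟩ * D.logicalFun k i x) * q x)
        closedSquare := (continuousOn_finsetSum _ fun i _ =>
          continuousOn_const.mul (D.continuousOn_logicalFun hp k i)).mul hqc
    refine ((h1.integrableOn_compact isCompact_closedSquare).mono_set openSquare_subset).congr_fun
      (fun x hx => ?_) measurableSet_openSquare
    simp only [D.apply_F_eq_sum w k hx]
  suffices H : ContinuousOn q closedSquare ∧ ∫ x in openSquare, (T v : Plane → ℝ) (D.F k x) * q x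
      = ∫ x in openSquare, (v : Plane → ℝ) (D.F k x) * q x from H.2
  induction hq using Submodule.span_induction with
  | mem q hq =>
    obtain ⟨a, b, ha, hb, rfl⟩ := hq
    refine ⟨by fun_prop, ?_⟩
    have := h v k (Polynomial.X ^ a) (Polynomial.X ^ b) (by simpa using ha) (by simpa using hb)
    rw [← D.integral_eq_moment hp, ← D.integral_eq_moment hp] at this
    simpa using this
  | zero => exact ⟨continuousOn_const, by simp⟩
  | add q q' _ _ h1 h2 =>
    refine ⟨h1.1.add h2.1, ?_⟩
    simp only [Pi.add_apply, mul_add]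
    rw [integral_add (hint _ _ h1.1) (hint _ _ h2.1), integral_add (hint _ _ h1.1)
      (hint _ _ h2.1), h1.2, h2.2]
  | smul c q _ h1 =>
    refine ⟨h1.1.const_smul c, ?_⟩
    simp only [Pi.smul_apply, smul_eq_mul, mul_left_comm _ c]
    rw [integral_const_mul, integral_const_mul, h1.2]

lemma mom_lam_orientIdx (S : Knots p) (o : Bool) (i : Fin (S.n + 1)) (Q : Polynomial ℝ) :
    mom (S.lam true (orientIdx o i)) Q = mom (S.lam o i) (orientPoly o Q) := by
  rw [mom, mom, ← integral_comp_orient o]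
  refine setIntegral_congr_fun measurableSet_Ioo fun t _ => ?_
  simp only [orientPoly_eval]
  rfl

/-! ### Vertex operators -/

/-- The increment `P_v Λ_b - Λ_b` for a corner `b` at the vertex `v`. -/
def vertexIncrement (r : ℕ) (v : Plane) (b : Fin K × Corner) : D.Vpw :=
  D.vertexAverage v + (D.vertexCorrection r b.1 b.2
    - ((D.cornersAt v).card : ℝ)⁻¹ • ∑ b' ∈ D.cornersAt v, D.vertexCorrection r b'.1 b'.2)
    - D.basis (D.cornerIdx b)

lemma vertexOp_apply (r : ℕ) (v : Plane) (φ : D.Vpw) :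
    D.vertexOp r v φ = φ + ∑ b ∈ D.cornersAt v,
      D.basis.repr φ (D.cornerIdx b) • D.vertexIncrement r v b := by
  suffices H : D.vertexOp r v = LinearMap.id + ∑ b ∈ D.cornersAt v,
      (D.basis.coord (D.cornerIdx b)).smulRight (D.vertexIncrement r v b) by
    rw [H]
    simp [LinearMap.sum_apply]
  refine D.basis.ext fun a => ?_
  rw [vertexOp, Module.Basis.constr_basis]
  simp only [LinearMap.add_apply, LinearMap.id_apply, LinearMap.sum_apply,
    LinearMap.smulRight_apply, Module.Basis.coord_apply, Module.Basis.repr_self]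
  split_ifs with h
  · obtain ⟨h1, h2⟩ := h.choose_spec
    obtain ⟨k, j⟩ := a
    simp only at h h1 h2 ⊢
    generalize h.choose = c at h1 h2 ⊢
    change j = Corner.index (n := D.n k) c (0, 0) at h2
    subst h2
    have hs : ∑ b ∈ D.cornersAt v, (Finsupp.single (D.cornerIdx (k, c)) (1 : ℝ)) (D.cornerIdx b) •
        D.vertexIncrement r v b = D.vertexIncrement r v (k, c) := by
      rw [Finset.sum_eq_single (k, c)]
      · rw [Finsupp.single_eq_same, one_smul]
      · intro b _ hb
        rw [Finsupp.single_eq_of_ne, zero_smul]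
        exact fun h => hb (D.cornerIdx_injective h)
      · intro h
        exact absurd (D.mem_cornersAt.2 h1) h
    refine Eq.trans ?_ (congrArg (D.basis (D.cornerIdx (k, c)) + ·) hs.symm)
    simp only [vertexIncrement]
    abel
  · rw [Finset.sum_eq_zero, add_zero]
    intro b hb
    rw [Finsupp.single_eq_of_ne, zero_smul]
    rintro rfl
    exact h ⟨b.2, D.mem_cornersAt.1 hb, rfl⟩

lemma repr_vertexCorrection {r : ℕ} (hr : r ≤ p + 1) (k : Fin K) (c : Corner)
    (b : Fin K × Corner) : D.basis.repr (D.vertexCorrection r k c) (D.cornerIdx b) = 0 := by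
  simp only [vertexCorrection, map_sum, map_smul, Module.Basis.repr_self, Finsupp.coe_finsetSum,
    Finset.sum_apply, Finsupp.coe_smul, Pi.smul_apply, smul_eq_mul]
  refine Finset.sum_eq_zero fun m₁ _ => Finset.sum_eq_zero fun m₂ _ => ?_
  rw [Finsupp.single_eq_of_ne, mul_zero]
  obtain ⟨l, d⟩ := b
  intro h
  simp only [cornerIdx, Sigma.mk.injEq] at h
  obtain ⟨rfl, h⟩ := h
  have h1 := congrArg (fun j => (j.1 : ℕ)) (eq_of_heq h)
  have hn := (D.knots l).three_cells
  have h2 := (D.knots l).idx_val (m := m₁ + 1) (by omega)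
  simp only [Corner.index] at h1
  rcases c with ⟨c1, c2⟩
  rcases d with ⟨d1, d2⟩
  cases c1 <;> cases d1 <;>
    simp only [orientIdx, Fin.val_rev, Fin.val_zero, h2, n] at h1 <;> omega

open Classical in
lemma repr_vertexIncrement {r : ℕ} (hr : r ≤ p + 1) (v : Plane) (b b' : Fin K × Corner) :
    D.basis.repr (D.vertexIncrement r v b) (D.cornerIdx b')
      = (if b' ∈ D.cornersAt v then ((D.cornersAt v).card : ℝ)⁻¹ else 0)
        - if b = b' then 1 else 0 := by
  have h1 : ∀ b : Fin K × Corner, (Finsupp.single (D.cornerIdx b) (1 : ℝ)) (D.cornerIdx b')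
      = if b = b' then 1 else 0 := by
    intro b
    rw [Finsupp.single_apply]
    simp [D.cornerIdx_injective.eq_iff]
  have h2 : ∀ b : Fin K × Corner, D.basis.repr (D.basis (D.cornerIdx b)) (D.cornerIdx b')
      = if b = b' then 1 else 0 := by
    intro b
    rw [Module.Basis.repr_self, h1]
  simp only [vertexIncrement, vertexAverage, map_add, map_sub, map_smul, map_sum,
    Finsupp.add_apply, Finsupp.sub_apply, Finsupp.smul_apply, Finsupp.coe_finsetSum,
    Finset.sum_apply, D.repr_vertexCorrection hr, Finset.sum_const_zero, smul_zero, sub_zero,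
    add_zero]
  rw [h2]
  congr 1
  rw [Finset.sum_congr rfl fun b _ => h2 b, Finset.sum_ite_eq']
  split_ifs <;> simp

/-- `P_v` leaves a spline fixed whose corner coefficients at `v` vanish. -/
lemma vertexOp_eq_self (r : ℕ) (v : Plane) (φ : D.Vpw)
    (h : ∀ b ∈ D.cornersAt v, D.basis.repr φ (D.cornerIdx b) = 0) : D.vertexOp r v φ = φ := by
  rw [vertexOp_apply, Finset.sum_eq_zero, add_zero]
  intro b hb
  rw [h b hb, zero_smul]

lemma vertexOp_sub (r : ℕ) (v : Plane) (φ : D.Vpw) : D.vertexOp r v φ - φ =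
    ∑ b ∈ D.cornersAt v, D.basis.repr φ (D.cornerIdx b) • D.vertexIncrement r v b := by
  rw [vertexOp_apply, add_sub_cancel_left]

lemma vertexOp_fix {r : ℕ} (hr : r ≤ p + 1) {v v' : Plane} (hv : v ≠ v') (φ : D.Vpw) :
    D.vertexOp r v (D.vertexOp r v' φ - φ) = D.vertexOp r v' φ - φ := by
  refine D.vertexOp_eq_self r v _ fun b hb => ?_
  rw [vertexOp_sub]
  simp only [map_sum, map_smul, Finsupp.coe_finsetSum, Finset.sum_apply, Finsupp.smul_apply]
  refine Finset.sum_eq_zero fun b' hb' => ?_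
  rw [mem_cornersAt] at hb hb'
  rw [D.repr_vertexIncrement hr, if_neg, if_neg]
  · simp
  · rintro rfl
    exact hv (hb.symm.trans hb')
  · rw [mem_cornersAt]
    exact fun h => hv (hb.symm.trans h)

lemma vertexList_apply {r : ℕ} (hr : r ≤ p + 1) {lv : List Plane}
    (hlv : lv.Perm D.vertices.toList) (φ : D.Vpw) :
    (lv.map (D.vertexOp r)).prod φ = φ + ∑ v ∈ D.vertices, (D.vertexOp r v φ - φ) := by
  rw [list_prod_apply_eq_add_sum (D.vertexOp r) ⊤ lv (hlv.nodup_iff.2 D.vertices.nodup_toList)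
    (fun v v' hv φ _ => D.vertexOp_fix hr hv φ) (φ := φ) trivial,
    (hlv.map _).sum_eq, Finset.sum_map_toList]

lemma mem_vertices (b : Fin K × Corner) : D.F b.1 b.2.pt ∈ D.vertices := by
  simp only [vertices, Finset.mem_image, Finset.mem_univ, true_and]
  exact ⟨b, rfl⟩

/-- After the vertex operators, the coefficient at a corner is the average at its vertex. -/
lemma repr_vertexProd {r : ℕ} (hr : r ≤ p + 1) (φ : D.Vpw) (b : Fin K × Corner) :
    D.basis.repr (D.vertexProd r φ) (D.cornerIdx b) =
      ∑ b' ∈ D.cornersAt (D.F b.1 b.2.pt), D.basis.repr φ (D.cornerIdx b') *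
        ((D.cornersAt (D.F b.1 b.2.pt)).card : ℝ)⁻¹ := by
  classical
  rw [vertexProd, D.vertexList_apply hr (List.Perm.refl _), map_add, map_sum, Finsupp.add_apply,
    Finsupp.coe_finsetSum, Finset.sum_apply, Finset.sum_eq_single (D.F b.1 b.2.pt)]
  · rw [vertexOp_sub]
    simp only [map_sum, map_smul, Finsupp.coe_finsetSum, Finset.sum_apply, Finsupp.smul_apply,
      smul_eq_mul, D.repr_vertexIncrement hr, mul_sub]
    have hb : b ∈ D.cornersAt (D.F b.1 b.2.pt) := D.mem_cornersAt.2 rfl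
    rw [if_pos hb, Finset.sum_sub_distrib]
    simp [hb]
  · intro v _ hv
    rw [vertexOp_sub]
    simp only [map_sum, map_smul, Finsupp.coe_finsetSum, Finset.sum_apply, Finsupp.smul_apply]
    refine Finset.sum_eq_zero fun b' hb' => ?_
    rw [mem_cornersAt] at hb'
    rw [D.repr_vertexIncrement hr, if_neg, if_neg]
    · simp
    · rintro rfl
      exact hv hb'.symm
    · rw [mem_cornersAt]
      exact fun h => hv h.symm
  · intro h
    exact absurd (D.mem_vertices b) h

lemma vertexProd_mem {r : ℕ} (hr : r ≤ p + 1) (φ : D.Vpw) :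
    D.vertexProd r φ ∈ D.vertexConforming := by
  intro b b' hb
  rw [D.repr_vertexProd hr, D.repr_vertexProd hr, hb]

lemma vertexOp_of_vertexConforming (r : ℕ) (v : Plane) {φ : D.Vpw}
    (hφ : φ ∈ D.vertexConforming) : D.vertexOp r v φ = φ := by
  rw [vertexOp_apply, add_eq_left]
  rcases (D.cornersAt v).eq_empty_or_nonempty with h | ⟨b₀, hb₀⟩
  · rw [h, Finset.sum_empty]
  have hc : ∀ b ∈ D.cornersAt v,
      D.basis.repr φ (D.cornerIdx b) = D.basis.repr φ (D.cornerIdx b₀) := fun b hb =>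
    hφ b b₀ ((D.mem_cornersAt.1 hb).trans (D.mem_cornersAt.1 hb₀).symm)
  rw [Finset.sum_congr rfl fun b hb => by rw [hc b hb], ← Finset.smul_sum]
  have hcard : ((D.cornersAt v).card : ℝ) ≠ 0 := by
    exact_mod_cast (Finset.card_pos.2 ⟨b₀, hb₀⟩).ne'
  rw [smul_eq_zero]
  right
  simp only [vertexIncrement, vertexAverage, Finset.sum_sub_distrib, Finset.sum_add_distrib,
    Finset.sum_const, ← Nat.cast_smul_eq_nsmul ℝ, smul_smul, mul_inv_cancel₀ hcard, one_smul]
  abel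

lemma vertexProd_of_vertexConforming {r : ℕ} (hr : r ≤ p + 1) {φ : D.Vpw}
    (hφ : φ ∈ D.vertexConforming) : D.vertexProd r φ = φ := by
  rw [vertexProd, D.vertexList_apply hr (List.Perm.refl _), Finset.sum_eq_zero, add_zero]
  intro v _
  rw [D.vertexOp_of_vertexConforming r v hφ, sub_self]

lemma moment_vertexCorrection (hp : 1 ≤ p) {r : ℕ} (hr : r ≤ p + 1) (k : Fin K)
    {P Q : Polynomial ℝ} (hP : P.natDegree < r) (hQ : Q.natDegree < r) (b : Fin K × Corner) :
    D.moment k P Q (D.vertexCorrection r b.1 b.2) = D.moment k P Q (D.basis (D.cornerIdx b)) := by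
  simp only [vertexCorrection, map_sum, map_smul, moment_basis, smul_eq_mul]
  split_ifs with h
  · simp only [Corner.index, mom_lam_orientIdx]
    rw [← (D.knots b.1).sum_gamma_mom hp b.2.1 hr (natDegree_orientPoly hP),
      ← (D.knots b.1).sum_gamma_mom hp b.2.2 hr (natDegree_orientPoly hQ), Finset.sum_mul_sum]
    exact Finset.sum_congr rfl fun m₁ _ => Finset.sum_congr rfl fun m₂ _ => by ring
  · simp

lemma moment_vertexProd (hp : 1 ≤ p) {r : ℕ} (hr : r ≤ p + 1) (k : Fin K)
    {P Q : Polynomial ℝ} (hP : P.natDegree < r) (hQ : Q.natDegree < r) (φ : D.Vpw) :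
    D.moment k P Q (D.vertexProd r φ) = D.moment k P Q φ := by
  rw [vertexProd, D.vertexList_apply hr (List.Perm.refl _), map_add, map_sum, add_eq_left]
  refine Finset.sum_eq_zero fun v _ => ?_
  rw [vertexOp_sub, map_sum]
  refine Finset.sum_eq_zero fun b _ => ?_
  rw [map_smul, vertexIncrement, vertexAverage]
  simp only [map_add, map_sub, map_smul, map_sum,
    D.moment_vertexCorrection hp hr k hP hQ]
  simp

end Multipatch

/-! ### Rows of coefficients along a side -/

namespace Frame

lemma index_localIndex {n : ℕ} (s : Frame) (j : Fin (n + 1) × Fin (n + 1)) :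
    s.index (s.localIndex j) = j := by
  rcases s with ⟨_ | _, a, b⟩ <;>
    simp [index, localIndex, Knots.orientIdx_orientIdx]

lemma localIndex_index {n : ℕ} (s : Frame) (j : Fin (n + 1) × Fin (n + 1)) :
    s.localIndex (s.index j) = j := by
  rcases s with ⟨_ | _, a, b⟩ <;>
    simp [index, localIndex, Knots.orientIdx_orientIdx]

lemma index_injective {n : ℕ} (s : Frame) : Function.Injective (s.index (n := n)) :=
  Function.LeftInverse.injective s.localIndex_index

/-- The corner at the start (`true`) or the end (`false`) of a side. -/
def corner (s : Frame) (b : Bool) : Corner :=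
  if s.swap then (s.perp, s.par == b) else (s.par == b, s.perp)

lemma corner_index {n : ℕ} (s : Frame) (b : Bool) :
    (s.corner b).index ((0 : Fin (n + 1)), (0 : Fin (n + 1)))
      = s.index (orientIdx b 0, 0) := by
  rcases s with ⟨_ | _, _ | _, _ | _⟩ <;> cases b <;>
    simp [corner, Corner.index, index, orientIdx]

lemma corner_pt (s : Frame) (b : Bool) : (s.corner b).pt = s.pt (orient b 0, 0) := by
  rcases s with ⟨_ | _, _ | _, _ | _⟩ <;> cases b <;>
    simp [corner, Corner.pt, pt, orient]

lemma localIndex_corner {n : ℕ} (s : Frame) (c : Corner) :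
    (s.localIndex (c.index ((0 : Fin (n + 1)), (0 : Fin (n + 1))))).1 = 0 ∨
      (s.localIndex (c.index ((0 : Fin (n + 1)), (0 : Fin (n + 1))))).1 = Fin.last n := by
  rcases s with ⟨_ | _, _ | _, _ | _⟩ <;> rcases c with ⟨_ | _, _ | _⟩ <;>
    simp [localIndex, Corner.index, orientIdx]

/-- A basis function of the first row along another side lies, for the given side, in the first or
last column or in the last row. -/
lemma localIndex_index_other {n : ℕ} (s s' : Frame) (h : (s.swap, s.perp) ≠ (s'.swap, s'.perp))
    (i : Fin (n + 1)) :
    (s.localIndex (s'.index (i, 0))).1 = 0 ∨ (s.localIndex (s'.index (i, 0))).1 = Fin.last n ∨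
      (s.localIndex (s'.index (i, 0))).2 = Fin.last n := by
  rcases s with ⟨_ | _, _ | _, _ | _⟩ <;> rcases s' with ⟨_ | _, _ | _, _ | _⟩ <;>
    simp [localIndex, index, orientIdx] at h ⊢

end Frame

lemma sideImage_eq_of_side_eq (F : ℝ × ℝ → Plane) {s s' : Frame}
    (h : (s.swap, s.perp) = (s'.swap, s'.perp)) : sideImage F s = sideImage F s' := by
  obtain ⟨sw, pa, pe⟩ := s
  obtain ⟨sw', pa', pe'⟩ := s'
  simp only [Prod.mk.injEq] at h
  obtain ⟨rfl, rfl⟩ := h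
  have key : ∀ pa pa' : Bool, sideImage F ⟨sw, pa, pe⟩ ⊆ sideImage F ⟨sw, pa', pe⟩ := by
    rintro pa pa' _ ⟨t, ht, rfl⟩
    by_cases hp : pa = pa'
    · subst hp; exact ⟨t, ht, rfl⟩
    · refine ⟨1 - t, ⟨by linarith [ht.2], by linarith [ht.1]⟩, ?_⟩
      cases pa <;> cases pa' <;> simp [Frame.pt, orient] at hp ⊢
  exact (key _ _).antisymm (key _ _)

namespace Multipatch

variable {p K : ℕ} (D : Multipatch p K)

lemma sideFun_apply (k : Fin K) (s : Frame) (m : Fin (D.n k + 1)) (f : (D.knots k).V s.par) :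
    D.sideFun k s m f
      = ∑ i, ((D.knots k).basis s.par).repr f i • D.basis ⟨k, s.index (i, m)⟩ := by
  rw [sideFun, Module.Basis.constr_apply_fintype]
  rfl

lemma repr_sideFun (k : Fin K) (s : Frame) (m : Fin (D.n k + 1)) (f : (D.knots k).V s.par)
    (i m' : Fin (D.n k + 1)) : D.basis.repr (D.sideFun k s m f) ⟨k, s.index (i, m')⟩
      = if m' = m then ((D.knots k).basis s.par).repr f i else 0 := by
  simp only [sideFun_apply, map_sum, map_smul, Module.Basis.repr_self, Finsupp.coe_finsetSum,
    Finset.sum_apply, Finsupp.coe_smul, Pi.smul_apply, smul_eq_mul]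
  have hinj : ∀ a b : Fin (D.n k + 1) × Fin (D.n k + 1),
      (⟨k, s.index a⟩ : D.Idx) = ⟨k, s.index b⟩ ↔ a = b := fun a b => by
    constructor
    · intro h
      simp only [Sigma.mk.injEq, heq_eq_eq, true_and] at h
      exact s.index_injective h
    · rintro rfl; rfl
  rw [Finset.sum_eq_single i]
  · by_cases h : m' = m
    · subst h; simp
    · rw [if_neg h, Finsupp.single_eq_of_ne, mul_zero]
      rw [Ne, hinj]
      exact fun h' => h (Prod.ext_iff.1 h').2
  · intro i' _ hi'
    rw [Finsupp.single_eq_of_ne, mul_zero]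
    rw [Ne, hinj]
    exact fun h' => hi' (Prod.ext_iff.1 h').1.symm
  · simp

lemma repr_sideFun_other {k k' : Fin K} (hk : k' ≠ k) (s : Frame) (m : Fin (D.n k + 1))
    (f : (D.knots k).V s.par) (j : Fin (D.n k' + 1) × Fin (D.n k' + 1)) :
    D.basis.repr (D.sideFun k s m f) ⟨k', j⟩ = 0 := by
  simp only [sideFun_apply, map_sum, map_smul, Module.Basis.repr_self, Finsupp.coe_finsetSum,
    Finset.sum_apply, Finsupp.coe_smul, Pi.smul_apply, smul_eq_mul]
  refine Finset.sum_eq_zero fun i _ => ?_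
  rw [Finsupp.single_eq_of_ne, mul_zero]
  intro h
  exact hk (congrArg Sigma.fst h)

/-- The trace on a side, as a spline in the coordinate along the side: only the basis functions
with perpendicular index `0` contribute. -/
def trace (k : Fin K) (s : Frame) : D.Vpw →ₗ[ℝ] (D.knots k).V s.par :=
  ∑ i, (D.basis.coord ⟨k, s.index (i, 0)⟩).smulRight ((D.knots k).basis s.par i)

lemma repr_trace (k : Fin K) (s : Frame) (φ : D.Vpw) (i : Fin (D.n k + 1)) :
    ((D.knots k).basis s.par).repr (D.trace k s φ) i = D.basis.repr φ ⟨k, s.index (i, 0)⟩ := by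
  simp only [trace, LinearMap.sum_apply, LinearMap.smulRight_apply, Module.Basis.coord_apply,
    map_sum, map_smul, Module.Basis.repr_self, Finsupp.coe_finsetSum,
    Finset.sum_apply, Finsupp.coe_smul, Pi.smul_apply, smul_eq_mul]
  rw [Finset.sum_eq_single i]
  · simp
  · intro j _ hj
    rw [Finsupp.single_eq_of_ne hj.symm, mul_zero]
  · simp

lemma trace_eq_iff (k : Fin K) (s : Frame) (φ : D.Vpw) (f : (D.knots k).V s.par) :
    D.trace k s φ = f ↔ ∀ i, D.basis.repr φ ⟨k, s.index (i, 0)⟩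
      = ((D.knots k).basis s.par).repr f i := by
  constructor
  · rintro rfl i
    rw [repr_trace]
  · intro h
    refine ((D.knots k).basis s.par).ext_elem fun i => ?_
    rw [repr_trace, h]

/-- The end coefficients of a trace are corner coefficients. -/
lemma repr_trace_end (k : Fin K) (s : Frame) (φ : D.Vpw) (b : Bool) :
    ((D.knots k).basis s.par).repr (D.trace k s φ) (orientIdx b 0)
      = D.basis.repr φ (D.cornerIdx (k, s.corner b)) := by
  rw [repr_trace, cornerIdx, Frame.corner_index]

/-- A spline on a row that is not the last one, with vanishing end coefficients, has no corner
coefficients and no trace on the other sides. -/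
lemma repr_sideFun_eq_zero (k : Fin K) (s : Frame) {m : Fin (D.n k + 1)} (hm : m ≠ Fin.last _)
    (f : (D.knots k).V s.par) (h0 : ((D.knots k).basis s.par).repr f 0 = 0)
    (h1 : ((D.knots k).basis s.par).repr f (Fin.last _) = 0)
    (j : Fin (D.n k + 1) × Fin (D.n k + 1))
    (hj : (s.localIndex j).1 = 0 ∨ (s.localIndex j).1 = Fin.last _ ∨
      (s.localIndex j).2 = Fin.last _) : D.basis.repr (D.sideFun k s m f) ⟨k, j⟩ = 0 := by
  rw [← s.index_localIndex j, repr_sideFun]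
  split_ifs with h
  · rcases hj with hj | hj | hj
    · rw [hj]; exact h0
    · rw [hj]; exact h1
    · exact absurd (h.symm.trans hj) hm
  · rfl

lemma corner_sideFun (k : Fin K) (s : Frame) {m : Fin (D.n k + 1)} (hm : m ≠ Fin.last _)
    (f : (D.knots k).V s.par) (h0 : ((D.knots k).basis s.par).repr f 0 = 0)
    (h1 : ((D.knots k).basis s.par).repr f (Fin.last _) = 0) (b : Fin K × Corner) :
    D.basis.repr (D.sideFun k s m f) (D.cornerIdx b) = 0 := by
  by_cases hk : b.1 = k
  · subst hk
    refine D.repr_sideFun_eq_zero b.1 s hm f h0 h1 _ ?_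
    rcases s.localIndex_corner (n := D.n b.1) b.2 with h | h
    · exact Or.inl h
    · exact Or.inr (Or.inl h)
  · exact D.repr_sideFun_other hk s m f _

lemma trace_sideFun_other (k : Fin K) (s : Frame) {m : Fin (D.n k + 1)} (hm : m ≠ Fin.last _)
    (f : (D.knots k).V s.par) (h0 : ((D.knots k).basis s.par).repr f 0 = 0)
    (h1 : ((D.knots k).basis s.par).repr f (Fin.last _) = 0) (k' : Fin K) (s' : Frame)
    (h : sideImage (D.F k') s' ≠ sideImage (D.F k) s) : D.trace k' s' (D.sideFun k s m f) = 0 := by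
  rw [trace_eq_iff]
  intro i
  rw [map_zero, Finsupp.zero_apply]
  by_cases hk : k' = k
  · subst hk
    refine D.repr_sideFun_eq_zero k' s hm f h0 h1 _ (s.localIndex_index_other s' (fun h' => h ?_) i)
    exact (sideImage_eq_of_side_eq _ h').symm
  · exact D.repr_sideFun_other hk s m f _

lemma trace_sideFun_self (k : Fin K) (s : Frame) (f : (D.knots k).V s.par) :
    D.trace k s (D.sideFun k s 0 f) = f := by
  rw [trace_eq_iff]
  intro i
  rw [repr_sideFun, if_pos rfl]

lemma trace_sideFun_row (k : Fin K) (s : Frame) {m : Fin (D.n k + 1)} (hm : m ≠ 0)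
    (f : (D.knots k).V s.par) : D.trace k s (D.sideFun k s m f) = 0 := by
  rw [trace_eq_iff]
  intro i
  rw [repr_sideFun, if_neg hm.symm]
  simp

lemma trace_sideFun_patch {k k' : Fin K} (hk : k' ≠ k) (s s' : Frame) (m : Fin (D.n k + 1))
    (f : (D.knots k).V s.par) : D.trace k' s' (D.sideFun k s m f) = 0 := by
  rw [trace_eq_iff]
  intro i
  rw [D.repr_sideFun_other hk]
  simp

lemma moment_sideFun (hp : 1 ≤ p) (k' : Fin K) (P Q : Polynomial ℝ) (k : Fin K) (s : Frame) :
    ∃ P' Q' : Polynomial ℝ, P'.natDegree ≤ max P.natDegree Q.natDegree ∧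
      Q'.natDegree ≤ max P.natDegree Q.natDegree ∧ ∀ (m : Fin (D.n k + 1))
      (f : (D.knots k).V s.par), D.moment k' P Q (D.sideFun k s m f) =
        if k = k' then (D.knots k).momV hp s.par P' f * mom ((D.knots k).lam s.perp m) Q'
        else 0 := by
  have hdeg : ∀ o (P : Polynomial ℝ), (orientPoly o P).natDegree ≤ P.natDegree := fun o P =>
    Nat.lt_succ_iff.1 (natDegree_orientPoly (Nat.lt_succ_self _))
  have key : ∀ P' Q' : Polynomial ℝ, (∀ i m, mom ((D.knots k).lam true (s.index (i, m)).1) P *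
      mom ((D.knots k).lam true (s.index (i, m)).2) Q
      = mom ((D.knots k).lam s.par i) P' * mom ((D.knots k).lam s.perp m) Q') →
      ∀ (m : Fin (D.n k + 1)) (f : (D.knots k).V s.par), D.moment k' P Q (D.sideFun k s m f) =
        if k = k' then (D.knots k).momV hp s.par P' f * mom ((D.knots k).lam s.perp m) Q'
        else 0 := by
    intro P' Q' h m f
    have hf : (D.knots k).momV hp s.par P' f
        = ∑ i, ((D.knots k).basis s.par).repr f i * mom ((D.knots k).lam s.par i) P' := by
      conv_lhs => rw [← ((D.knots k).basis s.par).sum_repr f]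
      simp only [map_sum, map_smul, smul_eq_mul]
      refine Finset.sum_congr rfl fun i _ => ?_
      rw [← Knots.basis_apply]
      rfl
    simp only [sideFun_apply, map_sum, map_smul, moment_basis, smul_eq_mul, h, hf, Finset.sum_mul]
    split_ifs
    · exact Finset.sum_congr rfl fun i _ => by ring
    · simp
  by_cases hs : s.swap
  · refine ⟨orientPoly s.par Q, orientPoly s.perp P, (hdeg _ _).trans (le_max_right _ _),
      (hdeg _ _).trans (le_max_left _ _), key _ _ fun i m => ?_⟩
    simp only [Frame.index, hs, if_true, mom_lam_orientIdx]
    ring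
  · refine ⟨orientPoly s.par P, orientPoly s.perp Q, (hdeg _ _).trans (le_max_left _ _),
      (hdeg _ _).trans (le_max_right _ _), key _ _ fun i m => ?_⟩
    simp only [Frame.index, hs, if_false, mom_lam_orientIdx, Bool.false_eq_true]

/-! ### Edge operators -/

namespace Interface

variable {D} {e : Set Plane} (I : D.Interface e) (r : ℕ)

lemma image_eq' : sideImage (D.F I.kp) I.sp = e :=
  (Set.image_congr fun t ht => (I.matching t ht).symm).trans I.image_eq

/-- The linear extension of the factors of the correction term on the coarse side. -/
def corrMLin : I.Vm →ₗ[ℝ] I.Vm :=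
  LinearMap.id
    + (((D.knots I.km).basis I.sm.par).coord 0).smulRight
      (I.res r ((D.knots I.kp).muStart I.sp.par r - I.lamP 0))
    + (((D.knots I.km).basis I.sm.par).coord (Fin.last _)).smulRight
      (I.res r ((D.knots I.kp).muEnd I.sp.par r - I.lamP (Fin.last _)))

/-- The linear extension of the factors of the correction term on the fine side. -/
def corrPLin : I.Vp →ₗ[ℝ] I.Vp :=
  LinearMap.id
    + (((D.knots I.kp).basis I.sp.par).coord 0).smulRight
      ((D.knots I.kp).muStart I.sp.par r - I.lamP 0)
    + (((D.knots I.kp).basis I.sp.par).coord (Fin.last _)).smulRight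
      ((D.knots I.kp).muEnd I.sp.par r - I.lamP (Fin.last _))

lemma corrMLin_basis (i : Fin (D.n I.km + 1)) : I.corrMLin r (I.lamM i) = I.corrM r i := by
  have hne : Fin.last (D.n I.km) ≠ 0 := last_ne_zero' (D.knots I.km)
  simp only [corrMLin, LinearMap.add_apply, LinearMap.id_apply, LinearMap.smulRight_apply,
    Module.Basis.coord_apply, Module.Basis.repr_self, corrM, lamM]
  by_cases h0 : i = 0
  · subst h0
    simp [Finsupp.single_eq_of_ne hne]
  · by_cases h1 : i = Fin.last _
    · subst h1
      simp [Finsupp.single_eq_of_ne hne.symm, hne]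
    · simp [Finsupp.single_eq_of_ne (Ne.symm h0), Finsupp.single_eq_of_ne (Ne.symm h1), h0, h1]

lemma corrPLin_basis (i : Fin (D.n I.kp + 1)) : I.corrPLin r (I.lamP i) = I.corrP r i := by
  have hne : Fin.last (D.n I.kp) ≠ 0 := last_ne_zero' (D.knots I.kp)
  simp only [corrPLin, LinearMap.add_apply, LinearMap.id_apply, LinearMap.smulRight_apply,
    Module.Basis.coord_apply, Module.Basis.repr_self, corrP, lamP]
  by_cases h0 : i = 0
  · subst h0
    simp [Finsupp.single_eq_of_ne hne]
  · by_cases h1 : i = Fin.last _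
    · subst h1
      simp [Finsupp.single_eq_of_ne hne.symm, hne]
    · simp [Finsupp.single_eq_of_ne (Ne.symm h0), Finsupp.single_eq_of_ne (Ne.symm h1), h0, h1]

/-- The trace from the coarse patch. -/
abbrev trM : D.Vpw →ₗ[ℝ] I.Vm := D.trace I.km I.sm

/-- The trace from the fine patch. -/
abbrev trP : D.Vpw →ₗ[ℝ] I.Vp := D.trace I.kp I.sp

lemma trM_basis (k : Fin K) (j : Fin (D.n k + 1) × Fin (D.n k + 1)) (hk : k ≠ I.km) :
    I.trM (D.basis ⟨k, j⟩) = 0 := by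
  rw [trace_eq_iff]
  intro i
  rw [Module.Basis.repr_self, Finsupp.single_eq_of_ne]
  · simp
  · exact fun h => hk (congrArg Sigma.fst h).symm

lemma trP_basis (k : Fin K) (j : Fin (D.n k + 1) × Fin (D.n k + 1)) (hk : k ≠ I.kp) :
    I.trP (D.basis ⟨k, j⟩) = 0 := by
  rw [trace_eq_iff]
  intro i
  rw [Module.Basis.repr_self, Finsupp.single_eq_of_ne]
  · simp
  · exact fun h => hk (congrArg Sigma.fst h).symm

lemma basis_eq_sideFun (k : Fin K) (s : Frame) (j : Fin (D.n k + 1) × Fin (D.n k + 1)) :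
    D.basis ⟨k, j⟩
      = D.sideFun k s (s.localIndex j).2 ((D.knots k).basis s.par (s.localIndex j).1) := by
  rw [sideFun, Module.Basis.constr_basis]
  rw [show ((s.localIndex j).1, (s.localIndex j).2) = s.localIndex j from rfl,
    Frame.index_localIndex]

/-- The edge operator in terms of the two traces. -/
lemma edgeOp_apply (φ : D.Vpw) : I.edgeOp r φ = φ - D.sideFun I.km I.sm 0 (I.trM φ)
    - D.sideFun I.kp I.sp 0 (I.trP φ) + I.average (I.trM φ + I.res r (I.trP φ))
    + I.correction r (I.corrMLin r (I.trM φ) - I.res r (I.corrPLin r (I.trP φ))) := by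
  suffices H : I.edgeOp r = LinearMap.id - D.sideFun I.km I.sm 0 ∘ₗ I.trM
      - D.sideFun I.kp I.sp 0 ∘ₗ I.trP + I.average ∘ₗ (I.trM + I.res r ∘ₗ I.trP)
      + I.correction r ∘ₗ (I.corrMLin r ∘ₗ I.trM - I.res r ∘ₗ I.corrPLin r ∘ₗ I.trP) by
    rw [H]; rfl
  refine D.basis.ext fun a => ?_
  rw [edgeOp, Module.Basis.constr_basis]
  obtain ⟨k, j⟩ := a
  simp only [LinearMap.add_apply, LinearMap.sub_apply, LinearMap.id_apply, LinearMap.comp_apply]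
  by_cases hk : k = I.km
  · subst hk
    have hP : I.trP (D.basis ⟨I.km, j⟩) = 0 := I.trP_basis _ _ I.ne
    rw [dif_pos rfl, hP]
    simp only [map_zero, sub_zero, add_zero]
    by_cases hj : (I.sm.localIndex j).2 = 0
    · have hM : I.trM (D.basis ⟨I.km, j⟩) = I.lamM (I.sm.localIndex j).1 := by
        rw [basis_eq_sideFun I.km I.sm j, hj, trace_sideFun_self]
      have hB : D.basis ⟨I.km, j⟩ = D.sideFun I.km I.sm 0 (I.lamM (I.sm.localIndex j).1) := by
        rw [basis_eq_sideFun I.km I.sm j, hj]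
      simp only [hM, if_pos hj, corrMLin_basis]
      rw [hB]
      abel
    · have hM : I.trM (D.basis ⟨I.km, j⟩) = 0 := by
        rw [basis_eq_sideFun I.km I.sm j, D.trace_sideFun_row _ _ hj]
      rw [if_neg hj, hM]
      simp
  · have hM : I.trM (D.basis ⟨k, j⟩) = 0 := I.trM_basis _ _ hk
    rw [dif_neg hk, hM]
    simp only [map_zero, sub_zero, zero_add, zero_sub, map_neg]
    by_cases hk' : k = I.kp
    · subst hk'
      rw [dif_pos rfl]
      by_cases hj : (I.sp.localIndex j).2 = 0
      · have hP : I.trP (D.basis ⟨I.kp, j⟩) = I.lamP (I.sp.localIndex j).1 := by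
          rw [basis_eq_sideFun I.kp I.sp j, hj, trace_sideFun_self]
        have hB : D.basis ⟨I.kp, j⟩ = D.sideFun I.kp I.sp 0 (I.lamP (I.sp.localIndex j).1) := by
          rw [basis_eq_sideFun I.kp I.sp j, hj]
        simp only [hP, if_pos hj, corrPLin_basis]
        rw [hB]
        abel
      · have hP : I.trP (D.basis ⟨I.kp, j⟩) = 0 := by
          rw [basis_eq_sideFun I.kp I.sp j, D.trace_sideFun_row _ _ hj]
        simp only [hP, if_neg hj]
        simp
    · rw [dif_neg hk', I.trP_basis _ _ hk']
      simp

lemma corner_eq (b : Bool) :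
    D.F I.km (I.sm.corner b).pt = D.F I.kp (I.sp.corner b).pt := by
  rw [Frame.corner_pt, Frame.corner_pt]
  refine I.matching _ ?_
  cases b <;> simp [orient]

lemma repr_ends {φ : D.Vpw} (hφ : φ ∈ D.vertexConforming) (b : Bool) :
    ((D.knots I.km).basis I.sm.par).repr (I.trM φ) (orientIdx b 0)
      = ((D.knots I.kp).basis I.sp.par).repr (I.trP φ) (orientIdx b 0) := by
  rw [repr_trace_end, repr_trace_end]
  exact hφ _ _ (I.corner_eq b)

/-- On vertex-conforming splines, the modified factors at the end indices cancel, since the end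
coefficients of the two traces agree. -/
lemma corr_diff {φ : D.Vpw} (hφ : φ ∈ D.vertexConforming) :
    I.corrMLin r (I.trM φ) - I.res r (I.corrPLin r (I.trP φ))
      = I.trM φ - I.res r (I.trP φ) := by
  have h0 := I.repr_ends hφ true
  have h1 := I.repr_ends hφ false
  simp only [orientIdx, Fin.rev_zero] at h0 h1
  simp only [corrMLin, corrPLin, LinearMap.add_apply, LinearMap.id_apply,
    LinearMap.smulRight_apply, Module.Basis.coord_apply, h0, h1, map_add, map_smul]
  abel

/-- The increment of the edge operator on vertex-conforming splines. -/
def increment (φ : D.Vpw) : D.Vpw :=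
  D.sideFun I.km I.sm 0 ((2⁻¹ : ℝ) • (I.res r (I.trP φ) - I.trM φ))
    + D.sideFun I.kp I.sp 0 ((2⁻¹ : ℝ) • I.ext (I.trM φ + I.res r (I.trP φ)) - I.trP φ)
    + I.correction r (I.trM φ - I.res r (I.trP φ))

lemma edgeOp_eq_add_increment {φ : D.Vpw} (hφ : φ ∈ D.vertexConforming) :
    I.edgeOp r φ = φ + I.increment r φ := by
  rw [edgeOp_apply, corr_diff I r hφ, increment, average]
  simp only [LinearMap.smul_apply, LinearMap.add_apply, LinearMap.comp_apply, map_add, map_sub,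
    map_smul]
  module

lemma repr_ext_zero (f : I.Vm) : ((D.knots I.kp).basis I.sp.par).repr (I.ext f) 0
    = ((D.knots I.km).basis I.sm.par).repr f 0 := by
  rw [Knots.repr_zero_eq, Knots.repr_zero_eq]; rfl

lemma repr_ext_last (f : I.Vm) : ((D.knots I.kp).basis I.sp.par).repr (I.ext f) (Fin.last _)
    = ((D.knots I.km).basis I.sm.par).repr f (Fin.last _) := by
  rw [Knots.repr_last_eq, Knots.repr_last_eq]; rfl

lemma correction_apply (f : I.Vm) : I.correction r f = (2⁻¹ : ℝ) •
    (∑ m : Fin r, (D.knots I.km).gamma I.sm.perp r m •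
        D.sideFun I.km I.sm ((D.knots I.km).idx (m + 1)) f
      - ∑ m : Fin r, (D.knots I.kp).gamma I.sp.perp r m •
        D.sideFun I.kp I.sp ((D.knots I.kp).idx (m + 1)) (I.ext f)) := by
  simp [correction]

section

variable {r} (hr : r ≤ p + 1)
include hr

lemma repr_res_zero (g : I.Vp) : ((D.knots I.km).basis I.sm.par).repr (I.res r g) 0
    = ((D.knots I.kp).basis I.sp.par).repr g 0 :=
  repr_restrictOp_zero _ _ _ _ _ r hr g

lemma repr_res_last (g : I.Vp) : ((D.knots I.km).basis I.sm.par).repr (I.res r g) (Fin.last _)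
    = ((D.knots I.kp).basis I.sp.par).repr g (Fin.last _) :=
  repr_restrictOp_last _ _ _ _ _ r hr g

lemma idx_ne_last (k : Fin K) (m : Fin r) : (D.knots k).idx (m + 1) ≠ Fin.last _ := by
  have hn := (D.knots k).three_cells
  rw [Ne, Fin.ext_iff, (D.knots k).idx_val (by omega), Fin.val_last]
  omega

lemma idx_ne_zero (k : Fin K) (m : Fin r) : (D.knots k).idx (m + 1) ≠ 0 := by
  have hn := (D.knots k).three_cells
  rw [Ne, Fin.ext_iff, (D.knots k).idx_val (by omega)]
  simp

/-- A linear functional that vanishes on the rows of splines with vanishing end coefficients, along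
both sides of the edge, vanishes on the increment. -/
lemma map_increment_eq_zero {N : Type*} [AddCommGroup N] [Module ℝ N] (L : D.Vpw →ₗ[ℝ] N)
    (hM : ∀ m ≠ Fin.last _, ∀ f, ((D.knots I.km).basis I.sm.par).repr f 0 = 0 →
      ((D.knots I.km).basis I.sm.par).repr f (Fin.last _) = 0 →
      L (D.sideFun I.km I.sm m f) = 0)
    (hP : ∀ m ≠ Fin.last _, ∀ f, ((D.knots I.kp).basis I.sp.par).repr f 0 = 0 →
      ((D.knots I.kp).basis I.sp.par).repr f (Fin.last _) = 0 →
      L (D.sideFun I.kp I.sp m f) = 0)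
    {φ : D.Vpw} (hφ : φ ∈ D.vertexConforming) : L (I.increment r φ) = 0 := by
  have h0 := I.repr_ends hφ true
  have h1 := I.repr_ends hφ false
  simp only [orientIdx, Fin.rev_zero] at h0 h1
  have hlm : (0 : Fin (D.n I.km + 1)) ≠ Fin.last _ := (last_ne_zero' (D.knots I.km)).symm
  have hlp : (0 : Fin (D.n I.kp + 1)) ≠ Fin.last _ := (last_ne_zero' (D.knots I.kp)).symm
  have hd0 : ((D.knots I.km).basis I.sm.par).repr (I.trM φ - I.res r (I.trP φ)) 0 = 0 := by
    rw [map_sub, Finsupp.sub_apply, I.repr_res_zero hr, h0, sub_self]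
  have hd1 : ((D.knots I.km).basis I.sm.par).repr (I.trM φ - I.res r (I.trP φ)) (Fin.last _)
      = 0 := by
    rw [map_sub, Finsupp.sub_apply, I.repr_res_last hr, h1, sub_self]
  have hcorr : ∀ d : I.Vm, ((D.knots I.km).basis I.sm.par).repr d 0 = 0 →
      ((D.knots I.km).basis I.sm.par).repr d (Fin.last _) = 0 → L (I.correction r d) = 0 := by
    intro d hd0 hd1
    rw [correction_apply, map_smul, map_sub, map_sum, map_sum, Finset.sum_eq_zero,
      Finset.sum_eq_zero]
    · simp
    · intro m _
      rw [map_smul, hP _ (idx_ne_last hr I.kp m), smul_zero]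
      · rw [repr_ext_zero, hd0]
      · rw [repr_ext_last, hd1]
    · intro m _
      rw [map_smul, hM _ (idx_ne_last hr I.km m) _ hd0 hd1, smul_zero]
  rw [increment, map_add, map_add, hM 0 hlm, hP 0 hlp, hcorr _ hd0 hd1]
  · simp
  · rw [map_sub, map_smul, Finsupp.sub_apply, Finsupp.smul_apply, repr_ext_zero, map_add,
      Finsupp.add_apply, I.repr_res_zero hr, h0, smul_eq_mul]
    ring
  · rw [map_sub, map_smul, Finsupp.sub_apply, Finsupp.smul_apply, repr_ext_last, map_add,
      Finsupp.add_apply, I.repr_res_last hr, h1, smul_eq_mul]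
    ring
  · rw [map_smul, Finsupp.smul_apply, ← neg_sub, map_neg, Finsupp.neg_apply, hd0]
    simp
  · rw [map_smul, Finsupp.smul_apply, ← neg_sub, map_neg, Finsupp.neg_apply, hd1]
    simp

lemma corner_increment {φ : D.Vpw} (hφ : φ ∈ D.vertexConforming) (b : Fin K × Corner) :
    D.basis.repr (I.increment r φ) (D.cornerIdx b) = 0 :=
  I.map_increment_eq_zero hr (D.basis.coord (D.cornerIdx b))
    (fun _ hm f h0 h1 => D.corner_sideFun _ _ hm f h0 h1 b)
    (fun _ hm f h0 h1 => D.corner_sideFun _ _ hm f h0 h1 b) hφ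

lemma increment_mem {φ : D.Vpw} (hφ : φ ∈ D.vertexConforming) :
    I.increment r φ ∈ D.vertexConforming := fun b b' _ => by
  rw [I.corner_increment hr hφ, I.corner_increment hr hφ]

lemma trace_increment_other {φ : D.Vpw} (hφ : φ ∈ D.vertexConforming) (k : Fin K) (s : Frame)
    (h : sideImage (D.F k) s ≠ e) : D.trace k s (I.increment r φ) = 0 :=
  I.map_increment_eq_zero hr (D.trace k s)
    (fun _ hm f h0 h1 => D.trace_sideFun_other _ _ hm f h0 h1 k s (by rwa [I.image_eq]))
    (fun _ hm f h0 h1 => D.trace_sideFun_other _ _ hm f h0 h1 k s (by rwa [I.image_eq'])) hφ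

/-- The edge operator makes the two traces agree. -/
lemma trP_increment (φ : D.Vpw) :
    I.trP (φ + I.increment r φ) = I.ext (I.trM (φ + I.increment r φ)) := by
  have hM : I.trM (I.increment r φ) = (2⁻¹ : ℝ) • (I.res r (I.trP φ) - I.trM φ) := by
    rw [increment, map_add, map_add, trace_sideFun_self,
      D.trace_sideFun_patch I.ne, correction]
    simp only [LinearMap.smul_apply, LinearMap.sub_apply, LinearMap.sum_apply,
      LinearMap.comp_apply, map_smul, map_sub, map_sum,
      D.trace_sideFun_row _ _ (idx_ne_zero hr I.km _), D.trace_sideFun_patch I.ne]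
    simp
  have hP : I.trP (I.increment r φ)
      = (2⁻¹ : ℝ) • I.ext (I.trM φ + I.res r (I.trP φ)) - I.trP φ := by
    rw [increment, map_add, map_add, trace_sideFun_self,
      D.trace_sideFun_patch I.ne.symm, correction]
    simp only [LinearMap.smul_apply, LinearMap.sub_apply, LinearMap.sum_apply,
      LinearMap.comp_apply, map_smul, map_sub, map_sum,
      D.trace_sideFun_row _ _ (idx_ne_zero hr I.kp _), D.trace_sideFun_patch I.ne.symm]
    simp
  rw [map_add, map_add, hM, hP]
  simp only [map_add, map_sub, map_smul]
  module

/-- The increment of the edge operator has no moments: the correction has the moments of the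
difference of the traces, carried by the first row on either side. -/
lemma moment_increment (hp : 1 ≤ p) (k : Fin K) {P Q : Polynomial ℝ} (hP : P.natDegree < r)
    (hQ : Q.natDegree < r) (φ : D.Vpw) : D.moment k P Q (I.increment r φ) = 0 := by
  have hmax : max P.natDegree Q.natDegree < r := max_lt hP hQ
  -- the perpendicular factors of the correction have the moments of the first basis function
  have hγ : ∀ l (s : Frame) (f : (D.knots l).V s.par), ∑ m : Fin r, (D.knots l).gamma s.perp r m *
      D.moment k P Q (D.sideFun l s ((D.knots l).idx (m + 1)) f)
      = D.moment k P Q (D.sideFun l s 0 f) := by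
    intro l s f
    obtain ⟨P', Q', hP', hQ', h⟩ := D.moment_sideFun hp k P Q l s
    simp only [h]
    split_ifs
    · rw [← (D.knots l).sum_gamma_mom hp s.perp hr (hQ'.trans_lt hmax), Finset.mul_sum]
      exact Finset.sum_congr rfl fun m _ => by ring
    · simp
  have hres : D.moment k P Q (D.sideFun I.kp I.sp 0 (I.ext (I.res r (I.trP φ))))
      = D.moment k P Q (D.sideFun I.kp I.sp 0 (I.trP φ)) := by
    obtain ⟨P', Q', hP', hQ', h⟩ := D.moment_sideFun hp k P Q I.kp I.sp
    have : (D.knots I.kp).momV hp I.sp.par P' (I.ext (I.res r (I.trP φ)))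
        = (D.knots I.kp).momV hp I.sp.par P' (I.trP φ) :=
      mom_restrictOp _ _ _ _ _ r hp hr _ (hP'.trans_lt hmax)
    rw [h, h, this]
  rw [increment, map_add, map_add, correction_apply]
  rw [map_smul (D.moment k P Q), map_sub (D.moment k P Q), map_sum, map_sum]
  simp only [map_smul (D.moment k P Q), smul_eq_mul, hγ]
  simp only [map_add, map_sub, map_smul, hres, smul_eq_mul]
  ring

end

end Interface

end Multipatch

namespace Multipatch

variable {p K : ℕ} (D : Multipatch p K)

/-! ### The product of the edge operators -/

namespace Interface

variable {D} {e : Set Plane} (I : D.Interface e)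

/-- The increment vanishes when the two traces agree. -/
lemma increment_eq_zero (r : ℕ) (hp : 1 ≤ p) {φ : D.Vpw}
    (h : I.trP φ = I.ext (I.trM φ)) : I.increment r φ = 0 := by
  have hres : I.res r (I.trP φ) = I.trM φ := by
    rw [h]
    exact restrictOp_inclusion _ _ _ _ _ r hp _
  rw [increment, hres, sub_self, smul_zero, map_zero, map_zero, h]
  have : (2⁻¹ : ℝ) • I.ext (I.trM φ + I.trM φ) - I.ext (I.trM φ) = 0 := by
    rw [map_add]
    module
  rw [this, map_zero]
  simp

end Interface

/-- The traces of `φ` from the two sides of every interior edge agree. -/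
def TracesMatch (I : ∀ e, D.IsInterior e → D.Interface e) (φ : D.Vpw) : Prop :=
  ∀ e he, (I e he).trP φ = (I e he).ext ((I e he).trM φ)

variable (I : ∀ e, D.IsInterior e → D.Interface e) {r : ℕ}

lemma IsInterior.mem_edges {e : Set Plane} (h : D.IsInterior e) : e ∈ D.edges := by
  obtain ⟨k, -, -, s, -, hs, -⟩ := h
  simp only [edges, Finset.mem_image, Finset.mem_univ, true_and]
  exact ⟨(k, s), hs⟩

lemma edgeOp_sub_of_isInterior {e : Set Plane} (he : D.IsInterior e) {φ : D.Vpw}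
    (hφ : φ ∈ D.vertexConforming) : D.edgeOp I r e φ - φ = (I e he).increment r φ := by
  rw [edgeOp, dif_pos he, (I e he).edgeOp_eq_add_increment r hφ, add_sub_cancel_left]

lemma edgeOp_sub_of_not_isInterior {e : Set Plane} (he : ¬ D.IsInterior e) (φ : D.Vpw) :
    D.edgeOp I r e φ - φ = 0 := by
  rw [edgeOp, dif_neg he, Module.End.one_apply, sub_self]

section

variable (hp : 1 ≤ p) (hr : r ≤ p + 1)
include hr

lemma edgeOp_sub_mem (e : Set Plane) {φ : D.Vpw} (hφ : φ ∈ D.vertexConforming) :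
    D.edgeOp I r e φ - φ ∈ D.vertexConforming := by
  by_cases he : D.IsInterior e
  · rw [D.edgeOp_sub_of_isInterior I he hφ]
    exact (I e he).increment_mem hr hφ
  · rw [D.edgeOp_sub_of_not_isInterior I he]
    exact Submodule.zero_mem _

lemma trace_edgeOp_sub_other {e : Set Plane} {φ : D.Vpw} (hφ : φ ∈ D.vertexConforming) (k : Fin K)
    (s : Frame) (h : sideImage (D.F k) s ≠ e) : D.trace k s (D.edgeOp I r e φ - φ) = 0 := by
  by_cases he : D.IsInterior e
  · rw [D.edgeOp_sub_of_isInterior I he hφ]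
    exact (I e he).trace_increment_other hr hφ k s h
  · rw [D.edgeOp_sub_of_not_isInterior I he, map_zero]

include hp

lemma edgeOp_fix {e e' : Set Plane} (h : e ≠ e') {φ : D.Vpw} (hφ : φ ∈ D.vertexConforming) :
    D.edgeOp I r e (D.edgeOp I r e' φ - φ) = D.edgeOp I r e' φ - φ := by
  rw [← sub_eq_zero]
  by_cases he : D.IsInterior e
  · rw [D.edgeOp_sub_of_isInterior I he (D.edgeOp_sub_mem I hr e' hφ)]
    apply (I e he).increment_eq_zero r hp
    rw [Interface.trP, Interface.trM,
      D.trace_edgeOp_sub_other I hr hφ _ _ (by rwa [(I e he).image_eq']),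
      D.trace_edgeOp_sub_other I hr hφ _ _ (by rwa [(I e he).image_eq]), map_zero]
  · rw [D.edgeOp_sub_of_not_isInterior I he]

lemma edgeList_apply {le : List (Set Plane)} (hle : le.Perm D.edges.toList) {φ : D.Vpw}
    (hφ : φ ∈ D.vertexConforming) :
    (le.map (D.edgeOp I r)).prod φ = φ + ∑ e ∈ D.edges, (D.edgeOp I r e φ - φ) := by
  rw [list_prod_apply_eq_add_sum (D.edgeOp I r) D.vertexConforming le
    (hle.nodup_iff.2 D.edges.nodup_toList) (fun e e' he φ hφ => D.edgeOp_fix I hp hr he hφ) hφ,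
    (hle.map _).sum_eq, Finset.sum_map_toList]

lemma edgeProd_mem {φ : D.Vpw} (hφ : φ ∈ D.vertexConforming) :
    D.edgeProd I r φ ∈ D.vertexConforming := by
  rw [edgeProd, D.edgeList_apply I hp hr (List.Perm.refl _) hφ]
  exact Submodule.add_mem _ hφ (Submodule.sum_mem _ fun e _ => D.edgeOp_sub_mem I hr e hφ)

lemma tracesMatch_edgeProd {φ : D.Vpw} (hφ : φ ∈ D.vertexConforming) :
    D.TracesMatch I (D.edgeProd I r φ) := by
  intro e he
  have key : ∀ k s, sideImage (D.F k) s = e → D.trace k s (D.edgeProd I r φ)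
      = D.trace k s (φ + (I e he).increment r φ) := by
    intro k s hks
    rw [edgeProd, D.edgeList_apply I hp hr (List.Perm.refl _) hφ, map_add, map_add, map_sum,
      Finset.sum_eq_single e, D.edgeOp_sub_of_isInterior I he hφ]
    · intro e' _ he'
      exact D.trace_edgeOp_sub_other I hr hφ k s (by rw [hks]; exact he'.symm)
    · intro h
      exact absurd (IsInterior.mem_edges D he) h
  rw [Interface.trP, Interface.trM, key _ _ (I e he).image_eq', key _ _ (I e he).image_eq]
  exact (I e he).trP_increment hr φ

lemma edgeProd_eq_self {φ : D.Vpw} (hφ : φ ∈ D.vertexConforming) (h : D.TracesMatch I φ) :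
    D.edgeProd I r φ = φ := by
  rw [edgeProd, D.edgeList_apply I hp hr (List.Perm.refl _) hφ, Finset.sum_eq_zero, add_zero]
  intro e _
  by_cases he : D.IsInterior e
  · rw [D.edgeOp_sub_of_isInterior I he hφ, (I e he).increment_eq_zero r hp (h e he)]
  · exact D.edgeOp_sub_of_not_isInterior I he φ

lemma moment_edgeProd (k : Fin K) {P Q : Polynomial ℝ} (hP : P.natDegree < r)
    (hQ : Q.natDegree < r) {φ : D.Vpw} (hφ : φ ∈ D.vertexConforming) :
    D.moment k P Q (D.edgeProd I r φ) = D.moment k P Q φ := by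
  rw [edgeProd, D.edgeList_apply I hp hr (List.Perm.refl _) hφ, map_add, map_sum,
    Finset.sum_eq_zero, add_zero]
  intro e _
  by_cases he : D.IsInterior e
  · rw [D.edgeOp_sub_of_isInterior I he hφ, (I e he).moment_increment hr hp k hP hQ]
  · rw [D.edgeOp_sub_of_not_isInterior I he, map_zero]

/-- The product of edge and vertex operators does not depend on the order of the factors. -/
lemma prod_eq_P0 {lv : List Plane} (hlv : lv.Perm D.vertices.toList) {le : List (Set Plane)}
    (hle : le.Perm D.edges.toList) :
    (le.map (D.edgeOp I r)).prod * (lv.map (D.vertexOp r)).prod = D.P0 I r := by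
  refine LinearMap.ext fun φ => ?_
  have h : (lv.map (D.vertexOp r)).prod φ = D.vertexProd r φ := by
    rw [vertexProd, D.vertexList_apply hr hlv, D.vertexList_apply hr (List.Perm.refl _)]
  rw [P0, Module.End.mul_apply, Module.End.mul_apply, h, edgeProd,
    D.edgeList_apply I hp hr hle (D.vertexProd_mem hr φ),
    D.edgeList_apply I hp hr (List.Perm.refl _) (D.vertexProd_mem hr φ)]

end

end Multipatch

open Filter Topology

/-! ### Geometry of a single patch -/

lemma closure_openSquare : closure openSquare = closedSquare := by
  rw [openSquare, closedSquare, closure_prod_eq, closure_Ioo zero_ne_one]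

lemma isOpen_openSquare : IsOpen openSquare := isOpen_Ioo.prod isOpen_Ioo

/-- The tangent cone at a point of the side `{d = 0}`: directions with positive second logical
coordinate point into the patch, and the preimage points approach the base point. -/
lemma exists_tangent {G : ℝ × ℝ → Plane} {t : ℝ} (ht : t ∈ Ioo (0 : ℝ) 1) {A : (ℝ × ℝ) ≃L[ℝ] Plane}
    (hA : HasStrictFDerivAt G (A : ℝ × ℝ →L[ℝ] Plane) (t, 0)) :
    ∃ g : Plane → ℝ × ℝ, Tendsto g (𝓝 (G (t, 0))) (𝓝 (t, 0)) ∧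
      ∀ w, 0 < (A.symm w).2 → ∀ᶠ ε : ℝ in 𝓝[>] 0,
        g (G (t, 0) + ε • w) ∈ openSquare ∧ G (g (G (t, 0) + ε • w)) = G (t, 0) + ε • w := by
  refine ⟨hA.localInverse G A (t, 0), hA.localInverse_tendsto, fun w hw => ?_⟩
  set g := hA.localInverse G A (t, 0)
  set X := G (t, 0)
  have hline : Tendsto (fun ε : ℝ => X + ε • w) (𝓝[>] 0) (𝓝 X) := by
    have : ContinuousAt (fun ε : ℝ => X + ε • w) 0 := by fun_prop
    have h := this.tendsto
    rw [zero_smul, add_zero] at h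
    exact h.mono_left nhdsWithin_le_nhds
  have hg : Tendsto (fun ε : ℝ => g (X + ε • w)) (𝓝[>] 0) (𝓝 (t, 0)) :=
    hA.localInverse_tendsto.comp hline
  have hgX : g X = (t, 0) := hA.localInverse_apply_image
  have hderiv : HasDerivAt (fun ε : ℝ => g (X + ε • w)) (A.symm w) 0 := by
    have h1 : HasDerivAt (fun ε : ℝ => X + ε • w) w 0 := by
      simpa using ((hasDerivAt_id (0 : ℝ)).smul_const w).const_add X
    have h2 : HasFDerivAt g (A.symm : Plane →L[ℝ] ℝ × ℝ) (X + (0 : ℝ) • w) := by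
      rw [zero_smul, add_zero]
      exact hA.to_localInverse.hasFDerivAt
    exact h2.comp_hasDerivAt 0 h1
  have hderiv2 : HasDerivAt (fun ε : ℝ => (g (X + ε • w)).2) (A.symm w).2 0 :=
    (ContinuousLinearMap.snd ℝ ℝ ℝ).hasFDerivAt.comp_hasDerivAt 0 hderiv
  have hpos : ∀ᶠ ε : ℝ in 𝓝[>] 0, 0 < (g (X + ε • w)).2 := by
    have h := (hasDerivAt_iff_tendsto_slope.1 hderiv2).eventually (lt_mem_nhds hw)
    have h' : ∀ᶠ ε : ℝ in 𝓝[>] 0, 0 < slope (fun ε : ℝ => (g (X + ε • w)).2) 0 ε :=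
      h.filter_mono (nhdsWithin_mono _ fun x hx => ne_of_gt hx)
    filter_upwards [h', self_mem_nhdsWithin] with ε hε hε0
    rw [slope_def_field, zero_smul, add_zero, hgX, sub_zero, sub_zero] at hε
    exact (div_pos_iff_of_pos_right hε0).1 hε
  have h1 : ∀ᶠ ε : ℝ in 𝓝[>] 0, (g (X + ε • w)).1 ∈ Ioo (0 : ℝ) 1 :=
    ((continuous_fst.tendsto _).comp hg).eventually (isOpen_Ioo.mem_nhds ht)
  have h2 : ∀ᶠ ε : ℝ in 𝓝[>] 0, (g (X + ε • w)).2 < 1 :=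
    ((continuous_snd.tendsto _).comp hg).eventually (gt_mem_nhds one_pos)
  filter_upwards [hpos, h1, h2, hline.eventually hA.eventually_right_inverse] with ε a b c d
  exact ⟨⟨b, a, c⟩, d⟩

/-- A `C¹` diffeomorphism of the closed reference square onto its image. -/
structure IsPatchMap (G : ℝ × ℝ → Plane) : Prop where
  smooth : ∀ x ∈ closedSquare, ContDiffAt ℝ 1 G x
  immersive : ∀ x ∈ closedSquare, Function.Bijective (fderiv ℝ G x)
  injOn : InjOn G closedSquare

namespace IsPatchMap

variable {G : ℝ × ℝ → Plane} (hG : IsPatchMap G)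
include hG

lemma continuousOn : ContinuousOn G closedSquare := fun x hx =>
  (hG.smooth x hx).continuousAt.continuousWithinAt

lemma exists_hasStrictFDerivAt {x : ℝ × ℝ} (hx : x ∈ closedSquare) :
    ∃ A : (ℝ × ℝ) ≃L[ℝ] Plane, HasStrictFDerivAt G (A : ℝ × ℝ →L[ℝ] Plane) x := by
  refine ⟨(LinearEquiv.ofBijective (fderiv ℝ G x : ℝ × ℝ →ₗ[ℝ] Plane)
    (hG.immersive x hx)).toContinuousLinearEquiv, ?_⟩
  exact ((hG.smooth x hx).hasStrictFDerivAt one_ne_zero).congr_fderiv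
    (ContinuousLinearMap.ext fun _ => rfl)

lemma closure_image : closure (G '' openSquare) = G '' closedSquare := by
  rw [← closure_openSquare, image_closure_of_isCompact]
  · rw [closure_openSquare]; exact Multipatch.isCompact_closedSquare
  · rw [closure_openSquare]; exact hG.continuousOn

lemma isCompact_image : IsCompact (G '' closedSquare) :=
  Multipatch.isCompact_closedSquare.image_of_continuousOn hG.continuousOn

lemma isOpen_image : IsOpen (G '' openSquare) := by
  rw [isOpen_iff_mem_nhds]
  rintro _ ⟨x, hx, rfl⟩
  obtain ⟨A, hA⟩ := hG.exists_hasStrictFDerivAt (Multipatch.openSquare_subset hx)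
  rw [← hA.map_nhds_eq_of_equiv]
  exact image_mem_map (isOpen_openSquare.mem_nhds hx)

/-- The inverse of a patch map is Lipschitz: by compactness of the square of the closed reference
square, this is a local question, near the diagonal settled by the inverse function theorem and
away from it by injectivity. -/
lemma exists_dist_le : ∃ c : ℝ, 0 ≤ c ∧
    ∀ x ∈ closedSquare, ∀ y ∈ closedSquare, dist x y ≤ c * dist (G x) (G y) := by
  have hC : IsCompact (closedSquare ×ˢ closedSquare) :=
    Multipatch.isCompact_closedSquare.prod Multipatch.isCompact_closedSquare
  suffices H : ∃ c : ℝ, 0 ≤ c ∧ ∀ z ∈ closedSquare ×ˢ closedSquare,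
      z ∈ closedSquare ×ˢ closedSquare → dist z.1 z.2 ≤ c * dist (G z.1) (G z.2) by
    obtain ⟨c, hc, h⟩ := H
    exact ⟨c, hc, fun x hx y hy => h (x, y) ⟨hx, hy⟩ ⟨hx, hy⟩⟩
  refine hC.induction_on (p := fun S => ∃ c : ℝ, 0 ≤ c ∧ ∀ z ∈ S,
      z ∈ closedSquare ×ˢ closedSquare → dist z.1 z.2 ≤ c * dist (G z.1) (G z.2)) ?_ ?_ ?_ ?_
  · exact ⟨0, le_rfl, fun _ h => h.elim⟩
  · rintro S T hST ⟨c, hc, h⟩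
    exact ⟨c, hc, fun z hz => h z (hST hz)⟩
  · rintro S T ⟨c, hc, h⟩ ⟨d, hd, h'⟩
    refine ⟨max c d, le_max_of_le_left hc, fun z hz hz' => ?_⟩
    rcases hz with hz | hz
    · exact (h z hz hz').trans (mul_le_mul_of_nonneg_right (le_max_left _ _) dist_nonneg)
    · exact (h' z hz hz').trans (mul_le_mul_of_nonneg_right (le_max_right _ _) dist_nonneg)
  · rintro ⟨x, y⟩ ⟨hx, hy⟩
    simp only at hx hy
    by_cases hxy : x = y
    · subst hxy
      obtain ⟨A, hA⟩ := hG.exists_hasStrictFDerivAt hx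
      obtain ⟨s, hxs, hs, happ⟩ := hA.approximates_deriv_on_open_nhds
      obtain ⟨κ, hanti⟩ : ∃ κ, AntilipschitzWith κ (s.domRestrict G) := ⟨_, happ.antilipschitz (A.subsingleton_or_nnnorm_symm_pos.imp id fun h =>
        NNReal.half_lt_self <| ne_of_gt <| inv_pos.2 h)⟩
      refine ⟨s ×ˢ s, mem_nhdsWithin_of_mem_nhds (prod_mem_nhds (hs.mem_nhds hxs)
        (hs.mem_nhds hxs)), κ, κ.coe_nonneg, fun z hz _ => ?_⟩
      exact hanti.le_mul_dist ⟨z.1, hz.1⟩ ⟨z.2, hz.2⟩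
    · have hd : 0 < dist (G x) (G y) := dist_pos.2 fun h => hxy (hG.injOn hx hy h)
      have hc : ContinuousWithinAt (fun z : (ℝ × ℝ) × (ℝ × ℝ) => dist (G z.1) (G z.2))
          (closedSquare ×ˢ closedSquare) (x, y) :=
        ((hG.continuousOn x hx).comp continuousWithinAt_fst fun z hz => hz.1).dist
          ((hG.continuousOn y hy).comp continuousWithinAt_snd fun z hz => hz.2)
      have hlt : ∀ᶠ z in 𝓝[closedSquare ×ˢ closedSquare] (x, y),
          dist (G x) (G y) / 2 < dist (G z.1) (G z.2) :=
        hc.eventually (lt_mem_nhds (half_lt_self hd))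
      obtain ⟨M, hM⟩ := Metric.isBounded_iff.1 Multipatch.isCompact_closedSquare.isBounded
      have hM0 : 0 ≤ M := dist_nonneg.trans (hM hx hy)
      refine ⟨_, hlt, M / (dist (G x) (G y) / 2), by positivity, fun z hz hz' => ?_⟩
      refine (hM hz'.1 hz'.2).trans ?_
      rw [div_mul_eq_mul_div, le_div_iff₀ (half_pos hd)]
      exact mul_le_mul_of_nonneg_left (le_of_lt hz) hM0

end IsPatchMap

/-! ### Side coordinates -/

namespace Frame

/-- From logical coordinates to side coordinates `(t, d)`. -/
def coords (s : Frame) (x : ℝ × ℝ) : ℝ × ℝ :=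
  if s.swap then (orient s.par x.2, orient s.perp x.1) else (orient s.par x.1, orient s.perp x.2)

lemma pt_coords (s : Frame) (x : ℝ × ℝ) : s.pt (s.coords x) = x := by
  rcases s with ⟨_ | _, _ | _, _ | _⟩ <;> simp [pt, coords, orient]

lemma coords_pt (s : Frame) (x : ℝ × ℝ) : s.coords (s.pt x) = x := by
  rcases s with ⟨_ | _, _ | _, _ | _⟩ <;> simp [pt, coords, orient]

lemma contDiff_pt (s : Frame) : ContDiff ℝ 1 s.pt := by
  change ContDiff ℝ 1 fun x => s.pt x
  rcases s with ⟨_ | _, _ | _, _ | _⟩ <;> simp only [pt, orient, if_true, if_false,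
    Bool.false_eq_true] <;> fun_prop

lemma contDiff_coords (s : Frame) : ContDiff ℝ 1 s.coords := by
  change ContDiff ℝ 1 fun x => s.coords x
  rcases s with ⟨_ | _, _ | _, _ | _⟩ <;> simp only [coords, orient, if_true, if_false,
    Bool.false_eq_true] <;> fun_prop

lemma pt_mem_closedSquare {s : Frame} {x : ℝ × ℝ} (hx : x ∈ closedSquare) :
    s.pt x ∈ closedSquare := by
  obtain ⟨⟨h1, h2⟩, h3, h4⟩ := hx
  rcases s with ⟨_ | _, _ | _, _ | _⟩ <;> refine ⟨⟨?_, ?_⟩, ?_, ?_⟩ <;>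
    simp [pt, orient] <;> assumption

lemma coords_mem_openSquare {s : Frame} {x : ℝ × ℝ} (hx : x ∈ openSquare) :
    s.coords x ∈ openSquare := by
  obtain ⟨⟨h1, h2⟩, h3, h4⟩ := hx
  rcases s with ⟨_ | _, _ | _, _ | _⟩ <;> refine ⟨⟨?_, ?_⟩, ?_, ?_⟩ <;>
    simp [coords, orient] <;> assumption

lemma pt_mem_openSquare {s : Frame} {x : ℝ × ℝ} (hx : x ∈ openSquare) :
    s.pt x ∈ openSquare := by
  obtain ⟨⟨h1, h2⟩, h3, h4⟩ := hx
  rcases s with ⟨_ | _, _ | _, _ | _⟩ <;> refine ⟨⟨?_, ?_⟩, ?_, ?_⟩ <;>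
    simp [pt, orient] <;> assumption

lemma image_pt_openSquare (s : Frame) : s.pt '' openSquare = openSquare := by
  refine Subset.antisymm (image_subset_iff.2 fun x hx => pt_mem_openSquare hx) fun x hx => ?_
  exact ⟨s.coords x, coords_mem_openSquare hx, s.pt_coords x⟩

lemma bijective_fderiv_pt (s : Frame) (x : ℝ × ℝ) : Function.Bijective (fderiv ℝ s.pt x) := by
  have hp : ∀ y, DifferentiableAt ℝ s.pt y := fun y =>
    (s.contDiff_pt.differentiable one_ne_zero) y
  have hc : ∀ y, DifferentiableAt ℝ s.coords y := fun y =>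
    (s.contDiff_coords.differentiable one_ne_zero) y
  have h1 : (fderiv ℝ s.coords (s.pt x)).comp (fderiv ℝ s.pt x) = ContinuousLinearMap.id ℝ _ := by
    rw [← fderiv_comp x (hc _) (hp x), show s.coords ∘ s.pt = id from funext s.coords_pt, fderiv_id]
  have h2 : (fderiv ℝ s.pt x).comp (fderiv ℝ s.coords (s.pt x)) = ContinuousLinearMap.id ℝ _ := by
    have := fderiv_comp (s.pt x) (hp (s.coords (s.pt x))) (hc (s.pt x))
    rw [show s.pt ∘ s.coords = id from funext s.pt_coords, fderiv_id, s.coords_pt] at this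
    exact this.symm
  exact Function.bijective_iff_has_inverse.2 ⟨fderiv ℝ s.coords (s.pt x),
    fun y => DFunLike.congr_fun h1 y, fun y => DFunLike.congr_fun h2 y⟩

lemma side_mem_closedSquare {t : ℝ} (ht : t ∈ Icc (0 : ℝ) 1) : (t, (0 : ℝ)) ∈ closedSquare :=
  ⟨ht, le_rfl, zero_le_one⟩

end Frame

lemma IsPatchMap.comp_pt {G : ℝ × ℝ → Plane} (hG : IsPatchMap G) (s : Frame) :
    IsPatchMap (G ∘ s.pt) where
  smooth x hx := (hG.smooth _ (Frame.pt_mem_closedSquare hx)).comp x s.contDiff_pt.contDiffAt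
  immersive x hx := by
    rw [fderiv_comp x ((hG.smooth _ (Frame.pt_mem_closedSquare hx)).differentiableAt one_ne_zero)
      (s.contDiff_pt.differentiable one_ne_zero x)]
    exact (hG.immersive _ (Frame.pt_mem_closedSquare hx)).comp (s.bijective_fderiv_pt x)
  injOn x hx y hy h := by
    have := hG.injOn (Frame.pt_mem_closedSquare hx) (Frame.pt_mem_closedSquare hy) h
    rw [← s.coords_pt x, this, s.coords_pt]

/-! ### Two patches that share a side -/

/-- If two disjoint patches share the side `{d = 0}`, the functionals that select the tangent cones
at a point of this side are negative multiples of each other. -/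
lemma exists_neg_smul_of_side {G G' : ℝ × ℝ → Plane}
    (hdisj : Disjoint (G '' openSquare) (G' '' openSquare))
    (hmatch : ∀ t ∈ Icc (0 : ℝ) 1, G (t, 0) = G' (t, 0)) {t : ℝ} (ht : t ∈ Ioo (0 : ℝ) 1)
    {A A' : (ℝ × ℝ) ≃L[ℝ] Plane} (hA : HasStrictFDerivAt G (A : ℝ × ℝ →L[ℝ] Plane) (t, 0))
    (hA' : HasStrictFDerivAt G' (A' : ℝ × ℝ →L[ℝ] Plane) (t, 0)) :
    ∃ c : ℝ, c < 0 ∧ ∀ w, (A'.symm w).2 = c * (A.symm w).2 := by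
  -- the tangent vectors along the side agree
  have hτ : A (1, 0) = A' (1, 0) := by
    have hc : HasDerivAt (fun u : ℝ => ((u, 0) : ℝ × ℝ)) (1, 0) t :=
      (hasDerivAt_id t).prodMk (hasDerivAt_const t (0 : ℝ))
    have h1 := HasFDerivAt.comp_hasDerivAt (x := t) (f := fun u : ℝ => ((u, 0) : ℝ × ℝ))
      (l := G) hA.hasFDerivAt hc
    have h2 := HasFDerivAt.comp_hasDerivAt (x := t) (f := fun u : ℝ => ((u, 0) : ℝ × ℝ))
      (l := G') hA'.hasFDerivAt hc
    refine h1.unique (h2.congr_of_eventuallyEq ?_)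
    filter_upwards [isOpen_Ioo.mem_nhds ht] with u hu
    exact hmatch u ⟨hu.1.le, hu.2.le⟩
  have hlin : ∀ w, (A'.symm w).2 = (A'.symm (A (0, 1))).2 * (A.symm w).2 := by
    intro w
    have hw : w = (A.symm w).1 • A' (1, 0) + (A.symm w).2 • A (0, 1) := by
      rw [← hτ, ← map_smul, ← map_smul, ← map_add]
      simp
    conv_lhs => rw [hw]
    rw [map_add, map_smul, map_smul, A'.symm_apply_apply]
    simp [mul_comm]
  refine ⟨(A'.symm (A (0, 1))).2, ?_, hlin⟩
  by_contra! hc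
  rcases hc.eq_or_lt with hc | hc
  · have := hlin (A' (0, 1))
    rw [← hc] at this
    simp at this
  · obtain ⟨g, -, hg⟩ := exists_tangent ht hA
    obtain ⟨g', -, hg'⟩ := exists_tangent ht hA'
    obtain ⟨ε, ⟨h1, h2⟩, h3, h4⟩ := ((hg (A (0, 1)) (by simp)).and (hg' (A (0, 1)) hc)).exists
    rw [← hmatch t ⟨ht.1.le, ht.2.le⟩] at h3 h4
    exact hdisj.le_bot ⟨⟨_, h1, h2⟩, ⟨_, h3, h4⟩⟩

/-- An open set with Lipschitz boundary that contains two disjoint patches with a common side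
contains the interior of that side: at a boundary point an open cone of directions would point out
of the set, but the directions into the two patches are dense. -/
lemma IsPatchMap.side_mem {Ω : Set Plane} (hΩ : HasLipschitzBoundary Ω) {G G' : ℝ × ℝ → Plane}
    (hG : IsPatchMap G) (hG' : IsPatchMap G')
    (hdisj : Disjoint (G '' openSquare) (G' '' openSquare))
    (hmatch : ∀ t ∈ Icc (0 : ℝ) 1, G (t, 0) = G' (t, 0)) (hGΩ : G '' openSquare ⊆ Ω)
    (hGΩ' : G' '' openSquare ⊆ Ω) {t : ℝ} (ht : t ∈ Ioo (0 : ℝ) 1) : G (t, 0) ∈ Ω := by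
  by_contra hX
  have ht' : t ∈ Icc (0 : ℝ) 1 := ⟨ht.1.le, ht.2.le⟩
  have hx := Frame.side_mem_closedSquare ht'
  obtain ⟨A, hA⟩ := hG.exists_hasStrictFDerivAt hx
  obtain ⟨A', hA'⟩ := hG'.exists_hasStrictFDerivAt hx
  obtain ⟨c, hc, hAA'⟩ := exists_neg_smul_of_side hdisj hmatch ht hA hA'
  have hfr : G (t, 0) ∈ frontier Ω := by
    refine ⟨closure_mono hGΩ ?_, fun h => hX (interior_subset h)⟩
    rw [hG.closure_image]
    exact mem_image_of_mem _ hx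
  obtain ⟨T, L, f, δ, hδ, hf, hT⟩ := hΩ _ hfr
  set X := G (t, 0)
  -- every direction off the tangent line points into `Ω`
  have hin : ∀ w, (A.symm w).2 ≠ 0 → ∀ᶠ ε : ℝ in 𝓝[>] 0, X + ε • w ∈ Ω := by
    intro w hw
    rcases lt_or_gt_of_ne hw with hw | hw
    · obtain ⟨g, -, hg⟩ := exists_tangent ht hA'
      filter_upwards [hg w (by rw [hAA']; exact mul_pos_of_neg_of_neg hc hw)] with ε hε
      rw [← hmatch t ht'] at hε
      exact hGΩ' ⟨_, hε.1, hε.2⟩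
    · obtain ⟨g, -, hg⟩ := exists_tangent ht hA
      filter_upwards [hg w hw] with ε hε
      exact hGΩ ⟨_, hε.1, hε.2⟩
  -- the cone of directions below the graph
  have hout : ∀ w, L * |T w 0| < - T w 1 → ¬ ∀ᶠ ε : ℝ in 𝓝[>] 0, X + ε • w ∈ Ω := by
    intro w hw hev
    have hball : ∀ᶠ ε : ℝ in 𝓝[>] 0, X + ε • w ∈ Metric.ball X δ := by
      have : ContinuousAt (fun ε : ℝ => X + ε • w) 0 := by fun_prop
      have h := this.tendsto
      rw [zero_smul, add_zero] at h
      exact (h.mono_left nhdsWithin_le_nhds).eventually (Metric.ball_mem_nhds X hδ)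
    obtain ⟨ε, h1, h2, h3⟩ := (hev.and (hball.and self_mem_nhdsWithin)).exists
    have h3 : (0 : ℝ) < ε := h3
    have h4 := (hT _ h2).1 h1
    have h5 : ¬ f (T X 0) < T X 1 := fun h => hX ((hT X (Metric.mem_ball_self hδ)).2 h)
    have h6 := hf.dist_le_mul (T X 0) (T (X + ε • w) 0)
    simp only [map_add, map_smul, PiLp.add_apply, PiLp.smul_apply, smul_eq_mul,
      Real.dist_eq] at h4 h6
    rw [show T X 0 - (T X 0 + ε * T w 0) = -(ε * T w 0) by ring, abs_neg, abs_mul,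
      abs_of_pos h3] at h6
    have h7 := (abs_le.1 h6).2
    have h8 := mul_lt_mul_of_pos_left hw h3
    nlinarith
  -- some direction of this open cone is off the tangent line
  set w₀ : Plane := T.symm (EuclideanSpace.single 1 (-1)) with hw₀
  have hopen : ∀ᶠ η : ℝ in 𝓝[≠] 0, L * |T (w₀ + η • A (0, 1)) 0| < - T (w₀ + η • A (0, 1)) 1 := by
    have hcont : ContinuousAt (fun η : ℝ => - T (w₀ + η • A (0, 1)) 1
        - L * |T (w₀ + η • A (0, 1)) 0|) 0 := by
      refine Continuous.continuousAt ?_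
      have h : ∀ i : Fin 2, Continuous fun η : ℝ => T (w₀ + η • A (0, 1)) i := fun i => by
        simp only [map_add, map_smul, PiLp.add_apply, PiLp.smul_apply, smul_eq_mul]
        fun_prop
      exact (h 1).neg.sub (continuous_const.mul (h 0).abs)
    have h0 : (0 : ℝ) < - T (w₀ + (0 : ℝ) • A (0, 1)) 1 - L * |T (w₀ + (0 : ℝ) • A (0, 1)) 0| := by
      rw [zero_smul, add_zero, hw₀, T.apply_symm_apply]
      simp
    filter_upwards [nhdsWithin_le_nhds (hcont.eventually (lt_mem_nhds h0))] with η hη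
    linarith
  have hne : ∀ᶠ η : ℝ in 𝓝[≠] 0, (A.symm (w₀ + η • A (0, 1))).2 ≠ 0 := by
    have h1 : ∀ η : ℝ, (A.symm (w₀ + η • A (0, 1))).2 = (A.symm w₀).2 + η := fun η => by
      rw [map_add, map_smul, A.symm_apply_apply]
      simp
    simp only [h1]
    by_cases h2 : (A.symm w₀).2 = 0
    · filter_upwards [self_mem_nhdsWithin] with η hη
      rwa [h2, zero_add]
    · have : ContinuousAt (fun η : ℝ => (A.symm w₀).2 + η) 0 := by fun_prop
      exact nhdsWithin_le_nhds (this.eventually_ne (by rwa [add_zero]))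
  obtain ⟨η, h1, h2⟩ := (hopen.and hne).exists
  exact hout _ h1 (hin _ h2)

namespace Multipatch

variable {p K : ℕ} (D : Multipatch p K)

/-! ### Geometry of the multipatch domain -/

lemma isPatchMap (k : Fin K) : IsPatchMap (D.F k) where
  smooth := D.smooth k
  immersive := D.immersive k
  injOn := D.injOn k

lemma closure_patch (k : Fin K) : closure (D.patch k) = D.F k '' closedSquare :=
  (D.isPatchMap k).closure_image

lemma isOpen_patch (k : Fin K) : IsOpen (D.patch k) := (D.isPatchMap k).isOpen_image

lemma isOpen_Omega : IsOpen D.Ω := isOpen_interior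

lemma patch_subset_Omega (k : Fin K) : D.patch k ⊆ D.Ω :=
  interior_maximal (subset_closure.trans (subset_iUnion (fun k => closure (D.patch k)) k))
    (D.isOpen_patch k)

lemma Omega_subset : D.Ω ⊆ ⋃ k, D.F k '' closedSquare := by
  refine interior_subset.trans (iUnion_mono fun k => ?_)
  rw [D.closure_patch]

lemma isCompact_iUnion_image : IsCompact (⋃ k, D.F k '' closedSquare) :=
  isCompact_iUnion fun k => (D.isPatchMap k).isCompact_image

lemma pt_mem_closedSquare (c : Corner) : c.pt ∈ closedSquare := by
  rcases c with ⟨_ | _, _ | _⟩ <;> simp [Corner.pt, orient, closedSquare]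

lemma image_comp_pt (k : Fin K) (s : Frame) : (D.F k ∘ s.pt) '' openSquare = D.patch k := by
  rw [image_comp, s.image_pt_openSquare]
  rfl

lemma disjoint_comp_pt {k l : Fin K} (hkl : k ≠ l) (s s' : Frame) :
    Disjoint ((D.F k ∘ s.pt) '' openSquare) ((D.F l ∘ s'.pt) '' openSquare) := by
  rw [image_comp_pt, image_comp_pt]
  exact D.disjoint k l hkl

/-- The geometric conformity in terms of the images of the closed reference square. -/
lemma conforming' {k l : Fin K} (hkl : k ≠ l) {x y : ℝ × ℝ} (hx : x ∈ closedSquare)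
    (hy : y ∈ closedSquare) (hxy : D.F k x = D.F l y) :
    (∃ c d : Corner, x = c.pt ∧ y = d.pt ∧ F D k '' closedSquare ∩ F D l '' closedSquare
        = {D.F k x}) ∨
      ∃ s s' : Frame, (∀ t ∈ Icc (0 : ℝ) 1, D.F k (s.pt (t, 0)) = D.F l (s'.pt (t, 0))) ∧
        ∃ t ∈ Icc (0 : ℝ) 1, x = s.pt (t, 0) ∧ y = s'.pt (t, 0) := by
  have hmem : D.F k x ∈ F D k '' closedSquare ∩ F D l '' closedSquare :=
    ⟨mem_image_of_mem _ hx, y, hy, hxy.symm⟩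
  have h := D.conforming k l hkl
  rw [show closure (F D k '' openSquare) = _ from D.closure_patch k,
    show closure (F D l '' openSquare) = _ from D.closure_patch l] at h
  rcases h with h | ⟨c, d, hcd, h⟩ | ⟨s, s', hss, h⟩
  · rw [h] at hmem
    exact hmem.elim
  · left
    have h1 : D.F k x = D.F k c.pt := by rw [h] at hmem; exact hmem
    exact ⟨c, d, D.injOn k hx (pt_mem_closedSquare c) h1,
      D.injOn l hy (pt_mem_closedSquare d) (by rw [← hxy, h1, hcd]), by rw [h, h1]⟩
  · right
    rw [h] at hmem
    obtain ⟨t, ht, h1⟩ := hmem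
    simp only at h1
    have hs := Frame.side_mem_closedSquare ht
    exact ⟨s, s', hss, t, ht, D.injOn k hx (Frame.pt_mem_closedSquare hs) h1.symm,
      D.injOn l hy (Frame.pt_mem_closedSquare hs) (by rw [← hxy, ← h1, hss t ht])⟩

lemma side_mem_Omega {k l : Fin K} (hkl : k ≠ l) {s s' : Frame}
    (h : ∀ t ∈ Icc (0 : ℝ) 1, D.F k (s.pt (t, 0)) = D.F l (s'.pt (t, 0))) {t : ℝ}
    (ht : t ∈ Ioo (0 : ℝ) 1) : D.F k (s.pt (t, 0)) ∈ D.Ω :=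
  IsPatchMap.side_mem D.lipschitz ((D.isPatchMap k).comp_pt s) ((D.isPatchMap l).comp_pt s')
    (D.disjoint_comp_pt hkl s s') h
    (by rw [image_comp_pt]; exact D.patch_subset_Omega k)
    (by rw [image_comp_pt]; exact D.patch_subset_Omega l) ht

/-- No third patch has an interior edge as a side: its tangent cone at a point of the edge would
have to avoid the dense union of the tangent cones of the two patches of the interface. -/
lemma Interface.eq_or_eq {D : Multipatch p K} {e : Set Plane} (I : D.Interface e) {k : Fin K}
    {s : Frame} (hks : sideImage (D.F k) s = e) : k = I.km ∨ k = I.kp := by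
  by_contra! hk
  have hmeas : ∀ t : ℝ, t ∈ Icc (0 : ℝ) 1 → D.F I.km (I.sm.pt (t, 0)) ∈ sideImage (D.F k) s := by
    intro t ht
    exact hks.symm.subset (I.image_eq.subset ⟨t, ht, rfl⟩)
  -- a point of the edge that is no end point for the third patch
  obtain ⟨t, ht, u, hu, htu⟩ : ∃ t ∈ Ioo (0 : ℝ) 1, ∃ u ∈ Ioo (0 : ℝ) 1,
      D.F I.km (I.sm.pt (t, 0)) = D.F k (s.pt (u, 0)) := by
    by_contra! hno
    have hend : ∀ t ∈ Ioo (0 : ℝ) 1, D.F I.km (I.sm.pt (t, 0)) = D.F k (s.pt (0, 0)) ∨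
        D.F I.km (I.sm.pt (t, 0)) = D.F k (s.pt (1, 0)) := by
      intro t ht
      obtain ⟨u, hu, h⟩ := hmeas t ⟨ht.1.le, ht.2.le⟩
      simp only at h
      rcases hu.1.eq_or_lt with h0 | h0
      · left; rw [← h, ← h0]
      rcases hu.2.eq_or_lt with h1 | h1
      · right; rw [← h, h1]
      exact absurd h.symm (hno t ht u ⟨h0, h1⟩)
    have hinj : InjOn (fun t : ℝ => D.F I.km (I.sm.pt (t, 0))) (Ioo 0 1) := by
      intro t ht t' ht' h
      have := ((D.isPatchMap I.km).comp_pt I.sm).injOn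
        (Frame.side_mem_closedSquare ⟨ht.1.le, ht.2.le⟩)
        (Frame.side_mem_closedSquare ⟨ht'.1.le, ht'.2.le⟩) h
      exact congrArg Prod.fst this
    have hfin : ((fun t : ℝ => D.F I.km (I.sm.pt (t, 0))) '' Ioo 0 1).Finite := by
      refine (Set.toFinite {D.F k (s.pt (0, 0)), D.F k (s.pt (1, 0))}).subset ?_
      rintro _ ⟨t, ht, rfl⟩
      exact hend t ht
    exact (Ioo_infinite (zero_lt_one (α := ℝ))) (hfin.of_finite_image hinj)
  have ht' : t ∈ Icc (0 : ℝ) 1 := ⟨ht.1.le, ht.2.le⟩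
  have hmem := Frame.side_mem_closedSquare ht'
  have hG := (D.isPatchMap I.km).comp_pt I.sm
  have hG' := (D.isPatchMap I.kp).comp_pt I.sp
  have hG'' := (D.isPatchMap k).comp_pt s
  obtain ⟨A, hA⟩ := hG.exists_hasStrictFDerivAt hmem
  obtain ⟨A', hA'⟩ := hG'.exists_hasStrictFDerivAt hmem
  obtain ⟨B, hB⟩ := hG''.exists_hasStrictFDerivAt
    (Frame.side_mem_closedSquare ⟨hu.1.le, hu.2.le⟩)
  obtain ⟨c, hc, hAA'⟩ := exists_neg_smul_of_side (D.disjoint_comp_pt I.ne I.sm I.sp) I.matching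
    ht hA hA'
  obtain ⟨g, -, hg⟩ := exists_tangent ht hA
  obtain ⟨g', -, hg'⟩ := exists_tangent ht hA'
  obtain ⟨g'', -, hg''⟩ := exists_tangent hu hB
  -- a direction into the third patch off the tangent line of the edge
  obtain ⟨w, hw, hw'⟩ : ∃ w, 0 < (B.symm w).2 ∧ (A.symm w).2 ≠ 0 := by
    by_cases h0 : (A.symm (B (0, 1))).2 = 0
    · have hcont : ContinuousAt (fun η : ℝ => (B.symm (B (0, 1) + η • A (0, 1))).2) 0 := by
        fun_prop
      have h1 : (0 : ℝ) < (B.symm (B (0, 1) + (0 : ℝ) • A (0, 1))).2 := by simp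
      have h1' : ∀ᶠ η : ℝ in 𝓝[≠] 0, 0 < (B.symm (B (0, 1) + η • A (0, 1))).2 :=
        nhdsWithin_le_nhds (hcont.eventually (lt_mem_nhds h1))
      obtain ⟨η, h2, h3⟩ := (h1'.and self_mem_nhdsWithin).exists
      refine ⟨_, h2, ?_⟩
      rw [map_add, map_smul, A.symm_apply_apply]
      simpa [h0] using h3
    · exact ⟨B (0, 1), by simp, h0⟩
  rcases lt_or_gt_of_ne hw' with h | h
  · obtain ⟨ε, ⟨h1, h2⟩, h3, h4⟩ := ((hg'' w hw).and (hg' w (by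
      rw [hAA']; exact mul_pos_of_neg_of_neg hc h))).exists
    have hX : (D.F I.kp ∘ I.sp.pt) (t, 0) = (D.F k ∘ s.pt) (u, 0) :=
      (I.matching t ht').symm.trans htu
    rw [hX] at h3 h4
    exact (D.disjoint_comp_pt hk.2 s I.sp).le_bot ⟨⟨_, h1, h2⟩, ⟨_, h3, h4⟩⟩
  · obtain ⟨ε, ⟨h1, h2⟩, h3, h4⟩ := ((hg'' w hw).and (hg w h)).exists
    have hX : (D.F I.km ∘ I.sm.pt) (t, 0) = (D.F k ∘ s.pt) (u, 0) := htu
    rw [hX] at h3 h4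
    exact (D.disjoint_comp_pt hk.1 s I.sm).le_bot ⟨⟨_, h1, h2⟩, ⟨_, h3, h4⟩⟩

/-! ### Pullbacks to the closed reference square -/

/-- The pullback of a broken spline to the closed reference square of the patch `k`. -/
def value (φ : D.Vpw) (k : Fin K) (x : ℝ × ℝ) : ℝ :=
  ∑ i, D.basis.repr φ ⟨k, i⟩ * D.logicalFun k i x

lemma apply_F (φ : D.Vpw) (k : Fin K) {x : ℝ × ℝ} (hx : x ∈ openSquare) :
    (φ : Plane → ℝ) (D.F k x) = D.value φ k x :=
  D.apply_F_eq_sum φ k hx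

lemma continuousOn_value (hp : 1 ≤ p) (φ : D.Vpw) (k : Fin K) :
    ContinuousOn (D.value φ k) closedSquare :=
  continuousOn_finsetSum _ fun i _ => continuousOn_const.mul (D.continuousOn_logicalFun hp k i)

lemma apply_eq_zero (φ : D.Vpw) {x : Plane} (hx : x ∉ D.Ω) : (φ : Plane → ℝ) x = 0 := by
  refine φ.2.1 x fun h => hx ?_
  obtain ⟨k, hk⟩ := mem_iUnion.1 h
  exact D.patch_subset_Omega k hk

lemma bounded_apply (hp : 1 ≤ p) (φ : D.Vpw) : ∃ M, ∀ x, |(φ : Plane → ℝ) x| ≤ M := by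
  have h : ∀ k, ∃ M, ∀ x ∈ closedSquare, |D.value φ k x| ≤ M := fun k =>
    isCompact_closedSquare.exists_bound_of_continuousOn (D.continuousOn_value hp φ k)
  choose M hM using h
  have hM0 : ∀ k, 0 ≤ M k := fun k =>
    (abs_nonneg _).trans (hM k (0, 0) (by simp [closedSquare]))
  refine ⟨∑ k, M k, fun x => ?_⟩
  by_cases hx : x ∈ ⋃ k, D.patch k
  · obtain ⟨k, y, hy, rfl⟩ := mem_iUnion.1 hx
    rw [D.apply_F φ k hy]
    exact (hM k y (openSquare_subset hy)).trans
      (Finset.single_le_sum (fun k _ => hM0 k) (Finset.mem_univ k))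
  · rw [φ.2.1 x hx, abs_zero]
    exact Finset.sum_nonneg fun k _ => hM0 k

lemma logicalFun_pt (k : Fin K) (s : Frame) (i : Fin (D.n k + 1) × Fin (D.n k + 1))
    (x : ℝ × ℝ) : D.logicalFun k (s.index i) (s.pt x)
      = (D.knots k).lam s.par i.1 x.1 * (D.knots k).lam s.perp i.2 x.2 := by
  rcases s with ⟨_ | _, a, b⟩
  · rfl
  · exact mul_comm _ _

/-- On a side, the pullback is the trace. -/
lemma value_side (φ : D.Vpw) (k : Fin K) (s : Frame) (t : ℝ) :
    D.value φ k (s.pt (t, 0)) = (D.trace k s φ : ℝ → ℝ) t := by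
  have hbij : Function.Bijective (s.index (n := D.n k)) :=
    Function.bijective_iff_has_inverse.2 ⟨s.localIndex, s.localIndex_index, s.index_localIndex⟩
  rw [Knots.coe_eq_sum, value, ← Function.Bijective.sum_comp hbij, Fintype.sum_prod_type]
  refine Finset.sum_congr rfl fun i _ => ?_
  rw [repr_trace, Finset.sum_eq_single 0]
  · rw [logicalFun_pt, Knots.lam_at_zero]
    simp
  · intro m _ hm
    rw [logicalFun_pt, Knots.lam_at_zero, if_neg hm]
    simp
  · simp

lemma value_corner (φ : D.Vpw) (k : Fin K) (c : Corner) :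
    D.value φ k c.pt = D.basis.repr φ (D.cornerIdx (k, c)) := by
  set s : Frame := ⟨false, c.1, c.2⟩ with hs
  have hc : s.corner true = c := by
    obtain ⟨a, b⟩ := c
    simp [hs, Frame.corner]
  have h := D.repr_trace_end k s φ true
  rw [hc] at h
  rw [← h, ← hc, Frame.corner_pt, value_side]
  exact (Knots.repr_zero_eq _ _ _).symm

lemma vertexConforming_iff (φ : D.Vpw) : φ ∈ D.vertexConforming ↔
    ∀ (k l : Fin K) (c d : Corner), D.F k c.pt = D.F l d.pt →
      D.value φ k c.pt = D.value φ l d.pt := by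
  simp only [value_corner]
  exact ⟨fun h k l c d => h (k, c) (l, d), fun h b b' => h b.1 b'.1 b.2 b'.2⟩

lemma tracesMatch_iff (I : ∀ e, D.IsInterior e → D.Interface e) (φ : D.Vpw) :
    D.TracesMatch I φ ↔ ∀ e he, ∀ t ∈ Ioo (0 : ℝ) 1,
      D.value φ (I e he).km ((I e he).sm.pt (t, 0))
        = D.value φ (I e he).kp ((I e he).sp.pt (t, 0)) := by
  simp only [value_side]
  refine forall_congr' fun e => forall_congr' fun he => ⟨fun h t _ => ?_, fun h => ?_⟩
  · rw [h]; rfl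
  · exact Knots.eq_of_eqOn_Ioo _ _ _ _ fun t ht => (h t ht).symm

/-- A vertex-conforming spline with matching traces takes the same value from any two patches: they
meet in a vertex or along an edge, and in the latter case they are the two patches of the
interface. -/
lemma value_eq_of_tracesMatch {I : ∀ e, D.IsInterior e → D.Interface e} {φ : D.Vpw}
    (hW : φ ∈ D.vertexConforming) (hT : D.TracesMatch I φ) {k l : Fin K} {x y : ℝ × ℝ}
    (hx : x ∈ closedSquare) (hy : y ∈ closedSquare) (hxy : D.F k x = D.F l y) :
    D.value φ k x = D.value φ l y := by
  by_cases hkl : k = l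
  · subst hkl
    rw [D.injOn k hx hy hxy]
  rcases D.conforming' hkl hx hy hxy with ⟨c, d, rfl, rfl, -⟩ | ⟨s, s', hss, t, ht, hxt, hyt⟩
  · exact (D.vertexConforming_iff φ).1 hW k l c d hxy
  · have hs' : sideImage (D.F l) s' = sideImage (D.F k) s :=
      Set.image_congr fun t ht => (hss t ht).symm
    have he : D.IsInterior (sideImage (D.F k) s) := ⟨k, l, hkl, s, s', rfl, hs'⟩
    set J := I _ he
    -- the common value along the edge of the interface
    obtain ⟨u, hu, hJu⟩ : D.F k x ∈ sideImage (D.F J.km) J.sm := by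
      rw [J.image_eq, hxt]
      exact ⟨t, ht, rfl⟩
    simp only at hJu
    have hus := Frame.side_mem_closedSquare hu
    have hval : D.value φ J.km (J.sm.pt (u, 0)) = D.value φ J.kp (J.sp.pt (u, 0)) := by
      rw [value_side, value_side, show D.trace J.kp J.sp φ = J.ext (J.trM φ) from hT _ he]
      rfl
    have key : ∀ m (z : ℝ × ℝ), (m = J.km ∨ m = J.kp) → z ∈ closedSquare → D.F m z = D.F k x →
        D.value φ m z = D.value φ J.km (J.sm.pt (u, 0)) := by
      rintro m z (rfl | rfl) hz h
      · rw [D.injOn _ hz (Frame.pt_mem_closedSquare hus) (h.trans hJu.symm)]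
      · rw [hval, D.injOn _ hz (Frame.pt_mem_closedSquare hus)
          ((h.trans hJu.symm).trans (J.matching u hu))]
    rw [key k x (J.eq_or_eq rfl) hx rfl, key l y (J.eq_or_eq hs') hy hxy.symm]

end Multipatch

/-! ### Blow-up of a Sobolev function at a point -/

/-- Weak derivatives in arbitrary directions. -/
lemma exists_weak_directional {Ω : Set Plane} {v : Plane → ℝ} (hv : v ∈ H1 Ω) (w : Plane) :
    ∃ g, MemLp g 2 (volume.restrict Ω) ∧ ∀ ψ : Plane → ℝ, ContDiff ℝ ∞ ψ → HasCompactSupport ψ →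
      tsupport ψ ⊆ Ω → ∫ x in Ω, v x * fderiv ℝ ψ x w = - ∫ x in Ω, g x * ψ x := by
  obtain ⟨hv2, h⟩ := hv
  obtain ⟨g0, hg0, h0⟩ := h 0
  obtain ⟨g1, hg1, h1⟩ := h 1
  refine ⟨w 0 • g0 + w 1 • g1, (hg0.const_smul _).add (hg1.const_smul _), fun ψ a b c => ?_⟩
  have hw : w = w 0 • EuclideanSpace.single 0 1 + w 1 • EuclideanSpace.single 1 1 := by
    ext i
    fin_cases i <;> simp
  have e1 : ∀ x, v x * fderiv ℝ ψ x w
      = w 0 * (v x * fderiv ℝ ψ x (EuclideanSpace.single 0 1))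
        + w 1 * (v x * fderiv ℝ ψ x (EuclideanSpace.single 1 1)) := fun x => by
    conv_lhs => rw [hw]
    rw [map_add, map_smul, map_smul, smul_eq_mul, smul_eq_mul]
    ring
  have e2 : ∀ x, (w 0 • g0 + w 1 • g1) x * ψ x = w 0 * (g0 x * ψ x) + w 1 * (g1 x * ψ x) :=
    fun x => by simp; ring
  simp only [e1, e2]
  rw [integral_add ((integrable_mul_fderiv 0 hv2 a b).const_mul _)
      ((integrable_mul_fderiv 1 hv2 a b).const_mul _),
    integral_add ((integrable_mul_test hg0 a.continuous b).const_mul _)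
      ((integrable_mul_test hg1 a.continuous b).const_mul _)]
  simp only [integral_const_mul]
  rw [h0 ψ a b c, h1 ψ a b c]
  ring

section Blowup

variable {ψ : Plane → ℝ} (X w : Plane)

lemma fderiv_rescale {ε : ℝ} (hε : 0 < ε) (hψ : ContDiff ℝ ∞ ψ) (y : Plane) :
    fderiv ℝ (fun x => ψ (ε⁻¹ • (x - X))) (X + ε • y) w = ε⁻¹ * fderiv ℝ ψ y w := by
  have hd : HasFDerivAt (fun x : Plane => ε⁻¹ • (x - X)) (ε⁻¹ • ContinuousLinearMap.id ℝ Plane)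
      (X + ε • y) := ((hasFDerivAt_id _).sub_const X).const_smul ε⁻¹
  have hy : ε⁻¹ • (X + ε • y - X) = y := by
    rw [add_sub_cancel_left, smul_smul, inv_mul_cancel₀ hε.ne', one_smul]
  have hψ' : HasFDerivAt ψ (fderiv ℝ ψ y) (ε⁻¹ • (X + ε • y - X)) := by
    rw [hy]
    exact ((hψ.differentiable (by simp)) y).hasFDerivAt
  have := (HasFDerivAt.comp (f := fun x : Plane => ε⁻¹ • (x - X)) (X + ε • y) hψ' hd).fderiv
  rw [show (fun x => ψ (ε⁻¹ • (x - X))) = ψ ∘ fun x : Plane => ε⁻¹ • (x - X) from rfl, this]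
  simp

lemma contDiff_rescale (ε : ℝ) (hψ : ContDiff ℝ ∞ ψ) :
    ContDiff ℝ ∞ fun x => ψ (ε⁻¹ • (x - X)) :=
  hψ.comp ((contDiff_id.sub contDiff_const).const_smul _)

lemma rescale_eq_zero {R ε : ℝ} (hR : tsupport ψ ⊆ Metric.closedBall 0 R) (hε : 0 < ε) {x : Plane}
    (hx : x ∉ Metric.closedBall X (ε * R)) : ψ (ε⁻¹ • (x - X)) = 0 := by
  refine image_eq_zero_of_notMem_tsupport fun h => hx ?_
  have := hR h
  rw [mem_closedBall_zero_iff, norm_smul, norm_inv, Real.norm_of_nonneg hε.le,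
    inv_mul_le_iff₀ hε] at this
  rwa [Metric.mem_closedBall, dist_eq_norm]

lemma integrable_rescale {v : Plane → ℝ} (hv : MemLp v 2 volume) (hψ : ContDiff ℝ ∞ ψ)
    (hc : HasCompactSupport ψ) {ε : ℝ} (hε : 0 < ε) :
    Integrable (fun y => v (X + ε • y) * fderiv ℝ ψ y w) := by
  obtain ⟨R, hR⟩ := hc.isCompact.isBounded.subset_closedBall 0
  have hcs : HasCompactSupport fun x => ψ (ε⁻¹ • (x - X)) :=
    HasCompactSupport.intro (isCompact_closedBall X (ε * R)) fun x hx =>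
      rescale_eq_zero X hR hε hx
  have h1 : Integrable (fun x => v x * fderiv ℝ (fun x => ψ (ε⁻¹ • (x - X))) x w) := by
    refine MemLp.integrable_mul (p := 2) (q := 2) hv (Continuous.memLp_of_hasCompactSupport ?_ ?_)
    · exact ((contDiff_rescale X ε hψ).continuous_fderiv (by simp)).clm_apply continuous_const
    · exact hcs.fderiv_apply (𝕜 := ℝ) _
  have h2 := ((h1.comp_add_left X).comp_smul hε.ne').const_mul ε
  refine h2.congr (Eventually.of_forall fun y => ?_)
  simp only
  rw [fderiv_rescale X w hε hψ]
  field_simp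

lemma integral_rescale (v : Plane → ℝ) (hψ : ContDiff ℝ ∞ ψ) {ε : ℝ} (hε : 0 < ε) :
    ∫ y, v (X + ε • y) * fderiv ℝ ψ y w
      = ε⁻¹ * ∫ x, v x * fderiv ℝ (fun x => ψ (ε⁻¹ • (x - X))) x w := by
  set h : Plane → ℝ := fun x => v x * fderiv ℝ (fun x => ψ (ε⁻¹ • (x - X))) x w with hh
  have h1 : ∫ y, h (X + ε • y) = (ε ^ 2)⁻¹ * ∫ x, h x := by
    have := Measure.integral_comp_smul_of_nonneg volume (fun y => h (X + y)) ε (hR := hε.le)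
    rw [this, integral_add_left_eq_self (μ := (volume : Measure Plane)) h X]
    simp
  have h2 : ∀ y, v (X + ε • y) * fderiv ℝ ψ y w = ε * h (X + ε • y) := fun y => by
    simp only [hh]
    rw [fderiv_rescale X w hε hψ]
    field_simp
  simp only [h2]
  rw [integral_const_mul, h1]
  field_simp

/-- The integrals of a Sobolev function against the derivatives of a test function that is
concentrated near a point are small compared to the scaling of traces: by the weak derivative, they
are controlled by the mass of the gradient in a small disc. -/
lemma tendsto_blowup {Ω : Set Plane} (hΩ : IsOpen Ω) {v : Plane → ℝ} (hv : v ∈ H1 Ω)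
    (hv0 : ∀ x ∉ Ω, v x = 0) {X : Plane} (hX : X ∈ Ω) (w : Plane) (hψ : ContDiff ℝ ∞ ψ)
    (hc : HasCompactSupport ψ) :
    Tendsto (fun ε : ℝ => ∫ y, v (X + ε • y) * fderiv ℝ ψ y w) (𝓝[>] 0) (𝓝 0) := by
  obtain ⟨g, hg, hweak⟩ := exists_weak_directional hv w
  obtain ⟨R, hR⟩ := hc.isCompact.isBounded.subset_closedBall 0
  obtain ⟨M, hM⟩ := hc.exists_bound_of_continuous hψ.continuous
  have hM0 : 0 ≤ M := (norm_nonneg _).trans (hM 0)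
  obtain ⟨δ, hδ, hball⟩ := Metric.isOpen_iff.1 hΩ X hX
  set g' := Ω.indicator g with hg'
  have hg2 : MemLp g' 2 volume := (memLp_indicator_iff_restrict hΩ.measurableSet).2 hg
  have hsq : Integrable (fun x => g' x ^ 2) volume := hg2.integrable_sq
  set B : ℝ → Set Plane := fun ε => Metric.closedBall X (ε * R) with hB
  set V : ℝ := volume.real (Metric.closedBall (0 : Plane) R) with hV
  have hV0 : 0 ≤ V := measureReal_nonneg
  have hvol : ∀ ε : ℝ, 0 < ε → volume.real (B ε) = ε ^ 2 * V := by
    intro ε hε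
    have := Measure.addHaar_closedBall_mul_of_pos (volume : Measure Plane) X hε R
    rw [Measure.real, hB]
    simp only
    rw [this, ENNReal.toReal_mul, ENNReal.toReal_ofReal (by positivity)]
    simp [hV, Measure.real]
  have hεR : Tendsto (fun ε : ℝ => ε * R) (𝓝[>] 0) (𝓝 0) := by
    have : Tendsto (fun ε : ℝ => ε * R) (𝓝 0) (𝓝 (0 * R)) := tendsto_id.mul_const R
    rw [zero_mul] at this
    exact this.mono_left nhdsWithin_le_nhds
  -- the mass of the gradient in small discs tends to zero
  have hS : Tendsto (fun ε => ∫ x in B ε, g' x ^ 2) (𝓝[>] 0) (𝓝 0) := by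
    refine hsq.2.tendsto_setIntegral_nhds_zero ?_
    have h1 : Tendsto (fun ε : ℝ => ENNReal.ofReal (ε ^ 2 * V)) (𝓝[>] 0) (𝓝 0) := by
      have : Tendsto (fun ε : ℝ => ENNReal.ofReal (ε ^ 2 * V)) (𝓝 0)
          (𝓝 (ENNReal.ofReal ((0 : ℝ) ^ 2 * V))) := by
        refine (ENNReal.continuous_ofReal.tendsto _).comp ?_
        exact Continuous.tendsto (by fun_prop) 0
      simp only [ne_eq, OfNat.ofNat_ne_zero, not_false_eq_true, zero_pow, zero_mul,
        ENNReal.ofReal_zero] at this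
      exact this.mono_left nhdsWithin_le_nhds
    refine h1.congr' ?_
    filter_upwards [self_mem_nhdsWithin] with ε hε
    rw [← hvol ε hε, Measure.real, Function.comp_apply, ENNReal.ofReal_toReal]
    exact (isCompact_closedBall X (ε * R)).measure_lt_top.ne
  -- the basic estimate, with a parameter
  have hest : ∀ η : ℝ, 0 < η → ∀ᶠ ε : ℝ in 𝓝[>] 0, ‖∫ y, v (X + ε • y) * fderiv ℝ ψ y w‖
      ≤ M / 2 * (η⁻¹ * (∫ x in B ε, g' x ^ 2) + η * V) := by
    intro η hη
    filter_upwards [self_mem_nhdsWithin, hεR.eventually (gt_mem_nhds hδ)] with ε hε hεδ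
    have hε : (0 : ℝ) < ε := hε
    have hBΩ : B ε ⊆ Ω := (Metric.closedBall_subset_ball hεδ).trans hball
    have hsupp : tsupport (fun x => ψ (ε⁻¹ • (x - X))) ⊆ B ε :=
      closure_minimal (fun x hx => by
        by_contra h
        exact hx (rescale_eq_zero X hR hε h)) Metric.isClosed_closedBall
    have hcs : HasCompactSupport fun x => ψ (ε⁻¹ • (x - X)) :=
      HasCompactSupport.intro (isCompact_closedBall X (ε * R)) fun x hx =>
        rescale_eq_zero X hR hε hx
    have h1 := hweak _ (contDiff_rescale X ε hψ) hcs (hsupp.trans hBΩ)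
    rw [setIntegral_eq_integral_of_forall_compl_eq_zero
      (fun x hx => by rw [hv0 x hx, zero_mul])] at h1
    have h2 : ∫ x in Ω, g x * ψ (ε⁻¹ • (x - X)) = ∫ x in B ε, g' x * ψ (ε⁻¹ • (x - X)) := by
      rw [setIntegral_eq_of_subset_of_forall_sdiff_eq_zero hΩ.measurableSet hBΩ]
      · refine setIntegral_congr_fun measurableSet_closedBall fun x hx => ?_
        simp only [hg', indicator_of_mem (hBΩ hx)]
      · intro x hx
        rw [rescale_eq_zero X hR hε hx.2, mul_zero]
    rw [integral_rescale X w v hψ hε, h1, h2, mul_neg, norm_neg, ← integral_const_mul]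
    have hBfin : volume (B ε) ≠ ⊤ := (isCompact_closedBall X (ε * R)).measure_lt_top.ne
    have hint : IntegrableOn (fun x => M / 2 * (η⁻¹ * g' x ^ 2 + η * (ε ^ 2)⁻¹)) (B ε) :=
      ((hsq.integrableOn.const_mul _).add (integrableOn_const hBfin)).const_mul _
    refine (norm_integral_le_of_norm_le hint (Eventually.of_forall fun x => ?_)).trans_eq ?_
    · rw [norm_mul, norm_mul, norm_inv, Real.norm_of_nonneg hε.le]
      -- Young's inequality
      have h3 : ε⁻¹ * ‖g' x‖ ≤ 1 / 2 * (η⁻¹ * g' x ^ 2 + η * (ε ^ 2)⁻¹) := by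
        have h4 : 0 ≤ η⁻¹ * (‖g' x‖ - η * ε⁻¹) ^ 2 := by positivity
        have h5 : g' x ^ 2 = ‖g' x‖ ^ 2 := by rw [Real.norm_eq_abs, sq_abs]
        have h6 : η⁻¹ * (‖g' x‖ - η * ε⁻¹) ^ 2
            = η⁻¹ * ‖g' x‖ ^ 2 + η * (ε ^ 2)⁻¹ - 2 * (ε⁻¹ * ‖g' x‖) := by
          field_simp
          ring
        rw [h5]
        linarith
      calc ε⁻¹ * (‖g' x‖ * ‖ψ (ε⁻¹ • (x - X))‖) = (ε⁻¹ * ‖g' x‖) * ‖ψ (ε⁻¹ • (x - X))‖ := by ring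
        _ ≤ (1 / 2 * (η⁻¹ * g' x ^ 2 + η * (ε ^ 2)⁻¹)) * M :=
          mul_le_mul h3 (hM _) (norm_nonneg _) (by positivity)
        _ = _ := by ring
    · rw [integral_const_mul, integral_add (hsq.integrableOn.const_mul _)
        (integrableOn_const hBfin), integral_const_mul, setIntegral_const, hvol ε hε, smul_eq_mul]
      field_simp
  rw [Metric.tendsto_nhds]
  intro e he
  set η : ℝ := e / (M * V + 1) with hη
  have hη0 : 0 < η := by positivity
  have hlim : Tendsto (fun ε => M / 2 * (η⁻¹ * (∫ x in B ε, g' x ^ 2) + η * V)) (𝓝[>] 0)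
      (𝓝 (M / 2 * (η⁻¹ * 0 + η * V))) := ((hS.const_mul _).add_const _).const_mul _
  have hlt : M / 2 * (η⁻¹ * 0 + η * V) < e := by
    have h1 : e * (M * V) < e * (M * V + 1) * 2 := by nlinarith [mul_nonneg hM0 hV0]
    rw [hη, mul_zero, zero_add, show M / 2 * (e / (M * V + 1) * V)
      = e * (M * V) / ((M * V + 1) * 2) by field_simp, div_lt_iff₀ (by positivity)]
    linarith
  filter_upwards [hest η hη0, hlim.eventually (gt_mem_nhds hlt)] with ε h1 h2
  rw [dist_zero_right]
  exact h1.trans_lt h2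

end Blowup

/-! ### A Sobolev function does not jump across a line -/

/-- A linear change of variables multiplies integrals by a nonzero constant. -/
lemma integral_comp_continuousLinearEquiv (A : (ℝ × ℝ) ≃L[ℝ] Plane) :
    ∃ c : ℝ, c ≠ 0 ∧ ∀ f : Plane → ℝ, ∫ y, f y = c * ∫ z, f (A z) := by
  set μ : Measure (ℝ × ℝ) := (volume : Measure Plane).map A.symm with hμ
  have : μ.IsAddHaarMeasure := A.symm.isAddHaarMeasure_map volume
  have h := Measure.isAddLeftInvariant_eq_smul μ volume
  refine ⟨μ.addHaarScalarFactor volume,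
    NNReal.coe_ne_zero.2 (Measure.addHaarScalarFactor_pos_of_isAddHaarMeasure μ volume).ne',
    fun f => ?_⟩
  have h1 : ∫ z, f (A z) ∂μ = ∫ y, f y := by
    rw [hμ]
    have := integral_map_equiv A.symm.toHomeomorph.toMeasurableEquiv (μ := volume)
      fun z => f (A z)
    refine this.trans ?_
    refine integral_congr_ae (Eventually.of_forall fun y => ?_)
    exact congrArg f (A.apply_symm_apply y)
  have h2 : ∫ z, f (A z) ∂μ = ∫ z, f (A z) ∂(μ.addHaarScalarFactor volume • volume) :=
    congrArg (fun ν => ∫ z, f (A z) ∂ν) h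
  rw [← h1, h2, integral_smul_nnreal_measure]
  rfl

/-- If a bounded Sobolev function has, at a point, blow-up limits `a` and `b` on the two sides of a
line, then `a = b`. -/
lemma eq_of_blowup {Ω : Set Plane} (hΩ : IsOpen Ω) {v : Plane → ℝ} (hv : v ∈ H1 Ω)
    (hv0 : ∀ x ∉ Ω, v x = 0) {M : ℝ} (hM : ∀ x, |v x| ≤ M) {X : Plane} (hX : X ∈ Ω)
    (A : (ℝ × ℝ) ≃L[ℝ] Plane) {a b : ℝ}
    (ha : ∀ y, 0 < (A.symm y).2 → Tendsto (fun ε : ℝ => v (X + ε • y)) (𝓝[>] 0) (𝓝 a))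
    (hb : ∀ y, (A.symm y).2 < 0 → Tendsto (fun ε : ℝ => v (X + ε • y)) (𝓝[>] 0) (𝓝 b)) :
    a = b := by
  have hM0 : 0 ≤ M := (abs_nonneg _).trans (hM 0)
  let θ : ContDiffBump (0 : ℝ) := ⟨1, 2, one_pos, one_lt_two⟩
  have hθ : ContDiff ℝ ∞ θ := θ.contDiff
  have hθc : HasCompactSupport θ := θ.hasCompactSupport
  set Θ : ℝ × ℝ → ℝ := fun z => θ z.1 * θ z.2 with hΘ
  have hΘs : ContDiff ℝ ∞ Θ := (hθ.comp contDiff_fst).mul (hθ.comp contDiff_snd)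
  have hΘc : HasCompactSupport Θ := by
    refine HasCompactSupport.intro (hθc.isCompact.prod hθc.isCompact) fun z hz => ?_
    rw [mem_prod, not_and_or] at hz
    rcases hz with hz | hz <;> simp [hΘ, image_eq_zero_of_notMem_tsupport hz]
  set ψ : Plane → ℝ := fun y => Θ (A.symm y) with hψ
  have hψs : ContDiff ℝ ∞ ψ := hΘs.comp A.symm.contDiff
  have hψc : HasCompactSupport ψ := hΘc.comp_homeomorph A.symm.toHomeomorph
  set w : Plane := A (0, 1) with hw
  -- the derivative of the test function
  have hder : ∀ z, fderiv ℝ ψ (A z) w = θ z.1 * deriv θ z.2 := by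
    intro z
    have h1 : HasFDerivAt ψ ((fderiv ℝ Θ z).comp (A.symm : Plane →L[ℝ] ℝ × ℝ)) (A z) := by
      have h2 : HasFDerivAt Θ (fderiv ℝ Θ z) (A.symm (A z)) := by
        rw [A.symm_apply_apply]
        exact ((hΘs.differentiable (by simp)) z).hasFDerivAt
      exact h2.comp _ A.symm.hasFDerivAt
    rw [h1.fderiv, hw]
    simp only [ContinuousLinearMap.comp_apply, ContinuousLinearEquiv.coe_coe, A.symm_apply_apply]
    have h3 : HasDerivAt (fun u : ℝ => Θ (z + u • ((0 : ℝ), (1 : ℝ)))) (θ z.1 * deriv θ z.2) 0 := by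
      have h4 : HasDerivAt (fun u : ℝ => θ (z.2 + u)) (deriv θ z.2) 0 := by
        have h5 : HasDerivAt θ (deriv θ z.2) (z.2 + 0) := by
          rw [add_zero]
          exact ((hθ.differentiable (by simp)) z.2).hasDerivAt
        exact h5.comp_const_add z.2 0
      simpa [hΘ] using h4.const_mul (θ z.1)
    have h6 := ((hΘs.differentiable (by simp)) z).hasFDerivAt.hasLineDerivAt ((0 : ℝ), (1 : ℝ))
    exact HasDerivAt.unique h6 h3
  set u : Plane → ℝ := fun y => if 0 < (A.symm y).2 then a else b with hu
  -- passage to the limit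
  have hnull : ∀ᵐ y : Plane, (A.symm y).2 ≠ 0 := by
    set L : Plane →ₗ[ℝ] ℝ := (LinearMap.snd ℝ ℝ ℝ).comp (A.symm : Plane →ₗ[ℝ] ℝ × ℝ) with hL
    have h1 : LinearMap.ker L ≠ ⊤ := by
      intro h
      have h2 : A (0, 1) ∈ LinearMap.ker L := h ▸ Submodule.mem_top
      rw [LinearMap.mem_ker] at h2
      simp [hL] at h2
    have h3 := Measure.addHaar_submodule (volume : Measure Plane) _ h1
    rw [ae_iff]
    convert h3 using 2
    ext y
    simp [hL]
  have hlim : Tendsto (fun ε : ℝ => ∫ y, v (X + ε • y) * fderiv ℝ ψ y w) (𝓝[>] 0)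
      (𝓝 (∫ y, u y * fderiv ℝ ψ y w)) := by
    have hv2 : MemLp v 2 volume := by
      have : Ω.indicator v = v := indicator_eq_self.2 fun x hx => by
        by_contra h
        exact hx (hv0 x h)
      rw [← this]
      exact (memLp_indicator_iff_restrict hΩ.measurableSet).2 hv.1
    refine tendsto_integral_filter_of_dominated_convergence (fun y => M * ‖fderiv ℝ ψ y w‖)
      ?_ ?_ ?_ ?_
    · filter_upwards [self_mem_nhdsWithin] with ε hε
      exact (integrable_rescale X w hv2 hψs hψc hε).aestronglyMeasurable
    · refine Eventually.of_forall fun ε => Eventually.of_forall fun y => ?_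
      rw [norm_mul]
      exact mul_le_mul_of_nonneg_right (hM _) (norm_nonneg _)
    · refine (Continuous.integrable_of_hasCompactSupport ?_ ?_).norm.const_mul M
      · exact (hψs.continuous_fderiv (by simp)).clm_apply continuous_const
      · exact hψc.fderiv_apply (𝕜 := ℝ) _
    · filter_upwards [hnull] with y hy
      refine Tendsto.mul_const _ ?_
      rcases lt_or_gt_of_ne hy with h | h
      · simp only [hu, if_neg (not_lt.2 h.le)]
        exact hb y h
      · simp only [hu, if_pos h]
        exact ha y h
  have hzero : ∫ y, u y * fderiv ℝ ψ y w = 0 :=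
    tendsto_nhds_unique hlim (tendsto_blowup hΩ hv hv0 hX w hψs hψc)
  -- evaluation of the limit in the coordinates `A`
  obtain ⟨c, hc, hchange⟩ := integral_comp_continuousLinearEquiv A
  rw [hchange] at hzero
  have h1 := (mul_eq_zero.1 hzero).resolve_left hc
  have h2 : ∀ z : ℝ × ℝ, u (A z) * fderiv ℝ ψ (A z) w
      = θ z.1 * ((if 0 < z.2 then a else b) * deriv θ z.2) := fun z => by
    rw [hder, hu]
    simp only [A.symm_apply_apply]
    ring
  simp only [h2] at h1
  rw [Measure.volume_eq_prod, integral_prod_mul (fun x => θ x)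
    (fun x => (if 0 < x then a else b) * deriv θ x)] at h1
  have h3 := (mul_eq_zero.1 h1).resolve_left θ.integral_pos.ne'
  have hθ1 : ContDiff ℝ 1 θ := hθ.of_le (by exact_mod_cast le_top)
  have hint : Integrable (deriv θ) :=
    (hθ1.continuous_deriv le_rfl).integrable_of_hasCompactSupport hθc.deriv
  have h4 : ∫ x, (if 0 < x then a else b) * deriv θ x
      = b * (∫ x in Iic 0, deriv θ x) + a * ∫ x in Ioi 0, deriv θ x := by
    have h5 : EqOn (fun x => (if 0 < x then a else b) * deriv θ x) (fun x => b * deriv θ x)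
        (Iic 0) := fun x hx => by
      simp only [if_neg (not_lt.2 (mem_Iic.1 hx))]
    have h6 : EqOn (fun x => (if 0 < x then a else b) * deriv θ x) (fun x => a * deriv θ x)
        (Ioi 0) := fun x hx => by
      simp only [if_pos (mem_Ioi.1 hx)]
    rw [← intervalIntegral.integral_Iic_add_Ioi
      ((hint.const_mul b).integrableOn.congr_fun h5.symm measurableSet_Iic)
      ((hint.const_mul a).integrableOn.congr_fun h6.symm measurableSet_Ioi),
      setIntegral_congr_fun measurableSet_Iic h5, setIntegral_congr_fun measurableSet_Ioi h6,
      integral_const_mul, integral_const_mul]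
  rw [h4, hθc.integral_Iic_deriv_eq hθ1, hθc.integral_Ioi_deriv_eq hθ1] at h3
  have h7 : θ 0 = 1 := θ.one_of_mem_closedBall (Metric.mem_closedBall_self zero_le_one)
  rw [h7] at h3
  linarith

namespace Multipatch

variable {p K : ℕ} (D : Multipatch p K)

/-! ### Conforming splines have matching traces and are vertex-conforming -/

/-- On a common side, the pullbacks of a conforming spline from the two patches agree. -/
lemma value_eq_of_mem_Vh (hp : 1 ≤ p) {φ : D.Vpw} (hφ : φ ∈ D.Vh) {k l : Fin K} (hkl : k ≠ l)
    {s s' : Frame} (h : ∀ t ∈ Icc (0 : ℝ) 1, D.F k (s.pt (t, 0)) = D.F l (s'.pt (t, 0))) {t : ℝ}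
    (ht : t ∈ Icc (0 : ℝ) 1) : D.value φ k (s.pt (t, 0)) = D.value φ l (s'.pt (t, 0)) := by
  have hcont : ∀ m (σ : Frame), ContinuousOn (fun x => D.value φ m (σ.pt x)) closedSquare :=
    fun m σ => (D.continuousOn_value hp φ m).comp σ.contDiff_pt.continuous.continuousOn
      fun x hx => Frame.pt_mem_closedSquare hx
  have hcont' : ∀ m (σ : Frame), ContinuousOn (fun t : ℝ => D.value φ m (σ.pt (t, 0)))
      (Icc 0 1) := fun m σ => (hcont m σ).comp (by fun_prop)
    fun t ht => Frame.side_mem_closedSquare ht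
  suffices H : EqOn (fun t : ℝ => D.value φ k (s.pt (t, 0)))
      (fun t : ℝ => D.value φ l (s'.pt (t, 0))) (Ioo 0 1) from
    H.of_subset_closure (hcont' k s) (hcont' l s') Ioo_subset_Icc_self
      (closure_Ioo zero_ne_one).symm.subset ht
  intro t ht
  have ht' : t ∈ Icc (0 : ℝ) 1 := ⟨ht.1.le, ht.2.le⟩
  have hmem := Frame.side_mem_closedSquare ht'
  obtain ⟨A, hA⟩ := ((D.isPatchMap k).comp_pt s).exists_hasStrictFDerivAt hmem
  obtain ⟨A', hA'⟩ := ((D.isPatchMap l).comp_pt s').exists_hasStrictFDerivAt hmem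
  obtain ⟨c, hc, hAA'⟩ := exists_neg_smul_of_side (D.disjoint_comp_pt hkl s s') h ht hA hA'
  obtain ⟨M, hM⟩ := D.bounded_apply hp φ
  -- the blow-up limits are the traces
  have key : ∀ m (σ : Frame) (B : (ℝ × ℝ) ≃L[ℝ] Plane),
      HasStrictFDerivAt (D.F m ∘ σ.pt) (B : ℝ × ℝ →L[ℝ] Plane) (t, 0) →
      ∀ y, 0 < (B.symm y).2 →
        Tendsto (fun ε : ℝ => (φ : Plane → ℝ) (D.F m (σ.pt (t, 0)) + ε • y)) (𝓝[>] 0)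
          (𝓝 (D.value φ m (σ.pt (t, 0)))) := by
    intro m σ B hB y hy
    obtain ⟨g, hg, hg'⟩ := exists_tangent ht hB
    have hline : Tendsto (fun ε : ℝ => (D.F m ∘ σ.pt) (t, 0) + ε • y) (𝓝[>] 0)
        (𝓝 ((D.F m ∘ σ.pt) (t, 0))) := by
      have : ContinuousAt (fun ε : ℝ => (D.F m ∘ σ.pt) (t, 0) + ε • y) 0 := by fun_prop
      have h := this.tendsto
      rw [zero_smul, add_zero] at h
      exact h.mono_left nhdsWithin_le_nhds
    have h1 : Tendsto (fun ε : ℝ => g ((D.F m ∘ σ.pt) (t, 0) + ε • y)) (𝓝[>] 0)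
        (𝓝[closedSquare] (t, 0)) :=
      tendsto_nhdsWithin_iff.2 ⟨hg.comp hline,
        (hg' y hy).mono fun ε hε => openSquare_subset hε.1⟩
    refine ((hcont m σ (t, 0) hmem).tendsto.comp h1).congr' ?_
    filter_upwards [hg' y hy] with ε hε
    have h2 := D.apply_F φ m (Frame.pt_mem_openSquare (s := σ) hε.1)
    rw [Function.comp_apply, ← h2]
    exact congrArg (φ : Plane → ℝ) hε.2
  refine eq_of_blowup D.isOpen_Omega hφ (fun x hx => D.apply_eq_zero φ hx) hM
    (D.side_mem_Omega hkl h ht) A (key k s A hA) fun y hy => ?_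
  rw [h t ht']
  exact key l s' A' hA' y (by rw [hAA']; exact mul_pos_of_neg_of_neg hc hy)

lemma tracesMatch_of_mem_Vh (hp : 1 ≤ p) (I : ∀ e, D.IsInterior e → D.Interface e) {φ : D.Vpw}
    (hφ : φ ∈ D.Vh) : D.TracesMatch I φ :=
  (D.tracesMatch_iff I φ).2 fun e he _ ht =>
    D.value_eq_of_mem_Vh hp hφ (I e he).ne (I e he).matching ⟨ht.1.le, ht.2.le⟩

end Multipatch

/-! ### Vertex continuity of conforming splines -/

lemma one_lt_rank_plane : 1 < Module.rank ℝ Plane := by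
  rw [← Module.finrank_eq_rank]
  simp

/-- Near a point of its closure, an open set with Lipschitz boundary is connected also after the
point has been removed: it is a punctured disc, or the part of a box above a graph. -/
lemma exists_isPreconnected {Ω : Set Plane} (hΩ : IsOpen Ω) (hL : HasLipschitzBoundary Ω)
    {v : Plane} (hv : v ∈ closure Ω) {U : Set Plane} (hU : U ∈ 𝓝 v) :
    ∃ Q, IsPreconnected Q ∧ Q ⊆ Ω ∩ U ∧ v ∉ Q ∧ ∃ N ∈ 𝓝 v, (Ω ∩ N) \ {v} ⊆ Q := by
  by_cases hvΩ : v ∈ Ω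
  · obtain ⟨δ, hδ, hball⟩ := Metric.mem_nhds_iff.1 (inter_mem (hΩ.mem_nhds hvΩ) hU)
    refine ⟨(fun z : ℝ × Plane => v + z.1 • z.2) '' (Ioo 0 δ ×ˢ Metric.sphere 0 1), ?_, ?_, ?_,
      Metric.ball v δ, Metric.ball_mem_nhds v hδ, ?_⟩
    · exact (isPreconnected_Ioo.prod (isPreconnected_sphere one_lt_rank_plane 0 1)).image _
        (by fun_prop)
    · rintro _ ⟨⟨t, u⟩, ⟨ht, hu⟩, rfl⟩
      refine hball ?_
      rw [mem_sphere_zero_iff_norm] at hu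
      rw [Metric.mem_ball, dist_eq_norm, add_sub_cancel_left, norm_smul, hu, mul_one,
        Real.norm_of_nonneg ht.1.le]
      exact ht.2
    · rintro ⟨⟨t, u⟩, ⟨ht, hu⟩, h⟩
      rw [mem_sphere_zero_iff_norm] at hu
      simp only [add_eq_left, smul_eq_zero] at h
      rcases h with h | h
      · exact ht.1.ne' h
      · simp [h] at hu
    · rintro y ⟨⟨-, hy⟩, hyv⟩
      have hne : 0 < ‖y - v‖ := norm_pos_iff.2 (sub_ne_zero.2 hyv)
      rw [Metric.mem_ball, dist_eq_norm] at hy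
      refine ⟨(‖y - v‖, ‖y - v‖⁻¹ • (y - v)), ⟨⟨hne, hy⟩, ?_⟩, ?_⟩
      · rw [mem_sphere_zero_iff_norm, norm_smul, norm_inv, norm_norm, inv_mul_cancel₀ hne.ne']
      · simp only
        rw [smul_smul, mul_inv_cancel₀ hne.ne', one_smul, add_sub_cancel]
  · obtain ⟨T, L, f, δ, hδ, hf, hT⟩ := hL v ⟨hv, fun h => hvΩ (interior_subset h)⟩
    have hTc : ∀ i : Fin 2, Continuous fun y => T y i := fun i => by fun_prop
    have hfc : Continuous f := hf.continuous
    have hfv : f (T v 0) = T v 1 := by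
      refine le_antisymm ?_ (not_lt.1 fun h => hvΩ ((hT v (Metric.mem_ball_self hδ)).2 h))
      by_contra! h
      have h1 : {y | T y 1 < f (T y 0)} ∩ Metric.ball v δ ∈ 𝓝 v :=
        inter_mem ((isOpen_lt (hTc 1) (hfc.comp (hTc 0))).mem_nhds h) (Metric.ball_mem_nhds v hδ)
      obtain ⟨y, ⟨hy1, hy2⟩, hy3⟩ := mem_closure_iff_nhds.1 hv _ h1
      exact absurd ((hT y hy2).1 hy3) (not_lt.2 (le_of_lt hy1))
    set Ψ : ℝ × ℝ → Plane := fun z => T.symm !₂[z.1, f z.1 + z.2] with hΨ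
    have hΨc : Continuous Ψ := by
      refine T.symm.continuous.comp ((PiLp.continuous_toLp 2 _).comp (continuous_pi fun i => ?_))
      fin_cases i
      · exact continuous_fst
      · exact (hfc.comp continuous_fst).add continuous_snd
    have hΨ0 : ∀ z, T (Ψ z) 0 = z.1 := fun z => by simp [hΨ]
    have hΨ1 : ∀ z, T (Ψ z) 1 = f z.1 + z.2 := fun z => by simp [hΨ]
    have hΨT : ∀ y, Ψ (T y 0, T y 1 - f (T y 0)) = y := fun y => by
      apply T.injective
      ext i
      fin_cases i
      · exact hΨ0 _
      · exact (hΨ1 _).trans (by simp)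
    have hΨv : Ψ (T v 0, 0) = v := by
      have := hΨT v
      rwa [hfv, sub_self] at this
    have hW : Ψ ⁻¹' (U ∩ Metric.ball v δ) ∈ 𝓝 (T v 0, (0 : ℝ)) :=
      hΨc.continuousAt.preimage_mem_nhds (by
        rw [hΨv]
        exact inter_mem hU (Metric.ball_mem_nhds v hδ))
    obtain ⟨η, hη, hball⟩ := Metric.mem_nhds_iff.1 hW
    refine ⟨Ψ '' (Ioo (T v 0 - η) (T v 0 + η) ×ˢ Ioo 0 η), ?_, ?_, ?_,
      {y | |T y 0 - T v 0| < η} ∩ {y | |T y 1 - f (T y 0)| < η} ∩ Metric.ball v δ, ?_, ?_⟩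
    · exact (isPreconnected_Ioo.prod isPreconnected_Ioo).image _ hΨc.continuousOn
    · rintro _ ⟨⟨a, h⟩, ⟨ha, hh⟩, rfl⟩
      have hmem : (a, h) ∈ Metric.ball (T v 0, (0 : ℝ)) η := by
        rw [← ball_prod_same, Real.ball_eq_Ioo, Real.ball_eq_Ioo]
        exact ⟨ha, by linarith [hh.1], by linarith [hh.2]⟩
      have h1 := hball hmem
      refine ⟨(hT _ h1.2).2 ?_, h1.1⟩
      rw [hΨ0, hΨ1]
      linarith [hh.1]
    · rintro ⟨⟨a, h⟩, ⟨ha, hh⟩, hv'⟩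
      have h1 := hΨ0 (a, h)
      have h2 := hΨ1 (a, h)
      rw [hv'] at h1 h2
      rw [← h1, hfv] at h2
      simp only at h2
      linarith [hh.1]
    · refine inter_mem (inter_mem ?_ ?_) (Metric.ball_mem_nhds v hδ)
      · refine (isOpen_lt ((hTc 0).sub continuous_const).abs continuous_const).mem_nhds ?_
        simpa using hη
      · refine (isOpen_lt ((hTc 1).sub (hfc.comp (hTc 0))).abs continuous_const).mem_nhds ?_
        simpa [hfv] using hη
    · rintro y ⟨⟨hyΩ, ⟨hy0, hy1⟩, hy⟩, -⟩
      have h1 := (hT y hy).1 hyΩ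
      have hy0 := abs_lt.1 (show |T y 0 - T v 0| < η from hy0)
      have hy1 := abs_lt.1 (show |T y 1 - f (T y 0)| < η from hy1)
      exact ⟨(T y 0, T y 1 - f (T y 0)), ⟨⟨by linarith, by linarith⟩, by linarith, hy1.2⟩, hΨT y⟩

namespace Multipatch

variable {p K : ℕ} (D : Multipatch p K)

lemma pt_notMem_openSquare (c : Corner) : c.pt ∉ openSquare := by
  rcases c with ⟨_ | _, _ | _⟩ <;> simp [Corner.pt, orient, openSquare]

/-- At a vertex, a conforming spline takes the same value from all patches. Otherwise the patches at
the vertex with a given value and those with other values have only the vertex in common, since the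
values agree along common edges; but these two families of closed sets cover a punctured
neighbourhood of the vertex in `Ω` that is connected. -/
lemma vertexConforming_of_mem_Vh (hp : 1 ≤ p) {φ : D.Vpw} (hφ : φ ∈ D.Vh) :
    φ ∈ D.vertexConforming := by
  rw [vertexConforming_iff]
  intro k l c d hcd
  by_contra hne
  set v := D.F k c.pt with hv
  set a := D.value φ k c.pt with ha
  set A : Set (Fin K) := {m | ∃ x ∈ closedSquare, D.F m x = v ∧ D.value φ m x = a} with hA
  set B : Set (Fin K) := {m | ∃ x ∈ closedSquare, D.F m x = v ∧ D.value φ m x ≠ a} with hB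
  have hclosed : ∀ S : Set (Fin K), IsClosed (⋃ m ∈ S, D.F m '' closedSquare) := fun S =>
    S.toFinite.isClosed_biUnion fun m _ => (D.isPatchMap m).isCompact_image.isClosed
  have hAB : (⋃ m ∈ A, D.F m '' closedSquare) ∩ (⋃ m ∈ B, D.F m '' closedSquare) ⊆ {v} := by
    rintro y ⟨hyA, hyB⟩
    simp only [mem_iUnion₂] at hyA hyB
    obtain ⟨m, ⟨x, hx, hxv, hxa⟩, hym⟩ := hyA
    obtain ⟨m', ⟨x', hx', hxv', hxa'⟩, hym'⟩ := hyB
    have hmm : m ≠ m' := by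
      rintro rfl
      rw [D.injOn m hx hx' (hxv.trans hxv'.symm)] at hxa
      exact hxa' hxa
    rcases D.conforming' hmm hx hx' (hxv.trans hxv'.symm) with
      ⟨-, -, -, -, h⟩ | ⟨s, s', hss, t, ht, hxt, hxt'⟩
    · have : y ∈ F D m '' closedSquare ∩ F D m' '' closedSquare := ⟨hym, hym'⟩
      rwa [h, hxv] at this
    · refine absurd ?_ hxa'
      rw [← hxa, hxt, hxt', D.value_eq_of_mem_Vh hp hφ hmm hss ht]
  have hvk : v ∈ closure (D.patch k) := by
    rw [D.closure_patch]
    exact mem_image_of_mem _ (pt_mem_closedSquare c)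
  have hvl : v ∈ closure (D.patch l) := by
    rw [D.closure_patch, hcd]
    exact mem_image_of_mem _ (pt_mem_closedSquare d)
  have hvkn : v ∉ D.patch k := by
    rintro ⟨x, hx, h⟩
    rw [D.injOn k (openSquare_subset hx) (pt_mem_closedSquare c) h] at hx
    exact pt_notMem_openSquare c hx
  have hvln : v ∉ D.patch l := by
    rintro ⟨x, hx, h⟩
    rw [D.injOn l (openSquare_subset hx) (pt_mem_closedSquare d) (h.trans hcd)] at hx
    exact pt_notMem_openSquare d hx
  have hkA : k ∈ A := ⟨c.pt, pt_mem_closedSquare c, rfl, rfl⟩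
  have hlB : l ∈ B := ⟨d.pt, pt_mem_closedSquare d, hcd.symm, fun h => hne h.symm⟩
  -- a neighbourhood that meets only the patches at the vertex
  have hU : (⋃ m ∈ (A ∪ B)ᶜ, D.F m '' closedSquare)ᶜ ∈ 𝓝 v := by
    refine (hclosed _).isOpen_compl.mem_nhds fun h => ?_
    simp only [mem_iUnion₂] at h
    obtain ⟨m, hm, x, hx, hxv⟩ := h
    by_cases hxa : D.value φ m x = a
    · exact hm (Or.inl ⟨x, hx, hxv, hxa⟩)
    · exact hm (Or.inr ⟨x, hx, hxv, hxa⟩)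
  obtain ⟨Q, hQ, hQΩ, hvQ, N, hN, hNQ⟩ := exists_isPreconnected D.isOpen_Omega D.lipschitz
    (closure_mono (D.patch_subset_Omega k) hvk) hU
  have hmeet : ∀ m, v ∈ closure (D.patch m) → v ∉ D.patch m → ∀ S : Set (Fin K), m ∈ S →
      (Q ∩ ⋃ m ∈ S, D.F m '' closedSquare).Nonempty := by
    intro m hm hm' S hmS
    obtain ⟨y, hyN, hym⟩ := mem_closure_iff_nhds.1 hm N hN
    refine ⟨y, hNQ ⟨⟨D.patch_subset_Omega m hym, hyN⟩, fun h => hm' (h ▸ hym)⟩, ?_⟩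
    exact mem_biUnion hmS (image_mono openSquare_subset hym)
  obtain ⟨y, hyQ, hy⟩ := isPreconnected_closed_iff.1 hQ _ _ (hclosed A) (hclosed B) (by
    intro y hy
    obtain ⟨hyΩ, hyU⟩ := hQΩ hy
    obtain ⟨m, hm⟩ := mem_iUnion.1 (D.Omega_subset hyΩ)
    by_cases hmAB : m ∈ A ∪ B
    · rcases hmAB with h | h
      · exact Or.inl (mem_biUnion h hm)
      · exact Or.inr (mem_biUnion h hm)
    · exact absurd (mem_biUnion (show m ∈ (A ∪ B)ᶜ from hmAB) hm) hyU)
    (hmeet k hvk hvkn A hkA) (hmeet l hvl hvln B hlB)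
  exact hvQ (by rwa [← show y = v from hAB hy])

end Multipatch

/-! ### Locally Lipschitz functions are Sobolev functions -/

/-- Along an interval covered by finitely many closed sets on each of which a continuous function
is Lipschitz, the function is Lipschitz with the same constant. -/
lemma abs_sub_le_of_closed_cover {ι : Type*} [Finite ι] {E : ι → Set ℝ} (hE : ∀ i, IsClosed (E i))
    {g : ℝ → ℝ} (hg : Continuous g) {M : ℝ} (hcov : Icc 0 1 ⊆ ⋃ i, E i)
    (h : ∀ i, ∀ s ∈ E i, ∀ t ∈ E i, |g s - g t| ≤ M * |s - t|) : |g 1 - g 0| ≤ M := by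
  have hsub : Icc (0 : ℝ) 1 ⊆ {t | |g t - g 0| ≤ M * t} := by
    refine IsClosed.Icc_subset_of_forall_exists_gt ?_ (by simp) ?_
    · exact (isClosed_le (by fun_prop) (by fun_prop)).inter isClosed_Icc
    · rintro t ⟨ht, ht0, ht1⟩ u (hu : t < u)
      -- some member of the cover accumulates at `t` from the right
      have hev : ∀ᶠ s in 𝓝[>] t, ∃ i, s ∈ E i := by
        filter_upwards [Ioo_mem_nhdsGT ht1] with s hs
        exact mem_iUnion.1 (hcov ⟨ht0.trans hs.1.le, hs.2.le⟩)
      obtain ⟨i, hi⟩ : ∃ i, ∃ᶠ s in 𝓝[>] t, s ∈ E i := by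
        by_contra! hno
        obtain ⟨s, ⟨i, hsi⟩, hs⟩ := (hev.and (eventually_all.2 hno)).exists
        exact hs i hsi
      have hti : t ∈ E i := by
        refine (hE i).closure_subset (mem_closure_iff_frequently.2 ?_)
        exact hi.filter_mono nhdsWithin_le_nhds
      obtain ⟨s, hsi, hs⟩ := (hi.and_eventually (Ioc_mem_nhdsGT hu)).exists
      refine ⟨s, ?_, hs⟩
      have h1 := h i s hsi t hti
      rw [abs_of_pos (sub_pos.2 hs.1)] at h1
      have ht : |g t - g 0| ≤ M * t := ht
      calc |g s - g 0| ≤ |g s - g t| + |g t - g 0| := abs_sub_le _ _ _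
        _ ≤ M * (s - t) + M * t := add_le_add h1 ht
        _ = M * s := by ring
  have := hsub (right_mem_Icc.2 zero_le_one)
  simpa using this

/-- A continuous function that is Lipschitz on each of finitely many closed sets satisfies the
Lipschitz estimate between the ends of any segment covered by these sets. -/
lemma abs_sub_le_of_segment {ι : Type*} [Finite ι] {C : ι → Set Plane} (hC : ∀ i, IsClosed (C i))
    {f : Plane → ℝ} (hf : Continuous f) {L : ℝ}
    (h : ∀ i, ∀ x ∈ C i, ∀ y ∈ C i, |f x - f y| ≤ L * dist x y) {x y : Plane}
    (hxy : segment ℝ x y ⊆ ⋃ i, C i) : |f y - f x| ≤ L * dist x y := by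
  set γ : ℝ → Plane := fun t => x + t • (y - x) with hγ
  have hγc : Continuous γ := by fun_prop
  have h0 : γ 0 = x := by simp [hγ]
  have h1 : γ 1 = y := by simp [hγ]
  have := abs_sub_le_of_closed_cover (E := fun i => γ ⁻¹' C i) (g := f ∘ γ) (M := L * dist x y)
    (fun i => (hC i).preimage hγc) (hf.comp hγc) (fun t ht => ?_) (fun i s hs t ht => ?_)
  · simpa only [Function.comp_apply, h0, h1] using this
  · obtain ⟨i, hi⟩ := mem_iUnion.1 (hxy (by
      rw [segment_eq_image']
      exact ⟨t, ht, rfl⟩))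
    exact mem_iUnion.2 ⟨i, hi⟩
  · refine (h i _ hs _ ht).trans_eq ?_
    rw [dist_eq_norm, show γ s - γ t = (s - t) • (y - x) by simp only [hγ]; module, norm_smul,
      Real.norm_eq_abs, dist_comm x y, dist_eq_norm y x]
    ring

/-- A continuous function that is locally Lipschitz on a bounded open set, with a uniform constant,
is a Sobolev function: its directional derivatives are weak derivatives, by Rademacher's
theorem. -/
lemma mem_H1_of_locally_lipschitz {Ω : Set Plane} (hΩ : IsOpen Ω) (hb : Bornology.IsBounded Ω)
    {f : Plane → ℝ} (hf : Continuous f) {L : NNReal}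
    (hL : ∀ x ∈ Ω, ∃ s ∈ 𝓝 x, LipschitzOnWith L f s) : f ∈ H1 Ω := by
  have : IsFiniteMeasure (volume.restrict Ω) :=
    ⟨by rw [Measure.restrict_apply_univ]; exact hb.measure_lt_top⟩
  refine ⟨?_, fun i => ⟨fun x => lineDeriv ℝ f x (EuclideanSpace.single i 1), ?_, ?_⟩⟩
  · obtain ⟨M, hM⟩ := hb.isCompact_closure.exists_bound_of_continuousOn hf.continuousOn
    refine MemLp.of_bound hf.aestronglyMeasurable M ?_
    filter_upwards [ae_restrict_mem hΩ.measurableSet] with x hx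
    exact hM x (subset_closure hx)
  · refine MemLp.of_bound (measurable_lineDeriv hf).aestronglyMeasurable
      (L * ‖EuclideanSpace.single i (1 : ℝ)‖) ?_
    filter_upwards [ae_restrict_mem hΩ.measurableSet] with x hx
    obtain ⟨s, hs, hLs⟩ := hL x hx
    exact norm_lineDeriv_le_of_lipschitzOn ℝ hs hLs
  · intro ψ hψ hc hsupp
    set e : Plane := EuclideanSpace.single i 1 with he
    -- near the support of the test function, `f` is replaced by a Lipschitz function
    obtain ⟨δ, hδ, hδΩ⟩ := hc.isCompact.exists_cthickening_subset_open hΩ hsupp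
    have hK : IsCompact (Metric.cthickening δ (tsupport ψ)) := hc.isCompact.cthickening
    have hloc : LocallyLipschitzOn (Metric.cthickening δ (tsupport ψ)) f := fun x hx => by
      obtain ⟨s, hs, hLs⟩ := hL x (hδΩ hx)
      exact ⟨L, s, mem_nhdsWithin_of_mem_nhds hs, hLs⟩
    obtain ⟨C, hC⟩ := hloc.exists_lipschitzOnWith_of_compact hK
    obtain ⟨f', hf', hff'⟩ := hC.extend_real
    obtain ⟨C', hψ'⟩ := hψ.lipschitzWith_of_hasCompactSupport hc (by simp)
    have hnhds : ∀ x ∈ tsupport ψ, f =ᶠ[𝓝 x] f' := fun x hx => by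
      refine mem_of_superset ?_ hff'
      exact mem_of_superset (Metric.isOpen_thickening.mem_nhds
        (Metric.self_subset_thickening hδ _ hx)) (Metric.thickening_subset_cthickening δ _)
    have hline : ∀ x, lineDeriv ℝ ψ x (-e) = - fderiv ℝ ψ x e := fun x => by
      rw [((hψ.differentiable (by simp)) x).lineDeriv_eq_fderiv, map_neg]
    have hzero : ∀ x ∉ tsupport ψ, fderiv ℝ ψ x e = 0 := fun x hx => by
      rw [image_eq_zero_of_notMem_tsupport (fun h => hx (tsupport_fderiv_subset ℝ h))]
      rfl
    have hparts := hf'.integral_lineDeriv_mul_eq (μ := volume) hψ' hc e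
    have h1 : ∫ x in Ω, f x * fderiv ℝ ψ x e = ∫ x, f' x * fderiv ℝ ψ x e := by
      rw [setIntegral_eq_integral_of_forall_compl_eq_zero fun x hx => by
        rw [hzero x fun h => hx (hsupp h), mul_zero]]
      refine integral_congr_ae (Eventually.of_forall fun x => ?_)
      by_cases hx : x ∈ tsupport ψ
      · simp only [(hnhds x hx).self_of_nhds]
      · simp only [hzero x hx, mul_zero]
    have h2 : ∫ x in Ω, lineDeriv ℝ f x e * ψ x = ∫ x, lineDeriv ℝ f' x e * ψ x := by
      rw [setIntegral_eq_integral_of_forall_compl_eq_zero fun x hx => by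
        rw [image_eq_zero_of_notMem_tsupport fun h => hx (hsupp h), mul_zero]]
      refine integral_congr_ae (Eventually.of_forall fun x => ?_)
      by_cases hx : x ∈ tsupport ψ
      · simp only [(hnhds x hx).lineDeriv_eq]
      · simp only [image_eq_zero_of_notMem_tsupport hx, mul_zero]
    rw [h1, h2, hparts, ← integral_neg]
    refine integral_congr_ae (Eventually.of_forall fun x => ?_)
    simp only [hline]
    ring

lemma mem_H1_congr {Ω : Set Plane} {f v : Plane → ℝ} (hf : f ∈ H1 Ω)
    (h : v =ᵐ[volume.restrict Ω] f) : v ∈ H1 Ω := by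
  obtain ⟨hf2, hf'⟩ := hf
  refine ⟨hf2.ae_eq h.symm, fun i => ?_⟩
  obtain ⟨g, hg, hg'⟩ := hf' i
  refine ⟨g, hg, fun ψ a b c => ?_⟩
  rw [← hg' ψ a b c]
  refine integral_congr_ae ?_
  filter_upwards [h] with x hx
  rw [hx]

/-- The boundary of a patch is a null set. -/
lemma IsPatchMap.volume_boundary {G : ℝ × ℝ → Plane} (hG : IsPatchMap G) :
    volume (G '' (closedSquare \ openSquare)) = 0 := by
  obtain ⟨A, -⟩ := hG.exists_hasStrictFDerivAt (x := (0, 0)) (by simp [closedSquare])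
  have hnull : (volume : Measure (ℝ × ℝ)) (closedSquare \ openSquare) = 0 := by
    rw [← ae_le_set]
    exact (Measure.set_prod_ae_eq Ioo_ae_eq_Icc Ioo_ae_eq_Icc).symm.le
  have hA : volume (A '' (closedSquare \ openSquare)) = 0 := by
    have : ((volume : Measure Plane).map A.symm).IsAddHaarMeasure :=
      A.symm.isAddHaarMeasure_map volume
    have h := Measure.isAddLeftInvariant_eq_smul ((volume : Measure Plane).map A.symm) volume
    have h1 : (volume : Measure Plane).map A.symm (closedSquare \ openSquare) = 0 := by
      have h2 := congrArg (fun ν : Measure (ℝ × ℝ) => ν (closedSquare \ openSquare)) h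
      refine h2.trans ?_
      rw [Measure.smul_apply, hnull, smul_zero]
    have hmeas : MeasurableSet (closedSquare \ openSquare) :=
      (measurableSet_Icc.prod measurableSet_Icc).diff Multipatch.measurableSet_openSquare
    rw [Measure.map_apply A.symm.continuous.measurable hmeas] at h1
    rwa [A.image_eq_preimage_symm]
  have hd : DifferentiableOn ℝ (G ∘ A.symm) (A '' (closedSquare \ openSquare)) := by
    rintro _ ⟨x, hx, rfl⟩
    refine DifferentiableAt.differentiableWithinAt ?_
    refine DifferentiableAt.comp (A x) ?_ A.symm.differentiableAt
    rw [A.symm_apply_apply]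
    exact (hG.smooth x hx.1).differentiableAt one_ne_zero
  have := addHaar_image_eq_zero_of_differentiableOn_of_addHaar_eq_zero volume hd hA
  rw [← image_comp] at this
  convert this using 3
  ext x
  simp

namespace Multipatch

variable {p K : ℕ} (D : Multipatch p K)

/-! ### Splines with matching traces are conforming -/

lemma lipschitz_logicalFun (hp : 1 ≤ p) (k : Fin K) (i : Fin (D.n k + 1) × Fin (D.n k + 1)) :
    ∃ C, ∀ x ∈ closedSquare, ∀ y ∈ closedSquare,
      |D.logicalFun k i x - D.logicalFun k i y| ≤ C * dist x y := by
  obtain ⟨C, hC⟩ := (D.knots k).lipschitz_lam hp true i.1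
  obtain ⟨C', hC'⟩ := (D.knots k).lipschitz_lam hp true i.2
  obtain ⟨M, hM⟩ := isCompact_Icc.exists_bound_of_continuousOn
    ((D.knots k).continuousOn_lam hp true i.1)
  obtain ⟨M', hM'⟩ := isCompact_Icc.exists_bound_of_continuousOn
    ((D.knots k).continuousOn_lam hp true i.2)
  refine ⟨|C| * |M'| + |M| * |C'|, fun x hx y hy => ?_⟩
  have h1 : |x.1 - y.1| ≤ dist x y := le_max_left (dist x.1 y.1) (dist x.2 y.2)
  have h2 : |x.2 - y.2| ≤ dist x y := le_max_right (dist x.1 y.1) (dist x.2 y.2)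
  have h3 : |(D.knots k).lam true i.1 x.1 - (D.knots k).lam true i.1 y.1| ≤ |C| * dist x y :=
    (hC _ hx.1 _ hy.1).trans (mul_le_mul (le_abs_self _) h1 (abs_nonneg _) (abs_nonneg _))
  have h4 : |(D.knots k).lam true i.2 x.2 - (D.knots k).lam true i.2 y.2| ≤ |C'| * dist x y :=
    (hC' _ hx.2 _ hy.2).trans (mul_le_mul (le_abs_self _) h2 (abs_nonneg _) (abs_nonneg _))
  have h5 : |(D.knots k).lam true i.2 x.2| ≤ |M'| := (hM' _ hx.2).trans (le_abs_self _)
  have h6 : |(D.knots k).lam true i.1 y.1| ≤ |M| := (hM _ hy.1).trans (le_abs_self _)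
  simp only [logicalFun]
  rw [show ∀ a b c d : ℝ, a * b - c * d = (a - c) * b + c * (b - d) from fun a b c d => by ring]
  refine (abs_add_le _ _).trans ?_
  rw [abs_mul, abs_mul, add_mul]
  refine add_le_add ?_ ?_
  · exact (mul_le_mul h3 h5 (abs_nonneg _) (by positivity)).trans_eq (by ring)
  · exact (mul_le_mul h6 h4 (abs_nonneg _) (abs_nonneg _)).trans_eq (by ring)

lemma lipschitz_value (hp : 1 ≤ p) (φ : D.Vpw) (k : Fin K) :
    ∃ C, ∀ x ∈ closedSquare, ∀ y ∈ closedSquare,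
      |D.value φ k x - D.value φ k y| ≤ C * dist x y := by
  choose C hC using D.lipschitz_logicalFun hp k
  refine ⟨∑ i, |D.basis.repr φ ⟨k, i⟩| * C i, fun x hx y hy => ?_⟩
  rw [value, value, ← Finset.sum_sub_distrib, Finset.sum_mul]
  refine (Finset.abs_sum_le_sum_abs _ _).trans (Finset.sum_le_sum fun i _ => ?_)
  rw [← mul_sub, abs_mul, mul_assoc]
  exact mul_le_mul_of_nonneg_left (hC i x hx y hy) (abs_nonneg _)

/-- A vertex-conforming spline with matching traces has a continuous representative, which is
Lipschitz on every closed patch. -/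
lemma exists_continuous_extension (hp : 1 ≤ p) {I : ∀ e, D.IsInterior e → D.Interface e}
    {φ : D.Vpw} (hW : φ ∈ D.vertexConforming) (hT : D.TracesMatch I φ) :
    ∃ (f : Plane → ℝ) (L : NNReal), Continuous f ∧
      (∀ k, ∀ x ∈ closedSquare, f (D.F k x) = D.value φ k x) ∧
      ∀ k, ∀ x ∈ D.F k '' closedSquare, ∀ y ∈ D.F k '' closedSquare,
        |f x - f y| ≤ L * dist x y := by
  classical
  set g : Plane → ℝ := fun y =>
    if h : ∃ a : Fin K × (ℝ × ℝ), a.2 ∈ closedSquare ∧ D.F a.1 a.2 = y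
    then D.value φ h.choose.1 h.choose.2 else 0 with hg
  have hgF : ∀ k, ∀ x ∈ closedSquare, g (D.F k x) = D.value φ k x := by
    intro k x hx
    have h : ∃ a : Fin K × (ℝ × ℝ), a.2 ∈ closedSquare ∧ D.F a.1 a.2 = D.F k x := ⟨(k, x), hx, rfl⟩
    simp only [hg]
    rw [dif_pos h]
    exact D.value_eq_of_tracesMatch hW hT h.choose_spec.1 hx h.choose_spec.2
  have hLip : ∀ k, ∃ L : ℝ, 0 ≤ L ∧ ∀ x ∈ D.F k '' closedSquare, ∀ y ∈ D.F k '' closedSquare,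
      |g x - g y| ≤ L * dist x y := by
    intro k
    obtain ⟨C, hC⟩ := D.lipschitz_value hp φ k
    obtain ⟨c, hc, hc'⟩ := (D.isPatchMap k).exists_dist_le
    refine ⟨|C| * c, by positivity, ?_⟩
    rintro _ ⟨x, hx, rfl⟩ _ ⟨y, hy, rfl⟩
    rw [hgF k x hx, hgF k y hy, mul_assoc]
    exact (hC x hx y hy).trans (mul_le_mul (le_abs_self _) (hc' x hx y hy) dist_nonneg
      (abs_nonneg _))
  choose L hL0 hL using hLip
  have hcont : ContinuousOn g (⋃ k, D.F k '' closedSquare) := by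
    refine (locallyFinite_of_finite _).continuousOn_iUnion
      (fun k => (D.isPatchMap k).isCompact_image.isClosed) fun k => ?_
    refine LipschitzOnWith.continuousOn (K := ⟨L k, hL0 k⟩) ?_
    exact LipschitzOnWith.of_dist_le_mul fun x hx y hy => hL k x hx y hy
  obtain ⟨f, hf⟩ := ContinuousMap.exists_restrict_eq D.isCompact_iUnion_image.isClosed
    ⟨_, continuousOn_iff_continuous_domRestrict.1 hcont⟩
  have hfg : ∀ k, ∀ x ∈ D.F k '' closedSquare, f x = g x := fun k x hx =>
    DFunLike.congr_fun hf (⟨x, mem_iUnion.2 ⟨k, hx⟩⟩ : (⋃ k, D.F k '' closedSquare : Set Plane))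
  refine ⟨f, ⟨∑ k, L k, Finset.sum_nonneg fun k _ => hL0 k⟩, f.continuous, fun k x hx => ?_,
    fun k x hx y hy => ?_⟩
  · rw [hfg k _ (mem_image_of_mem _ hx), hgF k x hx]
  · rw [hfg k x hx, hfg k y hy]
    exact (hL k x hx y hy).trans (mul_le_mul_of_nonneg_right
      (Finset.single_le_sum (fun k _ => hL0 k) (Finset.mem_univ k)) dist_nonneg)

lemma mem_Vh_of_tracesMatch (hp : 1 ≤ p) {I : ∀ e, D.IsInterior e → D.Interface e}
    {φ : D.Vpw} (hW : φ ∈ D.vertexConforming) (hT : D.TracesMatch I φ) : φ ∈ D.Vh := by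
  obtain ⟨f, L, hf, hfF, hfL⟩ := D.exists_continuous_extension hp hW hT
  have hH1 : f ∈ H1 D.Ω := by
    refine mem_H1_of_locally_lipschitz (L := L) D.isOpen_Omega
      (D.isCompact_iUnion_image.isBounded.subset D.Omega_subset) hf fun x hx => ?_
    obtain ⟨δ, hδ, hball⟩ := Metric.isOpen_iff.1 D.isOpen_Omega x hx
    refine ⟨_, Metric.ball_mem_nhds x hδ, LipschitzOnWith.of_dist_le_mul fun y hy z hz => ?_⟩
    rw [dist_comm y z]
    have := abs_sub_le_of_segment (fun k => (D.isPatchMap k).isCompact_image.isClosed) hf hfL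
      ((((convex_ball x δ).segment_subset hz hy).trans hball).trans D.Omega_subset)
    exact this
  refine mem_H1_congr hH1 ?_
  have hnull : volume (⋃ k, D.F k '' (closedSquare \ openSquare)) = 0 :=
    measure_iUnion_null fun k => (D.isPatchMap k).volume_boundary
  filter_upwards [ae_restrict_mem D.isOpen_Omega.measurableSet,
    ae_restrict_of_ae (measure_eq_zero_iff_ae_notMem.1 hnull)] with x hx hx'
  obtain ⟨k, y, hy, rfl⟩ := mem_iUnion.1 (D.Omega_subset hx)
  have hyo : y ∈ openSquare := by
    by_contra h
    exact hx' (mem_iUnion.2 ⟨k, y, ⟨hy, h⟩, rfl⟩)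
  rw [hfF k y hy]
  exact D.apply_F φ k hyo

end Multipatch

end BrokenFEEC

end

theorem mainTheorem1 {p K : ℕ} (hp : 1 ≤ p) (D : BrokenFEEC.Multipatch p K)
    (I : ∀ e, D.IsInterior e → D.Interface e) (r : ℕ) (hr : r ≤ p + 1) :
    (∀ lv : List BrokenFEEC.Plane, lv.Perm D.vertices.toList →
      ∀ le : List (Set BrokenFEEC.Plane), le.Perm D.edges.toList →
        (le.map (D.edgeOp I r)).prod * (lv.map (D.vertexOp r)).prod = D.P0 I r) ∧
    LinearMap.IsProj D.Vh (D.P0 I r) ∧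
    D.MomentPreserving r (D.P0 I r) := by
  refine ⟨fun lv hlv le hle => D.prod_eq_P0 I hp hr hlv hle, ⟨fun φ => ?_, fun φ hφ => ?_⟩,
    D.momentPreserving_of_moment hp r _ fun v k P Q hP hQ => ?_⟩
  · exact D.mem_Vh_of_tracesMatch hp (D.edgeProd_mem I hp hr (D.vertexProd_mem hr φ))
      (D.tracesMatch_edgeProd I hp hr (D.vertexProd_mem hr φ))
  · have hW := D.vertexConforming_of_mem_Vh hp hφ
    change D.edgeProd I r (D.vertexProd r φ) = φ
    rw [D.vertexProd_of_vertexConforming hr hW]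
    exact D.edgeProd_eq_self I hp hr hW (D.tracesMatch_of_mem_Vh hp I hφ)
  · change D.moment k P Q (D.edgeProd I r (D.vertexProd r v)) = _
    rw [D.moment_edgeProd I hp hr k hP hQ (D.vertexProd_mem hr v),
      D.moment_vertexProd hp hr k hP hQ]
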